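/- All graphs are finite and simple. For a graph $G$ and $X\subseteq V(G)$, let $B_G(X,1)$ be the set of vertices at distance at most $1$ from $X$ (that is, $X$ together with all neighbours of vertices of $X$). An induced packing of $k$ cycles in $G$ is a set of $k$ pairwise vertex-disjoint cycles of $G$ such that no edge of $G$ joins vertices of two distinct cycles of the set. **Theorem.** There exist a function $f:\mathbb{N}\to\mathbb{N}$ with $f(k)=\mathcal{O}(k\log k)$ (as $k\to\infty$) and a single deterministic algorithm that, given a positive integer $k$ and a graph $G$, finds either an induced packing of $k$ cycles in $G$ or a set $X\subseteq V(G)$ with $|X|\le f(k)$ such that $G-B_G(X,1)$ is a forest. The running time is polynomial in the size of the input, where $G$ is given by its adjacency matrix and $k$ in binary; it is measured as the number of steps of a random access machine whose arithmetic operations are addition and truncated subtraction. -/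

import Mathlib

open Filter Asymptotics

/-!
## Random access machines

Programs act on finitely many scalar variables and arrays of natural numbers (those that the
program text mentions). The only arithmetic operations are addition and truncated subtraction.
There is no multiplication, so in `t` steps numbers grow by at most `O(t)` bits and the unit cost
measure is polynomially equivalent to Turing machine time. The output is written with a print
instruction, so its length is at most the number of steps.
-/

namespace RAM

/-- The memory: scalar variables `var x`, array cells `arr a i`, and the output printed so far. -/
@[ext] structure State where
  var : ℕ → ℕ
  arr : ℕ → ℕ → ℕ
  out : List ℕ

/-- Arithmetic expressions. -/
inductive Expr where
  /-- a numeral -/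
  | const (c : ℕ)
  /-- the scalar variable number `x` -/
  | var (x : ℕ)
  /-- the cell of array number `a` whose index is the value of `i` -/
  | get (a : ℕ) (i : Expr)
  | add (e₁ e₂ : Expr)
  /-- truncated subtraction -/
  | sub (e₁ e₂ : Expr)

/-- The value of an expression. -/
def Expr.eval (s : State) : Expr → ℕ
  | .const c => c
  | .var x => s.var x
  | .get a i => s.arr a (i.eval s)
  | .add e₁ e₂ => e₁.eval s + e₂.eval s
  | .sub e₁ e₂ => e₁.eval s - e₂.eval s

/-- The number of elementary operations performed to evaluate an expression. -/
def Expr.cost : Expr → ℕ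
  | .const _ => 1
  | .var _ => 1
  | .get _ i => i.cost + 1
  | .add e₁ e₂ => e₁.cost + e₂.cost + 1
  | .sub e₁ e₂ => e₁.cost + e₂.cost + 1

/-- Programs. -/
inductive Prog where
  | skip
  /-- `x := e` -/
  | assign (x : ℕ) (e : Expr)
  /-- `a[i] := e` -/
  | store (a : ℕ) (i e : Expr)
  /-- append the value of `e` to the output -/
  | print (e : Expr)
  | seq (P Q : Prog)
  /-- if `e ≠ 0` then `P` else `Q` -/
  | ite (e : Expr) (P Q : Prog)
  /-- while `e ≠ 0` do `P` -/
  | loop (e : Expr) (P : Prog)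

/-- `Exec P s s' t`: started in state `s`, the program `P` halts in state `s'` after exactly
`t` steps. -/
inductive Exec : Prog → State → State → ℕ → Prop where
  | skip (s : State) : Exec .skip s s 1
  | assign (x : ℕ) (e : Expr) (s : State) :
      Exec (.assign x e) s { s with var := Function.update s.var x (e.eval s) } (e.cost + 1)
  | store (a : ℕ) (i e : Expr) (s : State) :
      Exec (.store a i e) s
        { s with
          arr := Function.update s.arr a (Function.update (s.arr a) (i.eval s) (e.eval s)) }
        (i.cost + e.cost + 1)
  | print (e : Expr) (s : State) :
      Exec (.print e) s { s with out := s.out ++ [e.eval s] } (e.cost + 1)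
  | seq {P Q : Prog} {s₁ s₂ s₃ : State} {t₁ t₂ : ℕ} :
      Exec P s₁ s₂ t₁ → Exec Q s₂ s₃ t₂ → Exec (.seq P Q) s₁ s₃ (t₁ + t₂)
  | ite_true {e : Expr} {P Q : Prog} {s s' : State} {t : ℕ} :
      e.eval s ≠ 0 → Exec P s s' t → Exec (.ite e P Q) s s' (e.cost + 1 + t)
  | ite_false {e : Expr} {P Q : Prog} {s s' : State} {t : ℕ} :
      e.eval s = 0 → Exec Q s s' t → Exec (.ite e P Q) s s' (e.cost + 1 + t)
  | loop_true {e : Expr} {P : Prog} {s₁ s₂ s₃ : State} {t₁ t₂ : ℕ} :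
      e.eval s₁ ≠ 0 → Exec P s₁ s₂ t₁ → Exec (.loop e P) s₂ s₃ t₂ →
        Exec (.loop e P) s₁ s₃ (e.cost + 1 + t₁ + t₂)
  | loop_false {e : Expr} {P : Prog} {s : State} :
      e.eval s = 0 → Exec (.loop e P) s s (e.cost + 1)

/-- The initial state on input `l`: array `0` holds `l`, variable `0` holds the length of `l`,
all other cells are `0`, and nothing has been printed. -/
def State.init (l : List ℕ) : State where
  var := fun x => if x = 0 then l.length else 0
  arr := fun a i => if a = 0 then l.getD i 0 else 0
  out := []

/-- The size of an input, a list of natural numbers: its length plus the total number of binary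
digits of its entries. -/
def inputSize (l : List ℕ) : ℕ := l.length + (l.map Nat.size).sum

/-- A search problem with instances `a : α`, candidate solutions `b : β a` and correctness
relation `R` is solvable in polynomial time: a single program, on every instance, halts after a
number of steps that is polynomial in the size of the encoded instance, having printed the code of
a correct solution. -/
def SolvableInPolyTime {α : Type} {β : α → Type} (encIn : α → List ℕ)
    (encOut : ∀ a, β a → List ℕ) (R : ∀ a, β a → Prop) : Prop :=
  ∃ (P : Prog) (p : Polynomial ℕ), ∀ a : α, ∃ (b : β a) (s : State) (t : ℕ),
    Exec P (State.init (encIn a)) s t ∧ t ≤ p.eval (inputSize (encIn a)) ∧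
      s.out = encOut a b ∧ R a b

end RAM

/-!
## Induced packings of cycles
-/

namespace SimpleGraph

/-- The ball `B_G(X, d)`: all vertices at distance at most `d` from `X`. -/
def ballAround {V : Type*} (G : SimpleGraph V) (X : Set V) (d : ℕ) : Set V :=
  {v | ∃ x ∈ X, G.edist v x ≤ d}

/-- An induced packing of `k` cycles: the cycles are pairwise vertex-disjoint and there is no edge
of `G` between two of them. -/
def IsInducedCyclePacking {V : Type*} (G : SimpleGraph V) {k : ℕ}
    (C : Fin k → Σ v : V, G.Walk v v) : Prop :=
  (∀ i, (C i).2.IsCycle) ∧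
    ∀ i j, i ≠ j → ∀ u ∈ (C i).2.support, ∀ w ∈ (C j).2.support, u ≠ w ∧ ¬ G.Adj u w

end SimpleGraph

/-!
## The search problem
-/

namespace InducedPacking

/-- An instance: a finite graph, with vertices numbered `0, …, n - 1`, and a positive integer. -/
structure Instance where
  n : ℕ
  G : SimpleGraph (Fin n)
  k : ℕ
  k_pos : 0 < k

open Classical in
/-- An instance is given as the list consisting of `k`, `n` and the rows of the adjacency matrix. -/
noncomputable def Instance.encode (I : Instance) : List ℕ :=
  I.k :: I.n :: (List.finRange I.n).flatMap fun u =>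
    (List.finRange I.n).map fun v => if I.G.Adj u v then 1 else 0

/-- A candidate solution: `k` closed walks, or a list of vertices. -/
inductive Candidate (I : Instance) : Type where
  | packing (C : Fin I.k → Σ v : Fin I.n, I.G.Walk v v)
  | hitting (X : List (Fin I.n))

/-- A closed walk is written as its length followed by its vertices in order, the first one not
being repeated at the beginning (so a cycle is written with each of its vertices exactly once). -/
def Candidate.encode (I : Instance) : Candidate I → List ℕ
  | .packing C => 1 :: (List.ofFn C).flatMap fun c =>
      c.2.length :: c.2.support.tail.map Fin.val
  | .hitting X => 0 :: X.map Fin.val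

/-- Correctness of a candidate: either an induced packing of `k` cycles, or a set `X` of at most
`f k` vertices such that `G - B_G(X, 1)` is a forest. -/
def Candidate.Correct (f : ℕ → ℕ) (I : Instance) : Candidate I → Prop
  | .packing C => I.G.IsInducedCyclePacking C
  | .hitting X => X.toFinset.card ≤ f I.k ∧
      (I.G.induce (I.G.ballAround {v | v ∈ X} 1)ᶜ).IsAcyclic

end InducedPacking

/-! Let `mu S` be twice the number of edges minus twice the number of vertices of the graph induced
by `S`, and call a set a core if its induced degrees are at least two. The vertex set of a cycle is
a core, so a graph is a forest once it has no nonempty core.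

Building phase. Keep a core `H` and a set `X` that meets every nonempty core inside `H`. Let `U` be
the set of vertices outside `H` and outside the ball around `X`. Grow `H` into `U` by vertices with
exactly one neighbour in the current set; this keeps `mu` and creates no core. If some `y` acquires
two neighbours, add it and prune: `H` gains an ear, `mu` rises by exactly 2, and `X` receives `y`
and at most two new branch vertices (`Inv.ear`). If growth stops without such a `y`, the rest of `U`
is not joined to the grown set. Either it contains no core, and then the ball around `X` meets all
cycles (`Inv.core_eq_empty`), or it yields an induced cycle apart from `H`, which joins `H` while
one of its vertices joins `X` (`Inv.newCycle`). After `k` such cycles they form the packing.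
Otherwise there were `c < k` cycles and `e` ears, with `|X| ≤ c + 3 e` and `mu H ≥ 2 e`.

Extraction phase. It remains to find `k` cycles in `H` or to bound `mu H`. In a core, a tree grown
in order of the number of branch vertices on the path from the root closes a cycle with only
logarithmically many branch vertices (`Grown.exists_depth`, `Grown.isNewCycle`). Degrees in `H` are
at most 4 and its branch vertices lie in `X`, so deleting the closed neighbourhood of such a cycle
lowers `mu` by `O(log |X|)` (`mu_sdiff_closedNbhd`, `Inv.mu_extract`). If the cores run out before
`k` cycles are extracted, then `mu H = O(k log |X|)`. Hence `|X| = O(k log |X|)`, which gives `|X| =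
O(k log k)` (`le_hitBound`).

The algorithm is written as an explicit program and verified by a small program logic (`Runs`), in
which a bound on the iterations of each loop gives a polynomial bound on the running time. -/

set_option linter.unusedSectionVars false

namespace InducedPacking

/-! ### Degree excess, pruning to a core, and growing by leaves. -/

section Degrees

variable {V : Type*} [DecidableEq V] (G : SimpleGraph V) [DecidableRel G.Adj]

/-- The number of neighbours of `v` in `S`. -/
def dg (S : Finset V) (v : V) : ℕ := (S.filter (G.Adj v)).card

/-- Every vertex of `S` has at least two neighbours in `S`. -/
def Core (S : Finset V) : Prop := ∀ v ∈ S, 2 ≤ dg G S v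

/-- The sum over `S` of the degree in `S` minus two. -/
def mu (S : Finset V) : ℤ := ∑ v ∈ S, ((dg G S v : ℤ) - 2)

variable {G}

theorem dg_mono {S T : Finset V} (h : S ⊆ T) (v : V) : dg G S v ≤ dg G T v :=
  Finset.card_le_card (Finset.filter_subset_filter _ h)

theorem dg_insert {S : Finset V} {v : V} (hv : v ∉ S) (u : V) :
    dg G (insert v S) u = dg G S u + if G.Adj u v then 1 else 0 := by
  unfold dg
  rw [Finset.filter_insert]
  split_ifs with h
  · rw [Finset.card_insert_of_notMem (by simp [hv])]
  · rfl

theorem dg_insert_self (S : Finset V) (v : V) : dg G (insert v S) v = dg G S v := by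
  unfold dg
  rw [Finset.filter_insert, if_neg (G.loopless.irrefl v)]

theorem dg_union {S T : Finset V} (h : Disjoint S T) (v : V) :
    dg G (S ∪ T) v = dg G S v + dg G T v := by
  unfold dg
  rw [Finset.filter_union, Finset.card_union_of_disjoint (Finset.disjoint_filter_filter h)]

theorem dg_sdiff_add {S T : Finset V} (h : T ⊆ S) (v : V) :
    dg G (S \ T) v + dg G T v = dg G S v := by
  rw [← dg_union Finset.sdiff_disjoint, Finset.sdiff_union_of_subset h]

theorem dg_eq_zero {S : Finset V} {v : V} : dg G S v = 0 ↔ ∀ u ∈ S, ¬ G.Adj v u := by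
  simp [dg, Finset.filter_eq_empty_iff]

theorem dg_eq_sum (S : Finset V) (v : V) : dg G S v = ∑ u ∈ S, if G.Adj v u then 1 else 0 := by
  simp [dg]

theorem sum_dg_comm (S T : Finset V) : ∑ v ∈ S, dg G T v = ∑ v ∈ T, dg G S v := by
  simp only [dg_eq_sum]
  rw [Finset.sum_comm]
  simp only [G.adj_comm]

theorem mu_empty : mu G (∅ : Finset V) = 0 := rfl

/-- The new vertex brings `dg G S v` edges, and `mu` counts each edge twice and each vertex minus
twice. -/
theorem mu_insert {S : Finset V} {v : V} (hv : v ∉ S) :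
    mu G (insert v S) = mu G S + 2 * dg G S v - 2 := by
  unfold mu
  rw [Finset.sum_insert hv, dg_insert_self]
  have : ∑ u ∈ S, ((dg G (insert v S) u : ℤ) - 2)
      = ∑ u ∈ S, ((dg G S u : ℤ) - 2) + dg G S v := by
    rw [dg_eq_sum S v]
    push_cast
    rw [← Finset.sum_add_distrib]
    refine Finset.sum_congr rfl fun u _ => ?_
    rw [dg_insert hv]
    simp only [G.adj_comm u v]
    push_cast
    ring
  rw [this]
  ring

theorem mu_singleton (v : V) : mu G {v} = -2 := by
  have := mu_insert (G := G) (S := ∅) (v := v) (by simp)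
  simpa [mu_empty, dg] using this

theorem mu_erase {S : Finset V} {v : V} (hv : v ∈ S) :
    mu G S = mu G (S.erase v) + 2 * dg G S v - 2 := by
  have := mu_insert (G := G) (S := S.erase v) (v := v) (by simp)
  rw [← dg_insert_self (S.erase v) v, Finset.insert_erase hv] at this
  exact this

theorem Core.mu_nonneg {S : Finset V} (h : Core G S) : 0 ≤ mu G S :=
  Finset.sum_nonneg fun v hv => by have := h v hv; omega

theorem Core.union {S T : Finset V} (hS : Core G S) (hT : Core G T) : Core G (S ∪ T) := by
  intro v hv
  rcases Finset.mem_union.1 hv with h | h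
  · exact (hS v h).trans (dg_mono Finset.subset_union_left v)
  · exact (hT v h).trans (dg_mono Finset.subset_union_right v)

theorem Core.insert {S : Finset V} (hS : Core G S) {v : V} (hv : 2 ≤ dg G S v) :
    Core G (insert v S) := by
  intro u hu
  rcases Finset.mem_insert.1 hu with rfl | h
  · rwa [dg_insert_self]
  · exact (hS u h).trans (dg_mono (Finset.subset_insert _ _) u)

variable (G) in
/-- `Pruned G S T`: `T` arises from `S` by repeatedly deleting a vertex with at most one
neighbour in the current set. -/
inductive Pruned (S : Finset V) : Finset V → Prop
  | refl : Pruned S S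
  | step {T : Finset V} {v : V} : Pruned S T → v ∈ T → dg G T v ≤ 1 → Pruned S (T.erase v)

theorem Pruned.subset {S T : Finset V} (h : Pruned G S T) : T ⊆ S := by
  induction h with
  | refl => exact subset_rfl
  | step _ _ _ ih => exact (Finset.erase_subset _ _).trans ih

/-- A vertex of a core keeps two neighbours in every set that contains the core, so pruning never
deletes it. A pruned set that is a core is therefore the largest core of the original set. -/
theorem Pruned.core_subset {S T K : Finset V} (h : Pruned G S T) (hK : Core G K) (hKS : K ⊆ S) :
    K ⊆ T := by
  induction h with
  | refl => exact hKS
  | @step T v _ hv hd ih =>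
    refine Finset.subset_erase.2 ⟨ih, fun hvK => ?_⟩
    have := hK v hvK
    have := dg_mono (G := G) ih v
    omega

theorem Pruned.mu_le {S T : Finset V} (h : Pruned G S T) : mu G S ≤ mu G T := by
  induction h with
  | refl => exact le_rfl
  | @step T v _ hv hd ih =>
    have := mu_erase (G := G) hv
    omega

/-- The vertex deleted last is isolated, so its deletion alone raises `mu` from -2 to 0. -/
theorem Pruned.mu_le_of_empty {S : Finset V} (h : Pruned G S ∅) (hS : S ≠ ∅) : mu G S ≤ -2 := by
  suffices ∀ T, Pruned G S T → T = ∅ → mu G S ≤ -2 from this _ h rfl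
  intro T h hT
  induction h with
  | refl => exact absurd hT hS
  | @step T v h' hv hd _ =>
    have : T = {v} := by
      refine Finset.eq_singleton_iff_unique_mem.2 ⟨hv, fun x hx => ?_⟩
      by_contra hne
      have : x ∈ T.erase v := Finset.mem_erase.2 ⟨hne, hx⟩
      simp [hT] at this
    have h2 := h'.mu_le
    rwa [this, mu_singleton] at h2

/-- A vertex outside a pruned core has at most one neighbour in it. -/
theorem Pruned.dg_le_one {S T : Finset V} (h : Pruned G S T) (hT : Core G T) {v : V}
    (hv : v ∈ S) (hvT : v ∉ T) : dg G T v ≤ 1 := by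
  by_contra hlt
  have hc := hT.insert (v := v) (by omega)
  exact hvT (h.core_subset hc (Finset.insert_subset hv h.subset) (Finset.mem_insert_self _ _))

variable (G) in
/-- The value of a vertex outside `S` next to `S`: the depth of its neighbours in `S`, plus one if
it is a branch vertex of `U`. -/
def gval (U S : Finset V) (D : V → ℕ) (v : V) : ℕ :=
  (∑ u ∈ S.filter (G.Adj v), D u) + if 3 ≤ dg G U v then 1 else 0

variable (G) in
/-- `Grown G U A S D`: `S` arises from `A` by repeatedly adding a vertex of `U` that has exactly
one neighbour in the current set and the least value among all such vertices, when no vertex of `U`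
has two neighbours in the current set; `D` records the values. -/
inductive Grown (U A : Finset V) : Finset V → (V → ℕ) → Prop
  | base {D : V → ℕ} (hD : ∀ v, D v = 0) : Grown U A A D
  | step {S : Finset V} {D : V → ℕ} {v : V} : Grown U A S D →
      (∀ u ∈ U, u ∉ S → dg G S u ≤ 1) → v ∈ U → v ∉ S → dg G S v = 1 →
      (∀ u ∈ U, u ∉ S → dg G S u = 1 → gval G U S D v ≤ gval G U S D u) →
      Grown U A (insert v S) (Function.update D v (gval G U S D v))

variable {U A S : Finset V} {D : V → ℕ}

theorem Grown.subset (h : Grown G U A S D) : A ⊆ S := by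
  induction h with
  | base => exact subset_rfl
  | step _ _ _ _ _ _ ih => exact ih.trans (Finset.subset_insert _ _)

theorem Grown.subset_union (h : Grown G U A S D) : S ⊆ A ∪ U := by
  induction h with
  | base => exact Finset.subset_union_left
  | step _ _ hv _ _ _ ih =>
    exact Finset.insert_subset (Finset.mem_union_right _ hv) ih

theorem Grown.mu_eq (h : Grown G U A S D) : mu G S = mu G A := by
  induction h with
  | base => rfl
  | step _ _ _ hv hd _ ih =>
    rw [mu_insert hv, hd, ih]
    push_cast
    ring

/-- The last vertex added has one neighbour in the grown set, so it cannot belong to `K`; peel the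
added vertices off in reverse order. -/
theorem Grown.core_subset (h : Grown G U A S D) {K : Finset V}
    (hK : ∀ v ∈ K, v ∉ A → 2 ≤ dg G K v) (hKS : K ⊆ S) : K ⊆ A := by
  induction h with
  | base => exact hKS
  | @step S D v h _ _ hv hd _ ih =>
    refine ih fun x hx => ?_
    rcases Finset.mem_insert.1 (hKS hx) with rfl | hxS
    · have h1 := hK x hx fun hA => hv (h.subset hA)
      have h2 := dg_mono (G := G) hKS x
      rw [dg_insert_self] at h2
      omega
    · exact hxS

/-- Each added vertex has at most one neighbour among the earlier members of `Z`, so it contributes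
at most zero to `mu`. -/
theorem Grown.mu_le (h : Grown G U A S D) {Z : Finset V} (hAZ : A ⊆ Z) (hZ : Z ⊆ S) :
    mu G Z ≤ mu G A := by
  induction h generalizing Z with
  | base => rw [Finset.Subset.antisymm hZ hAZ]
  | @step S D v h _ _ hv hd _ ih =>
    by_cases hvZ : v ∈ Z
    · have h1 := mu_erase (G := G) hvZ
      have h2 : Z.erase v ⊆ S := by
        intro x hx
        rcases Finset.mem_insert.1 (hZ (Finset.mem_of_mem_erase hx)) with rfl | h'
        · simp at hx
        · exact h'
      have h3 := ih (Finset.subset_erase.2 ⟨hAZ, fun hA => hv (h.subset hA)⟩) h2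
      have h4 := dg_mono (G := G) hZ v
      rw [dg_insert_self] at h4
      omega
    · exact ih hAZ fun x hx => (Finset.mem_insert.1 (hZ hx)).resolve_left
        fun e => hvZ (e ▸ hx)

/-- A set grown from a single vertex induces a tree, and a nonempty forest has fewer edges than
vertices. -/
theorem Grown.mu_le_of_singleton {r : V} (h : Grown G U {r} S D) {Z : Finset V} (hne : Z.Nonempty)
    (hZ : Z ⊆ S) : mu G Z ≤ -2 := by
  induction h generalizing Z with
  | base =>
    rw [(Finset.subset_singleton_iff.1 hZ).resolve_left hne.ne_empty, mu_singleton]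
  | @step S D v h _ _ hv hd _ ih =>
    by_cases hvZ : v ∈ Z
    · have h1 := mu_erase (G := G) hvZ
      have h2 : Z.erase v ⊆ S := by
        intro x hx
        rcases Finset.mem_insert.1 (hZ (Finset.mem_of_mem_erase hx)) with rfl | h'
        · simp at hx
        · exact h'
      have h4 := dg_mono (G := G) hZ v
      rw [dg_insert_self] at h4
      rcases (Z.erase v).eq_empty_or_nonempty with he | hne'
      · have : Z = {v} := by
          rw [← Finset.insert_erase hvZ, he]; rfl
        rw [this, mu_singleton]
      · have := ih hne' h2
        omega
    · exact ih hne fun x hx => (Finset.mem_insert.1 (hZ hx)).resolve_left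
        fun e => hvZ (e ▸ hx)

/-- If no vertex of `U` has three neighbours in `A`, growing stops before one has three. -/
theorem Grown.dg_le_two (h : Grown G U A S D) (hA : ∀ u ∈ U, u ∉ A → dg G A u ≤ 2) :
    ∀ u ∈ U, u ∉ S → dg G S u ≤ 2 := by
  cases h with
  | base => exact hA
  | step _ h1 _ hv _ _ =>
    -- Before the last addition every outside vertex had at most one neighbour in the set, and the
    -- addition supplies at most one more.
    intro u hu huS
    have := h1 u hu fun h => huS (Finset.mem_insert_of_mem h)
    rw [dg_insert hv]
    split_ifs <;> omega

end Degrees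

end InducedPacking

namespace InducedPacking

/-! ### Cycles with logarithmically many branch vertices in a core. -/

section Cycles

variable {V : Type*} [DecidableEq V] {G : SimpleGraph V} [DecidableRel G.Adj]
  {U A S : Finset V} {D : V → ℕ}

variable (G) in
/-- The number of vertices of `S` with at least three neighbours in `U`. -/
def branch (U S : Finset V) : ℕ := (S.filter fun v => 3 ≤ dg G U v).card

theorem branch_mono {S T : Finset V} (h : S ⊆ T) : branch G U S ≤ branch G U T :=
  Finset.card_le_card (Finset.filter_subset_filter _ h)

theorem branch_mono_left {U' : Finset V} (h : U ⊆ U') : branch G U S ≤ branch G U' S :=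
  Finset.card_le_card (Finset.monotone_filter_right _ fun _ _ hv => hv.trans (dg_mono h _))

theorem branch_insert {v : V} (hv : v ∉ S) :
    branch G U (insert v S) = branch G U S + if 3 ≤ dg G U v then 1 else 0 := by
  unfold branch
  rw [Finset.filter_insert]
  split_ifs
  · rw [Finset.card_insert_of_notMem (by simp [hv])]
  · rfl

theorem gval_of_unique {v w : V} (hd : dg G S v = 1) (hw : w ∈ S) (ha : G.Adj v w) :
    gval G U S D v = D w + if 3 ≤ dg G U v then 1 else 0 := by
  obtain ⟨x, hx⟩ := Finset.card_eq_one.1 hd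
  have : w ∈ S.filter (G.Adj v) := by simp [hw, ha]
  rw [hx, Finset.mem_singleton] at this
  subst this
  rw [gval, hx, Finset.sum_singleton]

theorem exists_adj_of_dg_pos {v : V} (hd : 0 < dg G S v) : ∃ w ∈ S, G.Adj v w := by
  obtain ⟨w, hw⟩ := Finset.card_pos.1 hd
  exact ⟨w, (Finset.mem_filter.1 hw).1, (Finset.mem_filter.1 hw).2⟩

theorem dg_pos_of_adj {v w : V} (hw : w ∈ S) (ha : G.Adj v w) : 0 < dg G S v :=
  Finset.card_pos.2 ⟨w, by simp [hw, ha]⟩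

/-- A set whose vertices outside `F` have two neighbours in it has few branch vertices. -/
theorem Grown.branch_le {r : V} (h : Grown G U {r} S D) {K F : Finset V} (hK : K ⊆ S)
    (hF : ∀ v ∈ K, v ∉ F → 2 ≤ dg G K v) : branch G U K ≤ ∑ v ∈ F, (D v + 1) := by
  induction h generalizing K F with
  | @base D hD =>
    rcases Finset.subset_singleton_iff.1 hK with rfl | rfl
    · simp [branch]
    · have hr : r ∈ F := by
        by_contra hr
        have := hF r (by simp) hr
        rw [← insert_empty_eq, dg_insert_self] at this
        simp [dg] at this
      -- The summand 1 pays for the root, which may be a branch vertex although its depth is zero.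
      calc branch G U {r} ≤ 1 := (Finset.card_filter_le _ _).trans (by simp)
        _ ≤ D r + 1 := by omega
        _ ≤ _ := Finset.single_le_sum (f := fun v => D v + 1) (fun _ _ => by omega) hr
  | @step S D v h _ _ hv hd _ ih =>
    have hupd : ∀ F : Finset V, v ∉ F →
        ∑ u ∈ F, (Function.update D v (gval G U S D v) u + 1) = ∑ u ∈ F, (D u + 1) := by
      intro F hvF
      refine Finset.sum_congr rfl fun u hu => ?_
      rw [Function.update_of_ne (ne_of_mem_of_not_mem hu hvF)]
    by_cases hvK : v ∈ K
    · have hKS : K.erase v ⊆ S := by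
        intro x hx
        rcases Finset.mem_insert.1 (hK (Finset.mem_of_mem_erase hx)) with rfl | h'
        · simp at hx
        · exact h'
      -- A last-added vertex of `K` is a leaf, so it lies in `F`. Its parent `w` takes over its role
      -- there: the depths of `v` and `w` differ exactly by the contribution of `v` to the branch
      -- count.
      have hvF : v ∈ F := by
        by_contra hvF
        have h1 := hF v hvK hvF
        have h2 := dg_mono (G := G) hK v
        rw [dg_insert_self] at h2
        omega
      obtain ⟨w, hw, ha⟩ := exists_adj_of_dg_pos (G := G) (S := S) (v := v) (by omega)
      have huniq : ∀ x ∈ S, G.Adj v x → x = w := by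
        obtain ⟨z, hz⟩ := Finset.card_eq_one.1 hd
        intro x hx hax
        have h1 : x ∈ S.filter (G.Adj v) := by simp [hx, hax]
        have h2 : w ∈ S.filter (G.Adj v) := by simp [hw, ha]
        rw [hz, Finset.mem_singleton] at h1 h2
        rw [h1, h2]
      have hK' : ∀ x ∈ K.erase v, x ∉ insert w (F.erase v) → 2 ≤ dg G (K.erase v) x := by
        intro x hx hxF
        simp only [Finset.mem_insert, Finset.mem_erase, not_or, not_and] at hxF hx
        have h1 := hF x hx.2 (hxF.2 hx.1)
        have h2 : dg G K x = dg G (K.erase v) x + if G.Adj x v then 1 else 0 := by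
          conv_lhs => rw [← Finset.insert_erase hvK]
          exact dg_insert (by simp) x
        rw [if_neg] at h2
        · omega
        · intro hxv
          exact hxF.1 (huniq x (hKS (Finset.mem_erase.2 hx)) hxv.symm)
      have h1 := ih hKS hK'
      have h2 : ∑ u ∈ insert w (F.erase v), (D u + 1) ≤ (D w + 1) + ∑ u ∈ F.erase v, (D u + 1) := by
        by_cases hwF : w ∈ F.erase v
        · rw [Finset.insert_eq_of_mem hwF]
          omega
        · rw [Finset.sum_insert hwF]
      have h3 : branch G U K = branch G U (K.erase v) + if 3 ≤ dg G U v then 1 else 0 := by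
        conv_lhs => rw [← Finset.insert_erase hvK]
        exact branch_insert (by simp)
      rw [← Finset.add_sum_erase F _ hvF, hupd _ (by simp), Function.update_self,
        gval_of_unique hd hw ha]
      omega
    · have hKS : K ⊆ S := fun x hx => (Finset.mem_insert.1 (hK hx)).resolve_left
        fun e => hvK (e ▸ hx)
      have h1 := ih (F := F.erase v) hKS fun x hx hxF => hF x hx fun h' => hxF
        (Finset.mem_erase.2 ⟨fun e => hvK (e ▸ hx), h'⟩)
      refine h1.trans ?_
      rw [← hupd _ (by simp)]
      exact Finset.sum_le_sum_of_subset (Finset.erase_subset _ _)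

/-- A candidate hangs either on an old vertex, and then keeps its value, or on the vertex just
added. -/
theorem gval_insert {u v : V} (hvS : v ∉ S) (h : dg G (insert v S) u = 1) (hu : u ∉ insert v S)
    (c : ℕ) :
    (dg G S u = 1 ∧ gval G U (insert v S) (Function.update D v c) u = gval G U S D u) ∨
    gval G U (insert v S) (Function.update D v c) u = c + if 3 ≤ dg G U u then 1 else 0 := by
  by_cases ha : G.Adj u v
  · right
    rw [gval_of_unique h (Finset.mem_insert_self _ _) ha, Function.update_self]
  · left
    have hd : dg G S u = 1 := by
      rw [dg_insert hvS, if_neg ha] at h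
      exact h
    obtain ⟨w, hw, haw⟩ := exists_adj_of_dg_pos (G := G) (S := S) (v := u) (by omega)
    refine ⟨hd, ?_⟩
    rw [gval_of_unique h (Finset.mem_insert_of_mem hw) haw, gval_of_unique hd hw haw,
      Function.update_of_ne]
    rintro rfl
    exact hvS hw

/-- The depth of a tree grown in a core is logarithmic in the number of branch vertices that it
has or that are about to be added at the current depth. -/
theorem Grown.exists_depth {r : V} (h : Grown G U {r} S D) (hr : r ∈ U) (hU : Core G U) :
    ∃ d, (∀ v ∈ S, D v ≤ d) ∧ (∀ u ∈ U, u ∉ S → dg G S u = 1 → d ≤ gval G U S D u) ∧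
      2 ^ d ≤ branch G U S + ((U \ S).filter fun u =>
        3 ≤ dg G U u ∧ ∃ w ∈ S, G.Adj u w ∧ D w + 1 ≤ d).card + 1 := by
  induction h with
  | base hD => exact ⟨0, fun v _ => by simp [hD], fun _ _ _ _ => Nat.zero_le _, by simp⟩
  | @step S D v h hle hvU hvS hd hmin ih =>
    obtain ⟨d, h1, h2, h3⟩ := ih
    obtain ⟨w, hw, ha⟩ := exists_adj_of_dg_pos (G := G) (S := S) (v := v) (by omega)
    have hv1 := h2 v hvU hvS hd
    have hv2 := gval_of_unique (U := U) (D := D) hd hw ha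
    have hwd := h1 w hw
    have hSU : S ⊆ U := h.subset_union.trans (by simp [hr])
    -- If the least value is `d`, level `d` is not exhausted: a branch vertex `v` merely moves from
    -- the pending set into `S`. Otherwise `d` must increase by one, and the count must double.
    rcases hv1.eq_or_lt with heq | hlt
    · refine ⟨d, ?_, ?_, ?_⟩
      · intro x hx
        rcases Finset.mem_insert.1 hx with rfl | hx
        · simp [← heq]
        · rw [Function.update_of_ne (ne_of_mem_of_not_mem hx hvS)]
          exact h1 x hx
      · intro u huU huS hdu
        rcases gval_insert (U := U) (D := D) hvS hdu huS (gval G U S D v) with ⟨h4, h5⟩ | h5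
        · rw [h5]
          exact h2 u huU (fun h => huS (Finset.mem_insert_of_mem h)) h4
        · rw [h5]
          omega
      · refine h3.trans ?_
        rw [branch_insert hvS]
        have hsub : ((U \ S).filter fun u =>
            3 ≤ dg G U u ∧ ∃ w ∈ S, G.Adj u w ∧ D w + 1 ≤ d).erase v ⊆
          ((U \ insert v S).filter fun u => 3 ≤ dg G U u ∧ ∃ w ∈ insert v S, G.Adj u w ∧
            Function.update D v (gval G U S D v) w + 1 ≤ d) := by
          intro u hu
          simp only [Finset.mem_erase, Finset.mem_filter, Finset.mem_sdiff] at hu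
          obtain ⟨huv, ⟨huU, huS⟩, hu3, x, hx, hux, hxd⟩ := hu
          simp only [Finset.mem_filter, Finset.mem_sdiff, Finset.mem_insert, not_or]
          refine ⟨⟨huU, huv, huS⟩, hu3, x, Or.inr hx, hux, ?_⟩
          rwa [Function.update_of_ne (ne_of_mem_of_not_mem hx hvS)]
        have hcard := Finset.card_le_card hsub
        by_cases hb : 3 ≤ dg G U v
        · have := Finset.pred_card_le_card_erase (s := (U \ S).filter fun u =>
            3 ≤ dg G U u ∧ ∃ w ∈ S, G.Adj u w ∧ D w + 1 ≤ d) (a := v)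
          rw [if_pos hb]
          omega
        · rw [Finset.erase_eq_of_notMem (by simp [hb])] at hcard
          omega
    · have hval : gval G U S D v = d + 1 := by
        split_ifs at hv2 <;> omega
      -- Since `v` has least value `d + 1` and depths in `S` are at most `d`, every candidate is a
      -- branch vertex hanging on a vertex of depth `d`.
      have hall : ∀ u ∈ U, u ∉ S → dg G S u = 1 → 3 ≤ dg G U u ∧ ∃ w ∈ S, G.Adj u w ∧ D w = d := by
        intro u huU huS hdu
        obtain ⟨x, hx, hax⟩ := exists_adj_of_dg_pos (G := G) (S := S) (v := u) (by omega)
        have h4 := gval_of_unique (U := U) (D := D) hdu hx hax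
        have h5 := hmin u huU huS hdu
        have h6 := h1 x hx
        split_ifs at h4 with h7
        · exact ⟨h7, x, hx, hax, by omega⟩
        · omega
      have hpend : ((U \ S).filter fun u =>
          3 ≤ dg G U u ∧ ∃ w ∈ S, G.Adj u w ∧ D w + 1 ≤ d) = ∅ := by
        rw [Finset.filter_eq_empty_iff]
        rintro u hu ⟨-, x, hx, hux, hxd⟩
        rw [Finset.mem_sdiff] at hu
        have h4 := dg_pos_of_adj hx hux
        have h5 := hle u hu.1 hu.2
        have h6 := gval_of_unique (U := U) (D := D) (by omega : dg G S u = 1) hx hux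
        have h7 := h2 u hu.1 hu.2 (by omega)
        have h8 := hmin u hu.1 hu.2 (by omega)
        split_ifs at h6 <;> omega
      rw [hpend] at h3
      set E := (U \ S).filter fun u => dg G S u = 1 with hE
      -- Each outside neighbour sends exactly one edge into `S`, so `E.card` counts the edges
      -- leaving `S`. As `mu G S = -2`, it is at least `branch G U S + 2`. All of `E` is pending at
      -- level `d + 1`, so the new total is at least twice the old one.
      have hEcard : (E.card : ℤ) = ∑ x ∈ S, ((dg G U x : ℤ) - 2) - mu G S := by
        have h4 : E.card = ∑ u ∈ U \ S, dg G S u := by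
          rw [hE, Finset.card_filter]
          refine Finset.sum_congr rfl fun u hu => ?_
          rw [Finset.mem_sdiff] at hu
          have := hle u hu.1 hu.2
          split_ifs <;> omega
        rw [h4, sum_dg_comm, mu, ← Finset.sum_sub_distrib]
        push_cast
        refine Finset.sum_congr rfl fun x _ => ?_
        have := dg_sdiff_add (G := G) hSU x
        omega
      have hmuS : mu G S = -2 := by rw [h.mu_eq, mu_singleton]
      have hbr : (branch G U S : ℤ) ≤ ∑ x ∈ S, ((dg G U x : ℤ) - 2) := by
        rw [branch, Finset.card_filter]
        push_cast
        refine Finset.sum_le_sum fun x hx => ?_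
        have := hU x (hSU hx)
        split_ifs <;> omega
      have hvE : v ∈ E := by simp [hE, hvU, hvS, hd]
      refine ⟨d + 1, ?_, ?_, ?_⟩
      · intro x hx
        rcases Finset.mem_insert.1 hx with rfl | hx
        · simp [hval]
        · rw [Function.update_of_ne (ne_of_mem_of_not_mem hx hvS)]
          exact (h1 x hx).trans (by omega)
      · intro u huU huS hdu
        rcases gval_insert (U := U) (D := D) hvS hdu huS (gval G U S D v) with ⟨h4, h5⟩ | h5
        · rw [h5, ← hval]
          exact hmin u huU (fun h => huS (Finset.mem_insert_of_mem h)) h4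
        · rw [h5]
          omega
      · rw [branch_insert hvS, if_pos (hall v hvU hvS hd).1, pow_succ]
        have hsub : E.erase v ⊆
          ((U \ insert v S).filter fun u => 3 ≤ dg G U u ∧ ∃ w ∈ insert v S, G.Adj u w ∧
            Function.update D v (gval G U S D v) w + 1 ≤ d + 1) := by
          intro u hu
          simp only [hE, Finset.mem_erase, Finset.mem_filter, Finset.mem_sdiff] at hu
          obtain ⟨huv, ⟨huU, huS⟩, hu1⟩ := hu
          obtain ⟨h4, x, hx, hux, hxd⟩ := hall u huU huS hu1
          simp only [Finset.mem_filter, Finset.mem_sdiff, Finset.mem_insert, not_or]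
          refine ⟨⟨huU, huv, huS⟩, h4, x, Or.inr hx, hux, ?_⟩
          rw [Function.update_of_ne (ne_of_mem_of_not_mem hx hvS)]
          omega
        have hcard := Finset.card_le_card hsub
        rw [Finset.card_erase_of_mem hvE] at hcard
        simp at h3
        omega

variable (G) in
/-- The outcome of growing a tree in the core `U` until a vertex closes a cycle: `Z` is the vertex
set of an induced cycle through `y`. -/
structure IsNewCycle (U Z : Finset V) (y : V) : Prop where
  subset : Z ⊆ U
  mem : y ∈ Z
  dg_eq : ∀ v ∈ Z, dg G Z v = 2
  -- Putting `y` into the hitting set thus destroys every core inside `Z`.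
  core_mem : ∀ K, Core G K → K ⊆ Z → K.Nonempty → y ∈ K
  dg_le : ∀ v ∈ U, v ∉ Z → ¬ G.Adj v y → dg G Z v ≤ 2
  branch_le : ∃ d, branch G U Z ≤ 2 * d + 3 ∧ 2 ^ d ≤ branch G U U + 1

/-- The tree together with `y` has `mu` zero, so it does not prune to the empty set. Subsets of the
tree have negative `mu`, so every core contains `y`. Removing `y` from `Z` leaves `mu` at most -2,
which forces `mu G Z ≤ 0`; in a core all summands are nonnegative, so every degree equals two. -/
theorem Grown.isNewCycle {r y : V} (h : Grown G U {r} S D) (hr : r ∈ U) (hU : Core G U)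
    (hyU : y ∈ U) (hyS : y ∉ S) (hd : dg G S y = 2) {Z : Finset V}
    (hP : Pruned G (insert y S) Z) (hZ : Core G Z) : IsNewCycle G U Z y := by
  have hSU : S ⊆ U := h.subset_union.trans (by simp [hr])
  have hZU : Z ⊆ U := hP.subset.trans (Finset.insert_subset hyU hSU)
  have hcm : ∀ K, Core G K → K ⊆ insert y S → K.Nonempty → y ∈ K := by
    intro K hK hKS hne
    by_contra hy
    have h1 := h.mu_le_of_singleton hne fun x hx => (Finset.mem_insert.1 (hKS hx)).resolve_left
        fun e => hy (e ▸ hx)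
    have := hK.mu_nonneg
    omega
  have hmu : mu G (insert y S) = 0 := by
    rw [mu_insert hyS, h.mu_eq, mu_singleton, hd]; norm_num
  have hZne : Z.Nonempty := by
    rw [Finset.nonempty_iff_ne_empty]
    rintro rfl
    have := hP.mu_le_of_empty (by simp)
    omega
  have hyZ := hcm Z hZ hP.subset hZne
  have hZS : Z.erase y ⊆ S := fun x hx => (Finset.mem_insert.1
    (hP.subset (Finset.mem_of_mem_erase hx))).resolve_left (Finset.ne_of_mem_erase hx)
  have hdy : dg G Z y ≤ 2 := by
    have := dg_mono (G := G) hP.subset y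
    rw [dg_insert_self] at this
    omega
  have hmuZ : mu G Z ≤ 0 := by
    have h1 := mu_erase (G := G) hyZ
    have hne : (Z.erase y).Nonempty := by
      obtain ⟨w, hw, ha⟩ := exists_adj_of_dg_pos (G := G) (S := Z) (v := y)
        (by have := hZ y hyZ; omega)
      exact ⟨w, Finset.mem_erase.2 ⟨ha.ne.symm, hw⟩⟩
    have h2 := h.mu_le_of_singleton hne hZS
    omega
  refine ⟨hZU, hyZ, ?_, fun K hK hKZ => hcm K hK (hKZ.trans hP.subset), ?_, ?_⟩
  · have h0 : mu G Z = 0 := le_antisymm hmuZ hZ.mu_nonneg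
    rw [mu, Finset.sum_eq_zero_iff_of_nonneg (fun v hv => by have := hZ v hv; omega)] at h0
    intro v hv
    have := h0 v hv
    omega
  · intro v hvU hvZ hvy
    by_cases hvS : v ∈ insert y S
    · exact (hP.dg_le_one hZ hvS hvZ).trans (by omega)
    · rw [Finset.mem_insert, not_or] at hvS
      have h1 := dg_mono (G := G) hP.subset v
      rw [dg_insert hyS, if_neg hvy] at h1
      have h2 := h.dg_le_two (fun u _ hu => ?_) v hvU hvS.2
      · omega
      · exact (Finset.card_filter_le _ _).trans (by simp)
  · obtain ⟨d, h1, -, h3⟩ := h.exists_depth hr hU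
    refine ⟨d, ?_, ?_⟩
    · have h4 : branch G U Z ≤ branch G U (Z.erase y) + 1 := by
        conv_lhs => rw [← Finset.insert_erase hyZ]
        rw [branch_insert (by simp)]
        split_ifs <;> omega
      -- Only the two neighbours of `y` can have fewer than two neighbours in `Z` without `y`. Each
      -- accounts for at most `d + 1` branch vertices, and `y` itself for one more, which gives `2 *
      -- d + 3`.
      have h5 := h.branch_le (K := Z.erase y) (F := S.filter (G.Adj y)) hZS fun v hv hvF => by
        have h6 := hZ v (Finset.mem_of_mem_erase hv)
        rw [← Finset.insert_erase hyZ, dg_insert (by simp), if_neg] at h6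
        · exact h6
        · intro ha
          exact hvF (Finset.mem_filter.2 ⟨hZS hv, ha.symm⟩)
      have h6 : ∑ v ∈ S.filter (G.Adj y), (D v + 1) ≤ (S.filter (G.Adj y)).card * (d + 1) := by
        rw [← smul_eq_mul]
        exact Finset.sum_le_card_nsmul _ _ _ fun v hv => by
          have := h1 v (Finset.mem_filter.1 hv).1
          omega
      have h7 : (S.filter (G.Adj y)).card = 2 := hd
      rw [h7] at h6
      omega
    · refine h3.trans (Nat.add_le_add_right ?_ 1)
      unfold branch
      rw [← Finset.card_union_of_disjoint]
      · refine Finset.card_le_card fun u hu => ?_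
        simp only [Finset.mem_union, Finset.mem_filter, Finset.mem_sdiff] at hu ⊢
        rcases hu with hu | hu
        · exact ⟨hSU hu.1, hu.2⟩
        · exact ⟨hu.1.1, hu.2.1⟩
      · rw [Finset.disjoint_left]
        intro u hu hu'
        simp only [Finset.mem_filter, Finset.mem_sdiff] at hu hu'
        exact hu'.1.2 hu.1

/-- Growing a tree in a core always ends with a vertex that closes a cycle. -/
theorem Grown.exists_dg_ne_zero {r : V} (h : Grown G U {r} S D) (hr : r ∈ U) (hU : Core G U) :
    ∃ u ∈ U, u ∉ S ∧ dg G S u ≠ 0 := by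
  by_contra! hcon
  have hSU : S ⊆ U := h.subset_union.trans (by simp [hr])
  -- With no edge leaving `S`, the tree would inherit the degrees of `U` and be a core, against its
  -- negative `mu`.
  have hS : Core G S := by
    intro v hv
    have h1 := hU v (hSU hv)
    rw [← dg_sdiff_add hSU] at h1
    have h2 : dg G (U \ S) v = 0 := by
      rw [dg_eq_zero]
      intro u hu ha
      rw [Finset.mem_sdiff] at hu
      exact dg_eq_zero.1 (hcon u hu.1 hu.2) v hv ha.symm
    omega
  have h1 := h.mu_le_of_singleton ⟨r, h.subset (by simp)⟩ subset_rfl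
  have := hS.mu_nonneg
  omega

/-- Deleting the closed neighbourhood of a cycle with few branch vertices. -/
theorem mu_sdiff_closedNbhd {Z : Finset V} (h4 : ∀ v ∈ U, dg G U v ≤ 4)
    (hZU : Z ⊆ U) (hZ : ∀ v ∈ Z, dg G Z v = 2) :
    mu G U - 16 * branch G U Z ≤ mu G (U.filter fun v => v ∉ Z ∧ dg G Z v = 0) := by
  set T := U.filter fun v => v ∉ Z ∧ dg G Z v = 0 with hT
  have hTU : T ⊆ U := Finset.filter_subset _ _
  set N := (U \ Z).filter fun v => dg G Z v ≠ 0 with hN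
  have hUT : U \ T = Z ∪ N := by
    ext v
    simp only [hT, hN, Finset.mem_sdiff, Finset.mem_filter, Finset.mem_union]
    have := @hZU v
    tauto
  have hZN : Disjoint Z N := by
    rw [Finset.disjoint_left]
    intro v hv hvN
    simp only [hN, Finset.mem_filter, Finset.mem_sdiff] at hvN
    exact hvN.1.2 hv
  have e1 : mu G T = ∑ v ∈ T, ((dg G U v : ℤ) - 2) - ∑ v ∈ U \ T, (dg G T v : ℤ) := by
    have : ∑ v ∈ U \ T, (dg G T v : ℤ) = ∑ v ∈ T, (dg G (U \ T) v : ℤ) := by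
      exact_mod_cast sum_dg_comm (G := G) (U \ T) T
    rw [this, mu, ← Finset.sum_sub_distrib]
    refine Finset.sum_congr rfl fun v _ => ?_
    have := dg_sdiff_add (G := G) hTU v
    omega
  have e2 : mu G U = ∑ v ∈ T, ((dg G U v : ℤ) - 2) + ∑ v ∈ U \ T, ((dg G U v : ℤ) - 2) := by
    rw [mu, add_comm, Finset.sum_sdiff hTU]
  -- This sum is the loss of `mu`. With `b` branch vertices, `Z` loses at most `2 b`. There are at
  -- most `2 b` neighbours of `Z`, and each costs at most `(4 - 2) + 4 = 6`. The total `14 b` lies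
  -- within the stated 16.
  have e3 : ∑ v ∈ U \ T, (((dg G U v : ℤ) - 2) + dg G T v) ≤ 16 * branch G U Z := by
    rw [hUT, Finset.sum_union hZN]
    have b1 : ∑ v ∈ Z, (((dg G U v : ℤ) - 2)) ≤ 2 * branch G U Z := by
      rw [branch, Finset.card_filter]
      push_cast
      rw [Finset.mul_sum]
      refine Finset.sum_le_sum fun v hv => ?_
      have := h4 v (hZU hv)
      split_ifs <;> omega
    have b2 : ∑ v ∈ Z, (((dg G U v : ℤ) - 2) + dg G T v) = ∑ v ∈ Z, (((dg G U v : ℤ) - 2)) := by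
      refine Finset.sum_congr rfl fun v hv => ?_
      have : dg G T v = 0 := by
        rw [dg_eq_zero]
        intro u hu ha
        simp only [hT, Finset.mem_filter] at hu
        exact dg_eq_zero.1 hu.2.2 v hv ha.symm
      omega
    have b3 : ∑ v ∈ N, (((dg G U v : ℤ) - 2) + dg G T v) ≤ 6 * N.card := by
      rw [mul_comm, ← nsmul_eq_mul]
      refine Finset.sum_le_card_nsmul _ _ _ fun v hv => ?_
      simp only [hN, Finset.mem_filter, Finset.mem_sdiff] at hv
      have h1 := h4 v hv.1.1
      have h2 := dg_mono (G := G) hTU v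
      omega
    have b4 : (N.card : ℤ) ≤ ∑ v ∈ Z, (((dg G U v : ℤ) - 2)) := by
      have c1 : N.card ≤ ∑ v ∈ N, dg G Z v := by
        rw [Finset.card_eq_sum_ones]
        refine Finset.sum_le_sum fun v hv => ?_
        simp only [hN, Finset.mem_filter] at hv
        omega
      rw [sum_dg_comm] at c1
      have c2 : ∑ v ∈ Z, (dg G N v : ℤ) ≤ ∑ v ∈ Z, (((dg G U v : ℤ) - 2)) := by
        refine Finset.sum_le_sum fun v hv => ?_
        have h1 := dg_sdiff_add (G := G) hZU v
        have h2 := dg_mono (G := G) (S := N) (T := U \ Z) (Finset.filter_subset _ _) v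
        have h3 := hZ v hv
        omega
      have c3 : (N.card : ℤ) ≤ ∑ v ∈ Z, (dg G N v : ℤ) := by exact_mod_cast c1
      exact c3.trans c2
    linarith
  rw [Finset.sum_add_distrib] at e3
  linarith

end Cycles

end InducedPacking

namespace InducedPacking

/-! ### The invariant of the building phase. -/

section Invariant

variable {V : Type*} [DecidableEq V] {G : SimpleGraph V} [DecidableRel G.Adj]
  {U S H X Z : Finset V} {D : V → ℕ} {c e : ℕ}

variable (G) in
/-- The invariant of the main loop: `H` is the structure found so far, `X` the hitting set, after
`c` new cycles and `e` ears. -/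
structure Inv (H X : Finset V) (c e : ℕ) : Prop where
  core : Core G H
  dg_le_two : ∀ v ∈ H, v ∉ X → dg G H v ≤ 2
  dg_le_four : ∀ v ∈ H, dg G H v ≤ 4
  -- Cycles inside `H` are already hit by `X` itself; its ball is needed only for vertices outside.
  core_inter : ∀ K, Core G K → K ⊆ H → Disjoint K X → K = ∅
  -- This keeps the vertex that closes an ear from having three neighbours, so an ear adds only 2 to
  -- `mu`.
  outside : ∀ v, v ∉ H → v ∉ X → dg G X v = 0 → dg G H v ≤ 2
  mu_ge : 2 * e ≤ mu G H
  card_le : X.card ≤ c + 3 * e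

theorem Inv.empty : Inv G (∅ : Finset V) ∅ 0 0 where
  core := by simp [Core]
  dg_le_two := by simp
  dg_le_four := by simp
  core_inter := by simp
  outside := by simp [dg]
  mu_ge := by simp [mu]
  card_le := by simp

/-- Growing keeps `mu`, and `y` adds 2. Pruning neither destroys this gain nor can it leave more, so
`mu G H' = mu G H + 2`. A total degree excess of 2 allows at most two branch vertices outside `X`
and no degree above four. A core of `H'` that avoids `y` lies in the grown set, hence in `H`, where
`X` meets it. -/
theorem Inv.ear (h : Inv G H X c e) (hU : ∀ v, v ∈ U ↔ v ∉ H ∧ v ∉ X ∧ dg G X v = 0)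
    (hS : Grown G U H S D) {y : V} (hyU : y ∈ U) (hyS : y ∉ S) (hd : dg G S y = 2)
    {H' X' : Finset V} (hP : Pruned G (insert y S) H') (hH' : Core G H')
    (hX' : X' = insert y X ∪ H'.filter fun v => 3 ≤ dg G H' v) : Inv G H' X' c (e + 1) := by
  have hHH' : H ⊆ H' := hP.core_subset h.core (hS.subset.trans (Finset.subset_insert _ _))
  have hnew : ∀ v ∈ H', v ∉ H → v ∈ U := by
    intro v hv hvH
    rcases Finset.mem_insert.1 (hP.subset hv) with rfl | hvS
    · exact hyU
    · exact (Finset.mem_union.1 (hS.subset_union hvS)).resolve_left hvH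
  have hmu1 : mu G H + 2 ≤ mu G H' := by
    have := hP.mu_le
    rw [mu_insert hyS, hS.mu_eq, hd] at this
    push_cast at this
    omega
  have hmu2 : mu G H' ≤ mu G H + 2 := by
    by_cases hy : y ∈ H'
    · have h1 := mu_erase (G := G) hy
      have h2 := hS.mu_le (Z := H'.erase y)
        (Finset.subset_erase.2 ⟨hHH', fun hyH => hyS (hS.subset hyH)⟩)
        (fun x hx => (Finset.mem_insert.1
          (hP.subset (Finset.mem_of_mem_erase hx))).resolve_left (Finset.ne_of_mem_erase hx))
      have h3 := dg_mono (G := G) hP.subset y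
      rw [dg_insert_self] at h3
      omega
    · have := hS.mu_le (Z := H') hHH' fun x hx => (Finset.mem_insert.1 (hP.subset hx)).resolve_left
        fun e => hy (e ▸ hx)
      omega
  -- New vertices come from `U`, which has no neighbour in `X`, so members of `X` gain no degree.
  have hXsame : ∀ v ∈ H, v ∈ X → dg G H' v = dg G H v := by
    intro v hvH hvX
    have h1 := dg_sdiff_add (G := G) hHH' v
    have : dg G (H' \ H) v = 0 := by
      rw [dg_eq_zero]
      intro u hu ha
      rw [Finset.mem_sdiff] at hu
      exact dg_eq_zero.1 ((hU u).1 (hnew u hu.1 hu.2)).2.2 v hvX ha.symm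
    omega
  -- `φ` is the gain in degree excess at each vertex: it is nonnegative and its sum is `mu G H' - mu
  -- G H`.
  set φ : V → ℤ := fun v => (dg G H' v : ℤ) - 2 - if v ∈ H then (dg G H v : ℤ) - 2 else 0 with hφ
  have hφ0 : ∀ v ∈ H', 0 ≤ φ v := by
    intro v hv
    have h1 := hH' v hv
    have h2 := dg_mono (G := G) hHH' v
    simp only [hφ]
    split_ifs <;> omega
  have hsum : ∑ v ∈ H', φ v ≤ 2 := by
    have h1 : ∑ v ∈ H', (if v ∈ H then (dg G H v : ℤ) - 2 else 0) = mu G H := by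
      rw [← Finset.sum_filter, Finset.filter_mem_eq_inter, Finset.inter_eq_right.2 hHH', mu]
    rw [hφ, Finset.sum_sub_distrib, h1]
    change mu G H' - mu G H ≤ 2
    omega
  have hφX : ∀ v ∈ H', v ∉ X → φ v = dg G H' v - 2 := by
    intro v hv hvX
    simp only [hφ]
    split_ifs with hvH
    · have h1 := h.dg_le_two v hvH hvX
      have h2 := h.core v hvH
      omega
    · omega
  have hcard : ((H'.filter fun v => 3 ≤ dg G H' v) \ X).card ≤ 2 := by
    have h1 : ∑ v ∈ (H'.filter fun v => 3 ≤ dg G H' v) \ X, (1 : ℤ) ≤ ∑ v ∈ H', φ v := by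
      refine (Finset.sum_le_sum fun v hv => ?_).trans
        (Finset.sum_le_sum_of_subset_of_nonneg (f := φ) (fun v hv => ?_) fun v hv _ => hφ0 v hv)
      · simp only [Finset.mem_sdiff, Finset.mem_filter] at hv
        rw [hφX v hv.1.1 hv.2]
        omega
      · exact (Finset.mem_filter.1 (Finset.mem_sdiff.1 hv).1).1
    simp only [Finset.sum_const, nsmul_eq_mul, mul_one] at h1
    omega
  refine ⟨hH', ?_, ?_, ?_, ?_, ?_, ?_⟩
  · intro v hv hvX
    by_contra hlt
    apply hvX
    rw [hX']
    exact Finset.mem_union_right _ (Finset.mem_filter.2 ⟨hv, by omega⟩)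
  · intro v hv
    by_cases hvX : v ∈ X
    · by_cases hvH : v ∈ H
      · rw [hXsame v hvH hvX]
        exact h.dg_le_four v hvH
      · exact absurd hvX ((hU v).1 (hnew v hv hvH)).2.1
    · have h1 := hφX v hv hvX
      have h2 := Finset.single_le_sum hφ0 hv
      omega
  · intro K hK hKH hdis
    rw [hX', Finset.disjoint_union_right, Finset.disjoint_insert_right] at hdis
    refine h.core_inter K hK (hS.core_subset (fun v hv _ => hK v hv) fun x hx => ?_) hdis.1.2
    exact (Finset.mem_insert.1 (hP.subset (hKH hx))).resolve_left fun e => hdis.1.1 (e ▸ hx)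
  · intro v hvH' hvX' hdX'
    rw [hX', Finset.mem_union, Finset.mem_insert, not_or, not_or] at hvX'
    have hsub : insert y X ⊆ X' := by rw [hX']; exact Finset.subset_union_left
    have hyX' : y ∈ X' := hsub (Finset.mem_insert_self _ _)
    have hvy : ¬ G.Adj v y := dg_eq_zero.1 hdX' y hyX'
    have hvU : v ∈ U := (hU v).2 ⟨fun hh => hvH' (hHH' hh), hvX'.1.2, by
      have := dg_mono (G := G) ((Finset.subset_insert _ _).trans hsub) v
      omega⟩
    by_cases hvS : v ∈ insert y S
    · exact (hP.dg_le_one hH' hvS hvH').trans (by omega)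
    · rw [Finset.mem_insert, not_or] at hvS
      have h1 := dg_mono (G := G) hP.subset v
      rw [dg_insert hyS, if_neg hvy] at h1
      have h2 := hS.dg_le_two (fun u hu _ => ?_) v hvU hvS.2
      · omega
      · obtain ⟨h3, h4, h5⟩ := (hU u).1 hu
        exact h.outside u h3 h4 h5
  · have := h.mu_ge
    push_cast
    omega
  -- One ear costs three vertices: `y` and at most two new branch vertices.
  · have h1 : X' ⊆ insert y X ∪ ((H'.filter fun v => 3 ≤ dg G H' v) \ X) := by
      rw [hX']
      intro v hv
      simp only [Finset.mem_union, Finset.mem_insert, Finset.mem_sdiff] at hv ⊢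
      tauto
    have h2 := Finset.card_le_card h1
    have h3 := Finset.card_union_le (insert y X) ((H'.filter fun v => 3 ≤ dg G H' v) \ X)
    have h4 := Finset.card_insert_le y X
    have h5 := h.card_le
    omega

/-- `Z` lies outside the closed set `S`, which contains `H`, so there is no edge between `Z` and
`H`; degrees and cores split along the two parts. An outside vertex cannot have neighbours in both
parts, since only vertices of `S` can be adjacent to `H` and only others to `Z`. -/
theorem Inv.newCycle (h : Inv G H X c e) (hU : ∀ v, v ∈ U ↔ v ∉ H ∧ v ∉ X ∧ dg G X v = 0)
    (hS : Grown G U H S D) (hclosed : ∀ u ∈ U, u ∉ S → dg G S u = 0) {W : Finset V}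
    (hP : Pruned G (U \ S) W) (hW : Core G W) {y : V} (hZ : IsNewCycle G W Z y) :
    (∀ z ∈ Z, z ∉ H ∧ dg G H z = 0) ∧ Inv G (H ∪ Z) (insert y X) (c + 1) e := by
  have hZU : ∀ z ∈ Z, z ∈ U ∧ z ∉ S := fun z hz => Finset.mem_sdiff.1 (hP.subset (hZ.subset hz))
  have hZH : ∀ z ∈ Z, z ∉ H ∧ dg G H z = 0 := by
    intro z hz
    obtain ⟨h1, h2⟩ := hZU z hz
    refine ⟨((hU z).1 h1).1, ?_⟩
    have h3 := hclosed z h1 h2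
    have h4 := dg_mono (G := G) hS.subset z
    omega
  have hdis : Disjoint H Z := by
    rw [Finset.disjoint_right]
    exact fun z hz => (hZH z hz).1
  have hHZ : ∀ v ∈ H, dg G Z v = 0 := by
    intro v hv
    rw [dg_eq_zero]
    intro z hz ha
    exact dg_eq_zero.1 (hZH z hz).2 v hv ha.symm
  have hdH : ∀ v ∈ H, dg G (H ∪ Z) v = dg G H v := fun v hv => by
    rw [dg_union hdis, hHZ v hv, add_zero]
  have hdZ : ∀ v ∈ Z, dg G (H ∪ Z) v = 2 := fun v hv => by
    rw [dg_union hdis, (hZH v hv).2, hZ.dg_eq v hv]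
  have hcZ : Core G Z := fun v hv => (hZ.dg_eq v hv).ge
  refine ⟨hZH, h.core.union hcZ, ?_, ?_, ?_, ?_, ?_, ?_⟩
  · intro v hv hvX
    rcases Finset.mem_union.1 hv with hv | hv
    · rw [hdH v hv]
      exact h.dg_le_two v hv fun h' => hvX (Finset.mem_insert_of_mem h')
    · exact (hdZ v hv).le
  · intro v hv
    rcases Finset.mem_union.1 hv with hv | hv
    · rw [hdH v hv]
      exact h.dg_le_four v hv
    · exact (hdZ v hv).le.trans (by omega)
  · intro K hK hKs hKX
    rw [Finset.disjoint_insert_right] at hKX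
    have hsplit : K = K ∩ H ∪ K ∩ Z := by
      rw [← Finset.inter_union_distrib_left, Finset.inter_eq_left.2 hKs]
    have hd : Disjoint (K ∩ H) (K ∩ Z) :=
      hdis.mono Finset.inter_subset_right Finset.inter_subset_right
    have hKZ : K ∩ Z = ∅ := by
      by_contra hne
      refine hKX.1 (Finset.mem_inter.1 (hZ.core_mem (K ∩ Z) ?_ Finset.inter_subset_right
        (Finset.nonempty_iff_ne_empty.2 hne))).1
      intro v hv
      have h1 := hK v (Finset.mem_inter.1 hv).1
      rw [hsplit, dg_union hd] at h1
      have h2 := dg_mono (G := G) (Finset.inter_subset_right (s₁ := K) (s₂ := H)) v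
      have h3 := (hZH v (Finset.mem_inter.1 hv).2).2
      omega
    rw [hKZ, Finset.union_empty] at hsplit
    exact h.core_inter K hK (hsplit ▸ Finset.inter_subset_right) hKX.2
  · intro v hv hvX hdX
    rw [Finset.mem_union, not_or] at hv
    rw [Finset.mem_insert, not_or] at hvX
    have hvy : ¬ G.Adj v y := dg_eq_zero.1 hdX y (Finset.mem_insert_self _ _)
    have hdX' : dg G X v = 0 := by
      have := dg_mono (G := G) (Finset.subset_insert y X) v
      omega
    have hvU : v ∈ U := (hU v).2 ⟨hv.1, hvX.2, hdX'⟩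
    rw [dg_union hdis]
    by_cases hvS : v ∈ S
    · have : dg G Z v = 0 := by
        rw [dg_eq_zero]
        intro z hz ha
        exact dg_eq_zero.1 (hclosed z (hZU z hz).1 (hZU z hz).2) v hvS ha.symm
      have := h.outside v hv.1 hvX.2 hdX'
      omega
    · have h1 : dg G H v = 0 := by
        have h3 := hclosed v hvU hvS
        have h4 := dg_mono (G := G) hS.subset v
        omega
      have h2 : dg G Z v ≤ 2 := by
        by_cases hvW : v ∈ W
        · exact hZ.dg_le v hvW hv.2 hvy
        · have h3 := hP.dg_le_one hW (Finset.mem_sdiff.2 ⟨hvU, hvS⟩) hvW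
          have h4 := dg_mono (G := G) hZ.subset v
          omega
      omega
  · have h1 : mu G (H ∪ Z) = mu G H + mu G Z := by
      unfold mu
      rw [Finset.sum_union hdis]
      congr 1
      · exact Finset.sum_congr rfl fun v hv => by rw [hdH v hv]
      · exact Finset.sum_congr rfl fun v hv => by rw [hdZ v hv, hZ.dg_eq v hv]
    have h2 := hcZ.mu_nonneg
    have h3 := h.mu_ge
    omega
  · have h1 := Finset.card_insert_le y X
    have h2 := h.card_le
    omega

/-- A core away from the ball around `X` splits along `S` without crossing edges. Its part outside
`S` is a core of `U \ S`, hence empty; its part inside is a core of the grown set, hence lies in `H`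
and would meet `X`. -/
theorem Inv.core_eq_empty (h : Inv G H X c e)
    (hU : ∀ v, v ∈ U ↔ v ∉ H ∧ v ∉ X ∧ dg G X v = 0)
    (hS : Grown G U H S D) (hclosed : ∀ u ∈ U, u ∉ S → dg G S u = 0)
    (hP : Pruned G (U \ S) ∅) {K : Finset V} (hK : Core G K)
    (hKX : ∀ v ∈ K, v ∉ X ∧ dg G X v = 0) : K = ∅ := by
  have hKU : ∀ v ∈ K, v ∉ S → v ∈ U := fun v hv hvS =>
    (hU v).2 ⟨fun hvH => hvS (hS.subset hvH), hKX v hv⟩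
  have hsplit : K = K \ S ∪ K ∩ S := by rw [Finset.sdiff_union_inter]
  have hd : Disjoint (K \ S) (K ∩ S) := Finset.disjoint_sdiff_inter K S
  have hno : ∀ u ∈ K \ S, dg G S u = 0 := fun u hu => by
    rw [Finset.mem_sdiff] at hu
    exact hclosed u (hKU u hu.1 hu.2) hu.2
  have h1 : K \ S = ∅ := by
    rw [← Finset.subset_empty]
    refine hP.core_subset (fun v hv => ?_) fun v hv => ?_
    · have h1 := hK v (Finset.mem_sdiff.1 hv).1
      rw [hsplit, dg_union hd] at h1
      have h2 := dg_mono (G := G) (Finset.inter_subset_right (s₁ := K) (s₂ := S)) v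
      have h3 := hno v hv
      omega
    · rw [Finset.mem_sdiff] at hv ⊢
      exact ⟨hKU v hv.1 hv.2, hv.2⟩
  have hKS : K ⊆ S := Finset.sdiff_eq_empty_iff_subset.1 h1
  refine h.core_inter K hK (hS.core_subset (fun v hv _ => hK v hv) hKS) ?_
  rw [Finset.disjoint_left]
  exact fun v hv => (hKX v hv).1

theorem Inv.branch_le (h : Inv G H X c e) : branch G H H ≤ X.card := by
  refine Finset.card_le_card fun v hv => ?_
  rw [Finset.mem_filter] at hv
  by_contra hvX
  have := h.dg_le_two v hv.1 hvX
  omega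

/-- One extraction of a cycle costs little. -/
theorem Inv.mu_extract (h : Inv G H X c e) {W : Finset V} (hWH : W ⊆ H) (hP : Pruned G W U)
    {y : V} (hZ : IsNewCycle G U Z y) :
    mu G W - 16 * (2 * Nat.log 2 (X.card + 1) + 3) ≤
      mu G (U.filter fun v => v ∉ Z ∧ dg G Z v = 0) := by
  have hUH : U ⊆ H := hP.subset.trans hWH
  have h1 := mu_sdiff_closedNbhd (fun v hv => (dg_mono hUH v).trans (h.dg_le_four v (hUH hv)))
    hZ.subset hZ.dg_eq
  -- Branch vertices of `U` are branch vertices of `H` and so lie in `X`, which bounds `d` by the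
  -- logarithm of `X.card + 1`.
  obtain ⟨d, h2, h3⟩ := hZ.branch_le
  have h4 : branch G U U ≤ X.card :=
    (branch_mono_left hUH).trans ((branch_mono hUH).trans h.branch_le)
  have h5 : d ≤ Nat.log 2 (X.card + 1) := Nat.le_log_of_pow_le (by norm_num) (by omega)
  have h6 := hP.mu_le
  have h7 : branch G U Z ≤ 2 * Nat.log 2 (X.card + 1) + 3 := by omega
  have h8 : (branch G U Z : ℤ) ≤ 2 * (Nat.log 2 (X.card + 1) : ℕ) + 3 := by exact_mod_cast h7
  linarith

end Invariant

/-! ### Solving the recursive inequality for the size of the hitting set. -/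

/-- The bound on the size of the hitting set. -/
def hitBound (k : ℕ) : ℕ := 601 * k * (Nat.log 2 k + 1)

theorem le_hitBound {k x : ℕ} (hk : 0 < k)
    (hx : x ≤ k + 24 * k * (2 * Nat.log 2 (x + 1) + 3)) : x ≤ hitBound k := by
  set m := Nat.log 2 (x + 1)
  set l := Nat.log 2 k with hl
  have h1 : 2 ^ m ≤ x + 1 := Nat.pow_log_le_self 2 (by omega)
  have h2 : k < 2 ^ (l + 1) := Nat.lt_pow_succ_log_self (by norm_num) k
  -- Here `x + 1 ≤ k + 1 + 72 k + 48 k m ≤ k (74 + 48 m)`, using `k ≥ 1`.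
  have h3 : 2 ^ m ≤ 2 ^ (l + 1) * (74 + 48 * m) :=
    calc 2 ^ m ≤ x + 1 := h1
      _ ≤ k * (74 + 48 * m) := by nlinarith
      _ ≤ _ := Nat.mul_le_mul_right _ h2.le
  have hm : m ≤ 11 * (l + 1) := by
    by_contra! hlt
    obtain ⟨j, hj⟩ := Nat.exists_eq_add_of_le (show l + 1 ≤ m by omega)
    rw [hj, pow_add] at h3
    have h4 : 2 ^ j ≤ 74 + 48 * (l + 1 + j) := Nat.le_of_mul_le_mul_left h3 (by positivity)
    -- With `j = m - (l + 1)`, the failure of the bound gives `j > 10 (l + 1)`. From 11 on, `2 ^ i`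
    -- exceeds `74 + 96 i`; at 10 it does not.
    have hj11 : 11 ≤ j := by omega
    have hjl : l + 1 ≤ j := by omega
    have h5 : ∀ i, 11 ≤ i → 74 + 96 * i < 2 ^ i := by
      intro i hi
      induction i, hi using Nat.le_induction with
      | base => norm_num
      | succ i hi ih => rw [pow_succ]; omega
    have := h5 j hj11
    omega
  unfold hitBound
  rw [← hl]
  calc x ≤ k + 24 * k * (2 * m + 3) := hx
    _ ≤ k + 24 * k * (2 * (11 * (l + 1)) + 3) := by gcongr
    -- The coefficients are `24 * 22 = 528` for `l + 1` and `1 + 72 = 73` for the rest; their sum is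
    -- 601.
    _ ≤ _ := by nlinarith [Nat.zero_le (k * l)]

theorem hitBound_isBigO :
    (fun k : ℕ => (hitBound k : ℝ)) =O[atTop] (fun k : ℕ => (k : ℝ) * Real.log (k : ℝ)) := by
  refine IsBigO.of_bound (601 * 4) ?_
  filter_upwards [eventually_ge_atTop 2] with k hk
  have hk' : (2 : ℝ) ≤ k := by exact_mod_cast hk
  have hlog2 : (1 / 2 : ℝ) ≤ Real.log 2 := by have := Real.log_two_gt_d9; linarith
  have hlog : Real.log 2 ≤ Real.log k := Real.log_le_log (by norm_num) hk'
  have h1 : ((Nat.log 2 k : ℕ) : ℝ) ≤ Real.logb 2 k := by exact_mod_cast Real.natLog_le_logb k 2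
  have h2 : Real.logb 2 k ≤ 2 * Real.log k := by
    rw [Real.logb, div_le_iff₀ (by linarith)]
    nlinarith
  rw [Real.norm_of_nonneg (by positivity), Real.norm_of_nonneg (by
    have : 0 ≤ Real.log k := by linarith
    positivity)]
  unfold hitBound
  push_cast
  -- Both `Nat.log 2 k` and 1 are at most `2 * Real.log k`, because `Real.log 2 ≥ 1 / 2` and `k ≥
  -- 2`.
  have h3 : ((Nat.log 2 k : ℕ) : ℝ) + 1 ≤ 4 * Real.log k := by linarith
  calc 601 * (k : ℝ) * ((Nat.log 2 k : ℕ) + 1) ≤ 601 * (k : ℝ) * (4 * Real.log k) := by gcongr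
    _ = _ := by ring

end InducedPacking

namespace InducedPacking

/-! ### Cycles as lists, packings, and forests as graphs without cores. -/

section CycleLists

variable {V : Type*} [DecidableEq V] {G : SimpleGraph V} [DecidableRel G.Adj]

variable (G) in
/-- The list `l` enumerates the vertices of a cycle in cyclic order. -/
structure IsCycleList (l : List V) : Prop where
  nodup : l.Nodup
  isChain : l.IsChain G.Adj
  three_le : 3 ≤ l.length
  adj : ∀ hne : l ≠ [], G.Adj (l.getLast hne) (l.head hne)

theorem IsCycleList.exists_walk {l : List V} (h : IsCycleList G l) :
    ∃ c : Σ v : V, G.Walk v v, c.2.IsCycle ∧ c.2.support.tail = l ∧ c.2.length = l.length := by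
  have hne : l ≠ [] := by
    rintro rfl
    simpa using h.three_le
  have h3 := h.three_le
  -- The walk starts at the last vertex of the list, so the tail of its support is the list itself,
  -- as the output format requires.
  refine ⟨⟨_, .cons (h.adj hne) (.ofSupport l hne h.isChain)⟩, ?_, ?_, ?_⟩
  · rw [SimpleGraph.Walk.isCycle_iff_isPath_tail_and_le_length]
    constructor
    · rw [SimpleGraph.Walk.isPath_def]
      simpa using h.nodup
    · simp
      omega
  · simp
  · simp
    omega

/-- A maximal path in a 2-regular set closes up to a cycle. -/
theorem isCycleList_of_maximal {Z : Finset V} (hZ : ∀ v ∈ Z, dg G Z v = 2) {l : List V}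
    (hnd : l.Nodup) (hch : l.IsChain G.Adj) (hlZ : ∀ v ∈ l, v ∈ Z) (hne : l ≠ [])
    (hmax : ∀ v ∈ Z, G.Adj (l.getLast hne) v → v ∈ l) : IsCycleList G l := by
  set m := l.length with hm
  have hpos : 0 < m := List.length_pos_iff.2 hne
  have hadj : ∀ i (hi : i + 1 < l.length), G.Adj l[i] l[i + 1] := fun i hi =>
    List.isChain_iff_getElem.1 hch i hi
  have hlast : l.getLast hne = l[m - 1] := List.getLast_eq_getElem hne
  have hhead : l.head hne = l[0] := List.head_eq_getElem_zero hne
  have hinj : ∀ i j (hi : i < l.length) (hj : j < l.length), l[i] = l[j] → i = j :=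
    fun i j hi hj he => (hnd.getElem_inj_iff).1 he
  obtain ⟨a, b, hab, hN⟩ := Finset.card_eq_two.1 (hZ _ (hlZ _ (List.getLast_mem hne)))
  -- Maximality puts both neighbours of the last vertex on the path. One that is neither the first
  -- nor the penultimate vertex would have three neighbours: its two path neighbours and the last
  -- vertex. So the two neighbours are the first and the penultimate vertex, and their distinctness
  -- gives length at least three.
  have key : ∀ v ∈ Z.filter (G.Adj (l.getLast hne)), v = l[0] ∨ ∃ h : 2 ≤ m, v = l[m - 2] := by
    intro v hv
    rw [Finset.mem_filter] at hv
    obtain ⟨j, hj, rfl⟩ := List.mem_iff_getElem.1 (hmax v hv.1 hv.2)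
    by_contra! hcon
    have hj0 : j ≠ 0 := by
      rintro rfl
      exact hcon.1 rfl
    have hj1 : j ≠ m - 1 := by
      rintro rfl
      rw [hlast] at hv
      exact hv.2.ne rfl
    have hj2 : j ≠ m - 2 := by
      rintro rfl
      exact hcon.2 (by omega) rfl
    have hsub : ({l[j - 1], l[j + 1], l[m - 1]} : Finset V) ⊆ Z.filter (G.Adj l[j]) := by
      intro x hx
      simp only [Finset.mem_insert, Finset.mem_singleton] at hx
      rw [Finset.mem_filter]
      rcases hx with rfl | rfl | rfl
      · refine ⟨hlZ _ (List.getElem_mem _), ?_⟩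
        have := hadj (j - 1) (by omega)
        simp only [show j - 1 + 1 = j by omega] at this
        exact this.symm
      · exact ⟨hlZ _ (List.getElem_mem _), hadj j (by omega)⟩
      · rw [hlast] at hv
        exact ⟨hlZ _ (List.getElem_mem _), hv.2.symm⟩
    have hc := Finset.card_le_card hsub
    rw [show (Z.filter (G.Adj l[j])).card = 2 from hZ _ hv.1, Finset.card_eq_three.2
      ⟨_, _, _, ?_, ?_, ?_, rfl⟩] at hc
    · omega
    · intro he
      have := hinj _ _ _ _ he
      omega
    · intro he
      have := hinj _ _ _ _ he
      omega
    · intro he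
      have := hinj _ _ _ _ he
      omega
  have ha := key a (by rw [hN]; simp)
  have hb := key b (by rw [hN]; simp)
  have h0 : l[0] ∈ Z.filter (G.Adj (l.getLast hne)) ∧ 3 ≤ m := by
    have hmm : ∀ h : 2 ≤ m, l[0] ≠ l[m - 2] → 3 ≤ m := by
      intro h hne'
      by_contra hlt
      have h2 : m - 2 = 0 := by omega
      exact hne' (by simp only [h2])
    rcases ha with rfl | ⟨h2, rfl⟩
    · rcases hb with rfl | ⟨h2, rfl⟩
      · exact absurd rfl hab
      · exact ⟨by rw [hN]; simp, hmm h2 hab⟩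
    · rcases hb with rfl | ⟨h2', rfl⟩
      · exact ⟨by rw [hN]; simp, hmm h2 hab.symm⟩
      · exact absurd rfl hab
  exact ⟨hnd, hch, h0.2, fun _ => by rw [hhead]; exact (Finset.mem_filter.1 h0.1).2⟩

variable (G) in
/-- Two sets of vertices, given by lists, are disjoint and not joined by an edge. -/
def Apart (l l' : List V) : Prop := ∀ u ∈ l, ∀ w ∈ l', u ≠ w ∧ ¬ G.Adj u w

theorem Apart.symm {l l' : List V} (h : Apart G l l') : Apart G l' l :=
  fun u hu w hw => ⟨(h w hw u hu).1.symm, fun ha => (h w hw u hu).2 ha.symm⟩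

variable (G) in
/-- A list of cycles that are pairwise disjoint and not joined by edges. -/
structure IsPackingList (C : List (List V)) : Prop where
  cycle : ∀ l ∈ C, IsCycleList G l
  apart : C.Pairwise (Apart G)

theorem IsPackingList.nil : IsPackingList G [] := ⟨by simp, by simp⟩

theorem IsPackingList.snoc {C : List (List V)} (h : IsPackingList G C) {l : List V}
    (hl : IsCycleList G l) (ha : ∀ l' ∈ C, Apart G l' l) : IsPackingList G (C ++ [l]) := by
  refine ⟨?_, ?_⟩
  · intro l' hl'
    rcases List.mem_append.1 hl' with h' | h'
    · exact h.cycle l' h'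
    · rw [List.mem_singleton.1 h']
      exact hl
  · rw [List.pairwise_append]
    refine ⟨h.apart, by simp, ?_⟩
    intro a hmem b hb
    rw [List.mem_singleton.1 hb]
    exact ha a hmem

/-- A graph in which no nonempty set of vertices disjoint from the ball around `X` is a core is a
forest outside that ball. -/
theorem isAcyclic_induce_compl_ball [Fintype V] {X : Finset V} {X' : Set V}
    (hXX' : ∀ v, v ∈ X → v ∈ X')
    (h : ∀ K : Finset V, Core G K → (∀ v ∈ K, v ∉ X ∧ dg G X v = 0) → K = ∅) :
    (G.induce (G.ballAround X' 1)ᶜ).IsAcyclic := by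
  intro v c hc
  let f : G.induce (G.ballAround X' 1)ᶜ →g G := (SimpleGraph.Embedding.induce _).toHom
  have hc' : (c.map f).IsCycle := hc.map (SimpleGraph.Embedding.induce (G := G) _).injective
  have := h (c.map f).support.toFinset ?_ ?_
  · have hmem : f v ∈ (c.map f).support.toFinset :=
      List.mem_toFinset.2 (SimpleGraph.Walk.start_mem_support _)
    rw [this] at hmem
    simp at hmem
  · intro u hu
    rw [List.mem_toFinset] at hu
    -- Each vertex already has two neighbours along the cycle, so the support is a core even if the
    -- cycle has chords.
    have h2 := hc'.ncard_neighborSet_toSubgraph_eq_two hu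
    rw [← h2, dg, ← Set.ncard_coe_finset]
    refine Set.ncard_le_ncard ?_ (Finset.finite_toSet _)
    intro w hw
    simp only [Finset.coe_filter, List.mem_toFinset, Set.mem_ofPred_eq]
    rw [SimpleGraph.Subgraph.mem_neighborSet] at hw
    exact ⟨(SimpleGraph.Walk.mem_verts_toSubgraph _).1 hw.snd_mem, hw.adj_sub⟩
  · intro u hu
    rw [List.mem_toFinset, SimpleGraph.Walk.support_map, List.mem_map] at hu
    obtain ⟨w, -, rfl⟩ := hu
    have hw : w.1 ∉ G.ballAround X' 1 := w.2
    have hw' : ∀ x ∈ X, ¬ G.edist w.1 x ≤ 1 := fun x hx hd => hw ⟨x, hXX' x hx, by exact_mod_cast hd⟩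
    have hf : f w = w.1 := rfl
    rw [hf, dg_eq_zero]
    refine ⟨fun hx => hw' _ hx (by simp), fun x hx ha => hw' x hx ?_⟩
    rw [SimpleGraph.edist_le_one_iff_adj_or_eq]
    exact Or.inl ha

end CycleLists

theorem IsPackingList.exists_candidate {I : Instance} [DecidableRel I.G.Adj] {C : List (List (Fin I.n))}
    (h : IsPackingList I.G C) (hk : C.length = I.k) (f : ℕ → ℕ) :
    ∃ b : Candidate I, b.Correct f I ∧
      b.encode I = 1 :: C.flatMap fun l => l.length :: l.map Fin.val := by
  have hlt : ∀ i : Fin I.k, i.1 < C.length := fun i => hk.symm ▸ i.2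
  have hw : ∀ i : Fin I.k, ∃ c : Σ v : Fin I.n, I.G.Walk v v, c.2.IsCycle ∧
      c.2.support.tail = C[i.1]'(hlt i) ∧ c.2.length = (C[i.1]'(hlt i)).length :=
    fun i => (h.cycle _ (List.getElem_mem _)).exists_walk
  choose c hc1 hc2 hc3 using hw
  have hsupp : ∀ i, ∀ u ∈ (c i).2.support, u ∈ C[i.1]'(hlt i) := by
    intro i u hu
    rw [← hc2]
    rw [SimpleGraph.Walk.mem_support_iff] at hu
    rcases hu with rfl | hu
    · exact SimpleGraph.Walk.end_mem_tail_support (hc1 i).not_nil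
    · exact hu
  have hap := List.pairwise_iff_getElem.1 h.apart
  refine ⟨.packing c, ⟨hc1, ?_⟩, ?_⟩
  · intro i j hij u hu w hw
    rcases lt_or_gt_of_ne (Fin.val_ne_of_ne hij) with h' | h'
    · exact hap _ _ _ _ h' u (hsupp i u hu) w (hsupp j w hw)
    · exact Apart.symm (hap _ _ _ _ h') u (hsupp i u hu) w (hsupp j w hw)
  · simp only [Candidate.encode]
    congr 1
    have hC : C = List.ofFn fun i : Fin I.k => C[i.1]'(hlt i) := by
      apply List.ext_getElem
      · simp [hk]
      · intro i h1 h2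
        simp
    conv_rhs => rw [hC]
    rw [List.flatMap_def, List.flatMap_def, List.map_ofFn, List.map_ofFn]
    congr 2
    funext i
    simp only [Function.comp_apply]
    rw [hc2, hc3]

end InducedPacking

/-! ### A program logic with running times. -/

namespace RAM

/-- The state after `x := v`. -/
def State.set (s : State) (x v : ℕ) : State := { s with var := Function.update s.var x v }

/-- The state after `a[i] := v`. -/
def State.put (s : State) (a i v : ℕ) : State :=
  { s with arr := Function.update s.arr a (Function.update (s.arr a) i v) }

/-- The state after printing `v`. -/
def State.emit (s : State) (v : ℕ) : State := { s with out := s.out ++ [v] }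

@[simp] theorem State.set_var (s : State) (x v y : ℕ) :
    (s.set x v).var y = if y = x then v else s.var y := by
  simp [State.set, Function.update_apply]

@[simp] theorem State.set_arr (s : State) (x v : ℕ) : (s.set x v).arr = s.arr := rfl

@[simp] theorem State.put_var (s : State) (a i v : ℕ) : (s.put a i v).var = s.var := rfl

theorem State.put_arr (s : State) (a i v b : ℕ) :
    (s.put a i v).arr b = if b = a then Function.update (s.arr a) i v else s.arr b := by
  simp only [State.put, Function.update_apply]

@[simp] theorem State.put_arr_apply (s : State) (a i v b j : ℕ) :
    (s.put a i v).arr b j = if b = a ∧ j = i then v else s.arr b j := by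
  rw [State.put_arr]
  by_cases h : b = a
  · subst h
    simp [Function.update_apply]
  · simp [h]

@[simp] theorem State.emit_var (s : State) (v : ℕ) : (s.emit v).var = s.var := rfl
@[simp] theorem State.emit_out (s : State) (v : ℕ) : (s.emit v).out = s.out ++ [v] := rfl

/-- A bound on the running time of a program all of whose loops make at most `L` iterations each
time they are entered. -/
def Prog.bound (L : ℕ) : Prog → ℕ
  | .skip => 1
  | .assign _ e => e.cost + 1
  | .store _ i e => i.cost + e.cost + 1
  | .print e => e.cost + 1
  | .seq P Q => P.bound L + Q.bound L
  | .ite e P Q => e.cost + 1 + (P.bound L + Q.bound L)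
  | .loop e P => L * (e.cost + 1 + P.bound L) + (e.cost + 1)

/-- `Prog.bound` as a polynomial. -/
noncomputable def Prog.boundPoly : Prog → Polynomial ℕ
  | .skip => 1
  | .assign _ e => (e.cost : Polynomial ℕ) + 1
  | .store _ i e => (i.cost : Polynomial ℕ) + (e.cost : Polynomial ℕ) + 1
  | .print e => (e.cost : Polynomial ℕ) + 1
  | .seq P Q => P.boundPoly + Q.boundPoly
  | .ite e P Q => (e.cost : Polynomial ℕ) + 1 + (P.boundPoly + Q.boundPoly)
  | .loop e P => Polynomial.X * ((e.cost : Polynomial ℕ) + 1 + P.boundPoly) +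
      ((e.cost : Polynomial ℕ) + 1)

theorem Prog.boundPoly_eval (L : ℕ) (P : Prog) : P.boundPoly.eval L = P.bound L := by
  induction P with
  | skip => simp [boundPoly, bound]
  | assign => simp [boundPoly, bound]
  | store => simp [boundPoly, bound]
  | print => simp [boundPoly, bound]
  | seq P Q ihP ihQ => simp [boundPoly, bound, ihP, ihQ]
  | ite e P Q ihP ihQ => simp [boundPoly, bound, ihP, ihQ]
  | loop e P ih => simp [boundPoly, bound, ih]

/-- The program may assign to the variable `x`. -/
def Prog.writesVar (x : ℕ) : Prog → Bool
  | .assign y _ => x == y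
  | .seq P Q => P.writesVar x || Q.writesVar x
  | .ite _ P Q => P.writesVar x || Q.writesVar x
  | .loop _ P => P.writesVar x
  | _ => false

/-- The program may write to the array `a`. -/
def Prog.writesArr (a : ℕ) : Prog → Bool
  | .store b _ _ => a == b
  | .seq P Q => P.writesArr a || Q.writesArr a
  | .ite _ P Q => P.writesArr a || Q.writesArr a
  | .loop _ P => P.writesArr a
  | _ => false

/-- The program may print. -/
def Prog.prints : Prog → Bool
  | .print _ => true
  | .seq P Q => P.prints || Q.prints
  | .ite _ P Q => P.prints || Q.prints
  | .loop _ P => P.prints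
  | _ => false

/-- What the program text does not write is unchanged from `s` to `s'`. -/
structure Frame (P : Prog) (s s' : State) : Prop where
  var : ∀ x, P.writesVar x = false → s'.var x = s.var x
  arr : ∀ a, P.writesArr a = false → s'.arr a = s.arr a
  out : P.prints = false → s'.out = s.out

theorem Exec.frame {P : Prog} {s s' : State} {t : ℕ} (h : Exec P s s' t) : Frame P s s' := by
  induction h with
  | skip => exact ⟨fun _ _ => rfl, fun _ _ => rfl, fun _ => rfl⟩
  | assign x e s =>
    refine ⟨fun y hy => ?_, fun _ _ => rfl, fun _ => rfl⟩
    simp only [Prog.writesVar, beq_eq_false_iff_ne] at hy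
    simp [hy]
  | store a i e s =>
    refine ⟨fun _ _ => rfl, fun b hb => ?_, fun _ => rfl⟩
    simp only [Prog.writesArr, beq_eq_false_iff_ne] at hb
    simp [hb]
  | print => exact ⟨fun _ _ => rfl, fun _ _ => rfl, fun h => by simp [Prog.prints] at h⟩
  | seq _ _ ih1 ih2 =>
    refine ⟨fun x hx => ?_, fun a ha => ?_, fun ho => ?_⟩
    · simp only [Prog.writesVar, Bool.or_eq_false_iff] at hx
      rw [ih2.var x hx.2, ih1.var x hx.1]
    · simp only [Prog.writesArr, Bool.or_eq_false_iff] at ha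
      rw [ih2.arr a ha.2, ih1.arr a ha.1]
    · simp only [Prog.prints, Bool.or_eq_false_iff] at ho
      rw [ih2.out ho.2, ih1.out ho.1]
  | ite_true _ _ ih =>
    refine ⟨fun x hx => ?_, fun a ha => ?_, fun ho => ?_⟩
    · simp only [Prog.writesVar, Bool.or_eq_false_iff] at hx
      exact ih.var x hx.1
    · simp only [Prog.writesArr, Bool.or_eq_false_iff] at ha
      exact ih.arr a ha.1
    · simp only [Prog.prints, Bool.or_eq_false_iff] at ho
      exact ih.out ho.1
  | ite_false _ _ ih =>
    refine ⟨fun x hx => ?_, fun a ha => ?_, fun ho => ?_⟩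
    · simp only [Prog.writesVar, Bool.or_eq_false_iff] at hx
      exact ih.var x hx.2
    · simp only [Prog.writesArr, Bool.or_eq_false_iff] at ha
      exact ih.arr a ha.2
    · simp only [Prog.prints, Bool.or_eq_false_iff] at ho
      exact ih.out ho.2
  | loop_true _ _ _ ih1 ih2 =>
    refine ⟨fun x hx => ?_, fun a ha => ?_, fun ho => ?_⟩
    · rw [ih2.var x hx, ih1.var x hx]
    · rw [ih2.arr a ha, ih1.arr a ha]
    · rw [ih2.out ho, ih1.out ho]
  | loop_false => exact ⟨fun _ _ => rfl, fun _ _ => rfl, fun _ => rfl⟩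

/-- Started in `s`, the program `P` halts within the time bound in a state that satisfies `Q`. -/
def Runs (L : ℕ) (P : Prog) (s : State) (Q : State → Prop) : Prop :=
  ∃ s' t, Exec P s s' t ∧ t ≤ P.bound L ∧ Q s'

variable {L : ℕ} {P P' : Prog} {s : State} {Q R : State → Prop} {e : Expr}

/-- The continuation also receives the frame, so postconditions need not mention memory that the
program text never writes; such side conditions reduce to `rfl`. -/
theorem Runs.mono (h : Runs L P s Q) (hQ : ∀ s', Frame P s s' → Q s' → R s') : Runs L P s R := by
  obtain ⟨s', t, h1, h2, h3⟩ := h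
  exact ⟨s', t, h1, h2, hQ s' h1.frame h3⟩

theorem Runs.skip (h : Q s) : Runs L .skip s Q := ⟨s, 1, .skip s, le_rfl, h⟩

theorem Runs.assign {x : ℕ} (h : Q (s.set x (e.eval s))) : Runs L (.assign x e) s Q :=
  ⟨_, _, .assign x e s, le_rfl, h⟩

theorem Runs.store {a : ℕ} {i : Expr} (h : Q (s.put a (i.eval s) (e.eval s))) :
    Runs L (.store a i e) s Q :=
  ⟨_, _, .store a i e s, le_rfl, h⟩

theorem Runs.print (h : Q (s.emit (e.eval s))) : Runs L (.print e) s Q :=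
  ⟨_, _, .print e s, le_rfl, h⟩

theorem Runs.seq (h : Runs L P s fun s' => Runs L P' s' Q) : Runs L (.seq P P') s Q := by
  obtain ⟨s₁, t₁, h1, h2, s₂, t₂, h3, h4, h5⟩ := h
  exact ⟨s₂, t₁ + t₂, .seq h1 h3, Nat.add_le_add h2 h4, h5⟩

theorem Runs.ite (h1 : e.eval s ≠ 0 → Runs L P s Q) (h2 : e.eval s = 0 → Runs L P' s Q) :
    Runs L (.ite e P P') s Q := by
  by_cases h : e.eval s = 0
  · obtain ⟨s', t, h3, h4, h5⟩ := h2 h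
    exact ⟨s', _, .ite_false h h3, by simp only [Prog.bound]; omega, h5⟩
  · obtain ⟨s', t, h3, h4, h5⟩ := h1 h
    exact ⟨s', _, .ite_true h h3, by simp only [Prog.bound]; omega, h5⟩

/-- The rule for loops, with an invariant that bounds the number of remaining iterations. -/
theorem Runs.loop (I : ℕ → State → Prop)
    (hbody : ∀ m s, I m s → e.eval s ≠ 0 → Runs L P s fun s' => ∃ m' < m, I m' s')
    {m : ℕ} (hm : m ≤ L) (hs : I m s) :
    Runs L (.loop e P) s fun s' => e.eval s' = 0 ∧ ∃ m', I m' s' := by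
  suffices ∀ m s, I m s → ∃ s' t, Exec (.loop e P) s s' t ∧
      t ≤ m * (e.cost + 1 + P.bound L) + (e.cost + 1) ∧ e.eval s' = 0 ∧ ∃ m', I m' s' by
    obtain ⟨s', t, h1, h2, h3⟩ := this m s hs
    refine ⟨s', t, h1, h2.trans ?_, h3⟩
    simp only [Prog.bound]
    gcongr
  intro m
  induction m using Nat.strong_induction_on with
  | _ m ih =>
    intro s hs
    by_cases he : e.eval s = 0
    · exact ⟨s, _, .loop_false he, by omega, he, m, hs⟩
    · obtain ⟨s₁, t₁, h1, h2, m', hm', h3⟩ := hbody m s hs he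
      obtain ⟨s₂, t₂, h4, h5, h6⟩ := ih m' hm' s₁ h3
      refine ⟨s₂, _, .loop_true he h1 h4, ?_, h6⟩
      have : (m' + 1) * (e.cost + 1 + P.bound L) ≤ m * (e.cost + 1 + P.bound L) :=
        Nat.mul_le_mul_right _ hm'
      rw [add_mul, one_mul] at this
      omega

/-- `for i := 0, …, b - 1 do P`, where `b` is the value of a variable. -/
def Prog.forTo (i b : ℕ) (P : Prog) : Prog :=
  .seq (.assign i (.const 0)) (.loop (.sub (.var b) (.var i))
    (.seq P (.assign i (.add (.var i) (.const 1)))))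

/-- The invariant takes the counter as a separate argument and must survive assignments to the
counter variable. The body may write neither the counter nor the bound, so `n - s.var i` counts the
remaining rounds. -/
theorem Runs.forTo {i b : ℕ} (hib : i ≠ b) {n : ℕ} (hn : s.var b = n) (hL : n ≤ L)
    (hPi : P.writesVar i = false) (hPb : P.writesVar b = false)
    (I : ℕ → State → Prop) (hset : ∀ j s v, I j s → I j (s.set i v)) (h0 : I 0 s)
    (hbody : ∀ j s, j < n → s.var i = j → s.var b = n → I j s → Runs L P s (I (j + 1))) :
    Runs L (Prog.forTo i b P) s (I n) := by
  refine Runs.seq (Runs.assign ?_)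
  refine (Runs.loop (fun m s => s.var b = n ∧ s.var i ≤ n ∧ n - s.var i ≤ m ∧ I (s.var i) s) ?_ hL
    ?_).mono ?_
  · rintro m s ⟨h1, h2, h3, h4⟩ he
    simp only [Expr.eval] at he
    refine Runs.seq ((hbody _ s (by omega) rfl h1 h4).mono fun s' hf hI => Runs.assign ?_)
    have hi' := hf.var i hPi
    have hb' := hf.var b hPb
    simp only [Expr.eval]
    refine ⟨m - 1, by omega, by simp [hb', hib.symm, h1], by simp [hi']; omega,
      by simp [hi']; omega, ?_⟩
    simp only [State.set_var, if_true, hi']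
    exact hset _ _ _ hI
  · exact ⟨by simp [hib.symm, hn], by simp [Expr.eval], by simp [Expr.eval],
      by simpa [Expr.eval] using hset 0 s 0 h0⟩
  · rintro s' - ⟨he, m, h1, h2, h3, h4⟩
    simp only [Expr.eval] at he
    rwa [show s'.var i = n by omega] at h4

end RAM

/-! ### Programs for counting neighbours and pruning. -/

namespace InducedPacking
open RAM

/-! Register conventions. Scalars: `1` holds `n`, `2` holds `k`, `3` and `4` are loop counters, `5`
and `6` hold the results of counting, `8` points to the vertex that closes a cycle, `14` is the length
of the output buffer, `19` counts cycles, `20` keeps the two main loops going. A scalar points to a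
vertex `v` if it holds `v + 1`, and to none if it holds `0`. Arrays: `0` is the input, `1` holds the
offsets of the rows of the adjacency matrix, `2` is the set `H`, `3` the set `X`, `4` the set in which
trees grow, `5` the growing set, `6` holds the depths, `7` is what remains of `H` during extraction,
`8` is the output buffer. -/

/-- The constant part of the memory: the graph and the parameters. -/
structure Env {n : ℕ} (G : SimpleGraph (Fin n)) (k : ℕ) (s : State) : Prop where
  n_eq : s.var 1 = n
  k_eq : s.var 2 = k
  row : ∀ v < n, s.arr 1 v = 2 + v * n
  adj : ∀ u v : Fin n, s.arr 0 (2 + u * n + v) ≠ 0 ↔ G.Adj u v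

/-- The program leaves the constant part of the memory alone. -/
def keepsEnv (P : Prog) : Bool :=
  !P.writesVar 1 && !P.writesVar 2 && !P.writesArr 0 && !P.writesArr 1

/-- The set of vertices whose indicator function is held in the array `a`. -/
def sset (n : ℕ) (s : State) (a : ℕ) : Finset (Fin n) :=
  Finset.univ.filter fun v => s.arr a v ≠ 0

section

variable {n k : ℕ} {G : SimpleGraph (Fin n)} {s s' : State} {P : Prog} {a b x v i L : ℕ}

theorem Env.frame (h : Env G k s) (hf : Frame P s s') (hP : keepsEnv P = true) : Env G k s' := by
  simp only [keepsEnv, Bool.and_eq_true, Bool.not_eq_true'] at hP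
  obtain ⟨⟨⟨h1, h2⟩, h3⟩, h4⟩ := hP
  refine ⟨?_, ?_, ?_, ?_⟩
  · rw [hf.var 1 h1, h.n_eq]
  · rw [hf.var 2 h2, h.k_eq]
  · rw [hf.arr 1 h4]
    exact h.row
  · rw [hf.arr 0 h3]
    exact h.adj

theorem Env.set (h : Env G k s) (h1 : 1 ≠ x) (h2 : 2 ≠ x) : Env G k (s.set x v) :=
  ⟨by simp [h1, h.n_eq], by simp [h2, h.k_eq], h.row, h.adj⟩

theorem Env.put (h : Env G k s) (h0 : 0 ≠ a) (h1 : 1 ≠ a) : Env G k (s.put a i v) :=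
  ⟨h.n_eq, h.k_eq, by simpa [h1] using h.row, by simpa [h0] using h.adj⟩

@[simp] theorem mem_sset {u : Fin n} : u ∈ sset n s a ↔ s.arr a u ≠ 0 := by simp [sset]

theorem sset_congr (h : s'.arr a = s.arr a) : sset n s' a = sset n s a := by
  ext u
  simp [h]

@[simp] theorem sset_set : sset n (s.set x v) a = sset n s a := rfl

@[simp] theorem sset_put_ne (h : b ≠ a) : sset n (s.put a i v) b = sset n s b := by
  ext u
  simp [h]

theorem sset_put_zero (u : Fin n) : sset n (s.put a u 0) a = (sset n s a).erase u := by
  ext w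
  simp only [mem_sset, State.put_arr_apply, true_and, Finset.mem_erase, Fin.val_inj]
  split_ifs <;> simp_all

theorem sset_put_ne_zero (u : Fin n) (hv : v ≠ 0) :
    sset n (s.put a u v) a = insert u (sset n s a) := by
  ext w
  simp only [mem_sset, State.put_arr_apply, true_and, Finset.mem_insert, Fin.val_inj]
  split_ifs <;> simp_all

theorem filter_lt_succ {j : ℕ} (F : Finset (Fin n)) (hj : j < n) :
    F.filter (fun w => w.val < j + 1) = if (⟨j, hj⟩ : Fin n) ∈ F then
      insert ⟨j, hj⟩ (F.filter fun w => w.val < j) else F.filter fun w => w.val < j := by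
  ext w
  split_ifs with h
  · simp only [Finset.mem_filter, Finset.mem_insert, Fin.ext_iff]
    constructor
    · rintro ⟨h1, h2⟩
      by_cases h3 : w.val = j
      · exact Or.inl h3
      · exact Or.inr ⟨h1, by omega⟩
    · rintro (h1 | h1)
      · have : w = ⟨j, hj⟩ := Fin.ext h1
        exact ⟨this ▸ h, by omega⟩
      · exact ⟨h1.1, by omega⟩
  · simp only [Finset.mem_filter, and_congr_right_iff]
    intro hw
    have : w.val ≠ j := fun h1 => h ((Fin.ext h1 : w = ⟨j, hj⟩) ▸ hw)
    omega

theorem filter_lt_self (F : Finset (Fin n)) : F.filter (fun w => w.val < n) = F := by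
  rw [Finset.filter_eq_self]
  exact fun w _ => w.2

/-- Set variable `5` to the number of neighbours of the vertex `v` in the set `a`, and variable `6`
to the sum of their entries in array `6`. -/
def countProg (a v : ℕ) : Prog :=
  .seq (.assign 5 (.const 0)) <| .seq (.assign 6 (.const 0)) <| .forTo 4 1 <|
    .ite (.get 0 (.add (.get 1 (.var v)) (.var 4)))
      (.ite (.get a (.var 4))
        (.seq (.assign 5 (.add (.var 5) (.const 1)))
          (.assign 6 (.add (.var 6) (.get 6 (.var 4))))) .skip) .skip

variable [DecidableRel G.Adj]

theorem runs_countProg (hE : Env G k s) (hL : n ≤ L) (hv : v ≠ 4 ∧ v ≠ 5 ∧ v ≠ 6) {u : Fin n}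
    (hu : s.var v = u) : Runs L (countProg a v) s fun s' =>
      s'.var 5 = dg G (sset n s a) u ∧
      s'.var 6 = ∑ w ∈ (sset n s a).filter (G.Adj u), s.arr 6 w := by
  obtain ⟨hv4, hv5, hv6⟩ := hv
  refine Runs.seq (Runs.assign (Runs.seq (Runs.assign ?_)))
  -- After `j` rounds both accumulators refer to the part of `F` with indices below `j`.
  set F := (sset n s a).filter (G.Adj u) with hF
  refine (Runs.forTo (by decide) (n := n) (by simp [hE.n_eq]) hL rfl rfl
    (fun j s' => s'.arr = s.arr ∧ s'.var v = u ∧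
      s'.var 5 = (F.filter fun w => w.val < j).card ∧
      s'.var 6 = ∑ w ∈ F.filter (fun w => w.val < j), s.arr 6 w) ?_ ?_ ?_).mono ?_
  · rintro j s' c ⟨h1, h2, h3, h4⟩
    exact ⟨h1, by simp [hv4, h2], by simp [h3], by simp [h4]⟩
  · exact ⟨rfl, by simp [hv5, hv6, hu], by simp [Expr.eval], by simp [Expr.eval]⟩
  · rintro j s' hj h4 - ⟨h1, h2, h3, h5⟩
    have hmem : (⟨j, hj⟩ : Fin n) ∈ F ↔ s.arr a j ≠ 0 ∧ G.Adj u ⟨j, hj⟩ := by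
      simp [hF]
    have hadj := hE.adj u ⟨j, hj⟩
    simp only at hadj
    have hcond : (Expr.get 0 (.add (.get 1 (.var v)) (.var 4))).eval s' = s.arr 0 (2 + u * n + j) := by
      simp [Expr.eval, h1, h2, h4, hE.row u u.2]
    rw [filter_lt_succ F hj]
    refine Runs.ite (fun hc => Runs.ite (fun hc2 => ?_) fun hc2 => ?_) fun hc => ?_
    · rw [hcond] at hc
      simp only [Expr.eval, h1, h4] at hc2
      rw [if_pos (hmem.2 ⟨hc2, hadj.1 hc⟩)]
      refine Runs.seq (Runs.assign (Runs.assign ⟨h1, by simp [hv5, hv6, h2], ?_, ?_⟩))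
      · rw [Finset.card_insert_of_notMem (by simp)]
        simp [Expr.eval, h3]
      · rw [Finset.sum_insert (by simp)]
        simp [Expr.eval, h5, h1, h4, add_comm]
    · simp only [Expr.eval, h1, h4] at hc2
      rw [if_neg fun h => (hmem.1 h).1 hc2]
      exact Runs.skip ⟨h1, h2, h3, h5⟩
    · rw [hcond] at hc
      rw [if_neg fun h => hadj.2 (hmem.1 h).2 hc]
      exact Runs.skip ⟨h1, h2, h3, h5⟩
  · rintro s' - ⟨-, -, h3, h4⟩
    rw [filter_lt_self] at h3 h4
    exact ⟨h3, h4⟩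

/-- One pass of pruning the set `5`. -/
def prunePass : Prog :=
  .forTo 3 1 <| .ite (.get 5 (.var 3))
    (.seq (countProg 5 3) (.ite (.sub (.const 2) (.var 5))
      (.seq (.store 5 (.var 3) (.const 0)) (.assign 7 (.const 1))) .skip)) .skip

/-- Prune the set `5`. -/
def pruneProg : Prog :=
  .seq (.assign 7 (.const 1)) (.loop (.var 7) (.seq (.assign 7 (.const 0)) prunePass))

/-- Degrees counted before a deletion may be stale afterwards, so the pass certifies a core only if
variable `7` stayed zero and all counts refer to the unchanged set. Otherwise the set shrank, which
bounds the number of passes. -/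
theorem runs_prunePass (hE : Env G k s) (hL : n ≤ L) (h7 : s.var 7 = 0) :
    Runs L prunePass s fun s' => Pruned G (sset n s 5) (sset n s' 5) ∧
      (s'.var 7 = 0 → sset n s' 5 = sset n s 5 ∧ Core G (sset n s 5)) ∧
      (s'.var 7 ≠ 0 → (sset n s' 5).card < (sset n s 5).card) := by
  refine (Runs.forTo (by decide) (n := n) hE.n_eq hL rfl rfl
    (fun j s' => Env G k s' ∧ Pruned G (sset n s 5) (sset n s' 5) ∧
      (s'.var 7 = 0 → sset n s' 5 = sset n s 5 ∧
        ∀ w ∈ sset n s 5, w.val < j → 2 ≤ dg G (sset n s 5) w) ∧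
      (s'.var 7 ≠ 0 → (sset n s' 5).card < (sset n s 5).card)) ?_ ?_ ?_).mono ?_
  · rintro j s' c ⟨h1, h2, h3, h4⟩
    exact ⟨h1.set (by decide) (by decide), h2, by simpa using h3, by simpa using h4⟩
  · exact ⟨hE, .refl, fun _ => ⟨rfl, by simp⟩, fun h => absurd h7 h⟩
  · rintro j s' hj h3 - ⟨hE', hP, h0, h1⟩
    refine Runs.ite (fun hc => ?_) fun hc => ?_
    · simp only [Expr.eval, h3] at hc
      have hm : (⟨j, hj⟩ : Fin n) ∈ sset n s' 5 := by simpa using hc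
      refine Runs.seq ((runs_countProg hE' hL (by decide) (u := ⟨j, hj⟩) h3).mono
        fun s₁ hf ⟨h5, _⟩ => ?_)
      have hE₁ := hE'.frame hf rfl
      have hS : sset n s₁ 5 = sset n s' 5 := sset_congr (hf.arr 5 rfl)
      have h7' : s₁.var 7 = s'.var 7 := hf.var 7 rfl
      have h3' : s₁.var 3 = j := (hf.var 3 rfl).trans h3
      refine Runs.ite (fun hc2 => ?_) fun hc2 => ?_
      · simp only [Expr.eval, h5] at hc2
        refine Runs.seq (Runs.store (Runs.assign ?_))
        simp only [Expr.eval, h3', sset_set, State.set_var, if_true]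
        have hput := sset_put_zero (s := s₁) (a := 5) (⟨j, hj⟩ : Fin n)
        simp only at hput
        rw [hput, hS]
        refine ⟨(hE₁.put (by decide) (by decide)).set (by decide) (by decide),
          .step hP hm (by omega), by simp, fun _ => ?_⟩
        exact (Finset.card_erase_lt_of_mem hm).trans_le (Finset.card_le_card hP.subset)
      · simp only [Expr.eval, h5] at hc2
        refine Runs.skip ⟨hE₁, hS ▸ hP, fun h => ?_, fun h => ?_⟩
        · rw [h7'] at h
          rw [hS]
          refine ⟨(h0 h).1, fun w hw hwj => ?_⟩
          rcases Nat.lt_succ_iff_lt_or_eq.1 hwj with hwj | hwj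
          · exact (h0 h).2 w hw hwj
          · have : w = ⟨j, hj⟩ := Fin.ext hwj
            rw [this, ← (h0 h).1]
            omega
        · rw [h7'] at h
          rw [hS]
          exact h1 h
    · simp only [Expr.eval, h3] at hc
      refine Runs.skip ⟨hE', hP, fun h => ⟨(h0 h).1, fun w hw hwj => ?_⟩, h1⟩
      rcases Nat.lt_succ_iff_lt_or_eq.1 hwj with hwj | hwj
      · exact (h0 h).2 w hw hwj
      · rw [← (h0 h).1, mem_sset, hwj] at hw
        exact absurd hc hw
  · rintro s' - ⟨-, h1, h2, h3⟩
    exact ⟨h1, fun h => ⟨(h2 h).1, fun w hw => (h2 h).2 w hw w.2⟩, h3⟩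

theorem Pruned.trans {V : Type*} [DecidableEq V] {G : SimpleGraph V} [DecidableRel G.Adj]
    {S T R : Finset V} (h1 : Pruned G S T) (h2 : Pruned G T R) : Pruned G S R := by
  induction h2 with
  | refl => exact h1
  | step _ hv hd ih => exact .step ih hv hd

theorem sset_card_le : (sset n s a).card ≤ n := (Finset.card_le_univ _).trans (by simp)

theorem runs_pruneProg (hE : Env G k s) (hL : n + 1 ≤ L) :
    Runs L pruneProg s fun s' => Pruned G (sset n s 5) (sset n s' 5) ∧ Core G (sset n s' 5) := by
  refine Runs.seq (Runs.assign ?_)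
  refine (Runs.loop (fun m s' => Env G k s' ∧ Pruned G (sset n s 5) (sset n s' 5) ∧
    (s'.var 7 = 0 → Core G (sset n s' 5)) ∧
    (s'.var 7 ≠ 0 → (sset n s' 5).card < m)) ?_ (m := n + 1) hL ?_).mono ?_
  · rintro m s₁ ⟨hE₁, hP, h0, h1⟩ hc
    simp only [Expr.eval] at hc
    refine Runs.seq (Runs.assign ?_)
    refine (runs_prunePass (hE₁.set (by decide) (by decide)) (by omega) (by simp [Expr.eval])).mono
      fun s₂ hf ⟨hP2, h2, h3⟩ => ?_
    simp only [sset_set] at hP2 h2 h3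
    have := h1 hc
    refine ⟨m - 1, by omega, (hE₁.set (by decide) (by decide)).frame hf rfl, hP.trans hP2,
      fun h => ?_, fun h => ?_⟩
    · rw [(h2 h).1]
      exact (h2 h).2
    · have := h3 h
      omega
  · refine ⟨hE.set (by decide) (by decide), .refl, by simp [Expr.eval], fun _ => ?_⟩
    exact Nat.lt_succ_of_le sset_card_le
  · rintro s' - ⟨h, m, -, h1, h2, -⟩
    exact ⟨h1, h2 h⟩

end

end InducedPacking

/-! ### The program that grows a set by candidates of least value. -/

namespace InducedPacking
open RAM

section

variable {n k : ℕ} {G : SimpleGraph (Fin n)} {s s' : State} {a b x v i L : ℕ}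

/-- The depths recorded in array `6`. -/
def depths (n : ℕ) (s : State) (v : Fin n) : ℕ := s.arr 6 v

/-- Record the vertex `3` as the best candidate so far, with value `12`. -/
def recordProg : Prog := .seq (.assign 10 (.add (.var 3) (.const 1))) (.assign 11 (.var 12))

/-- Examine the vertex `3`, which lies in the set `4` but not in the set `5`. -/
def examineProg : Prog :=
  .seq (countProg 5 3) <| .ite (.var 5)
    (.ite (.sub (.var 5) (.const 1)) (.assign 8 (.add (.var 3) (.const 1)))
      (.seq (.assign 12 (.var 6)) <| .seq (countProg 4 3) <|
        .seq (.ite (.sub (.var 5) (.const 2)) (.assign 12 (.add (.var 12) (.const 1))) .skip) <|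
          .ite (.var 10) (.ite (.sub (.var 11) (.var 12)) recordProg .skip) recordProg)) .skip

/-- Look for a vertex of the set `4` outside the set `5` that has two neighbours in the set `5`, and
for one of least value among those that have one. -/
def scanProg : Prog :=
  .forTo 3 1 <| .ite (.get 4 (.var 3)) (.ite (.get 5 (.var 3)) .skip examineProg) .skip

/-- Grow the set `5` inside the set `4`. -/
def growProg : Prog :=
  .seq (.assign 8 (.const 0)) <| .seq (.assign 9 (.const 1)) <| .loop (.var 9) <|
    .seq (.assign 10 (.const 0)) <| .seq scanProg <| .ite (.var 8) (.assign 9 (.const 0)) <|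
      .ite (.var 10)
        (.seq (.store 5 (.sub (.var 10) (.const 1)) (.const 1))
          (.store 6 (.sub (.var 10) (.const 1)) (.var 11)))
        (.assign 9 (.const 0))

variable [DecidableRel G.Adj]

variable (G) in
/-- The state of a scan after the vertices that satisfy `p`. -/
structure Scanned (U S : Finset (Fin n)) (D : Fin n → ℕ) (p : Fin n → Prop) (s : State) : Prop where
  le_one : s.var 8 = 0 → ∀ u ∈ U, u ∉ S → p u → dg G S u ≤ 1
  found : s.var 8 ≠ 0 → ∃ y : Fin n, s.var 8 = y + 1 ∧ y ∈ U ∧ y ∉ S ∧ 2 ≤ dg G S y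
  none : s.var 10 = 0 → ∀ u ∈ U, u ∉ S → p u → dg G S u ≠ 1
  best : s.var 10 ≠ 0 → ∃ v : Fin n, s.var 10 = v + 1 ∧ v ∈ U ∧ v ∉ S ∧ dg G S v = 1 ∧
    s.var 11 = gval G U S D v ∧
    ∀ u ∈ U, u ∉ S → p u → dg G S u = 1 → gval G U S D v ≤ gval G U S D u

theorem Scanned.congr {U S : Finset (Fin n)} {D : Fin n → ℕ} {p : Fin n → Prop}
    (h : Scanned G U S D p s) (h8 : s'.var 8 = s.var 8) (h10 : s'.var 10 = s.var 10)
    (h11 : s'.var 11 = s.var 11) : Scanned G U S D p s' := by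
  obtain ⟨h1, h2, h3, h4⟩ := h
  exact ⟨by rwa [h8], by rwa [h8], by rwa [h10], by rwa [h10, h11]⟩

/-- Vertices without neighbours in `S` affect neither search, so they may be counted as scanned. -/
theorem Scanned.skip {U S : Finset (Fin n)} {D : Fin n → ℕ} {p q : Fin n → Prop}
    (h : Scanned G U S D p s) (hq : ∀ u ∈ U, u ∉ S → q u → p u ∨ dg G S u = 0) :
    Scanned G U S D q s := by
  obtain ⟨h1, h2, h3, h4⟩ := h
  refine ⟨fun h u hu huS hqu => ?_, h2, fun h u hu huS hqu => ?_, fun h => ?_⟩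
  · rcases hq u hu huS hqu with h' | h'
    · exact h1 h u hu huS h'
    · omega
  · rcases hq u hu huS hqu with h' | h'
    · exact h3 h u hu huS h'
    · omega
  · obtain ⟨v, h5, h6, h7, h8, h9, h10⟩ := h4 h
    refine ⟨v, h5, h6, h7, h8, h9, fun u hu huS hqu hd => ?_⟩
    rcases hq u hu huS hqu with h' | h'
    · exact h10 u hu huS h' hd
    · omega

theorem Scanned.addFound {U S : Finset (Fin n)} {D : Fin n → ℕ} {p q : Fin n → Prop}
    (h : Scanned G U S D p s) {y : Fin n} (hq : ∀ u, q u → p u ∨ u = y) (hyU : y ∈ U)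
    (hyS : y ∉ S) (hd : 2 ≤ dg G S y) : Scanned G U S D q (s.set 8 (y + 1)) := by
  obtain ⟨h1, h2, h3, h4⟩ := h
  refine ⟨by simp, fun _ => ⟨y, by simp, hyU, hyS, hd⟩, fun h u hu huS hqu => ?_, fun h => ?_⟩
  · rcases hq u hqu with h' | rfl
    · exact h3 (by simpa using h) u hu huS h'
    · omega
  · obtain ⟨v, h5, h6, h7, h8, h9, h10⟩ := h4 (by simpa using h)
    refine ⟨v, by simpa using h5, h6, h7, h8, by simpa using h9, fun u hu huS hqu hd => ?_⟩
    rcases hq u hqu with h' | rfl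
    · exact h10 u hu huS h' hd
    · omega

theorem Scanned.keepBest {U S : Finset (Fin n)} {D : Fin n → ℕ} {p q : Fin n → Prop}
    (h : Scanned G U S D p s) {y : Fin n} (hq : ∀ u, q u → p u ∨ u = y)
    (hd : dg G S y = 1) (h10 : s.var 10 ≠ 0) (h11 : s.var 11 ≤ gval G U S D y) :
    Scanned G U S D q s := by
  obtain ⟨h1, h2, h3, h4⟩ := h
  refine ⟨fun h u hu huS hqu => ?_, h2, fun h => absurd h h10, fun h => ?_⟩
  · rcases hq u hqu with h' | rfl
    · exact h1 h u hu huS h'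
    · omega
  · obtain ⟨v, h5, h6, h7, h8, h9, h12⟩ := h4 h
    refine ⟨v, h5, h6, h7, h8, h9, fun u hu huS hqu hd => ?_⟩
    rcases hq u hqu with h' | rfl
    · exact h12 u hu huS h' hd
    · omega

theorem Scanned.newBest {U S : Finset (Fin n)} {D : Fin n → ℕ} {p q : Fin n → Prop}
    (h : Scanned G U S D p s) {y : Fin n} (hq : ∀ u, q u → p u ∨ u = y) (hyU : y ∈ U)
    (hyS : y ∉ S) (hd : dg G S y = 1) (h11 : s.var 10 ≠ 0 → gval G U S D y ≤ s.var 11) :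
    Scanned G U S D q ((s.set 10 (y + 1)).set 11 (gval G U S D y)) := by
  obtain ⟨h1, h2, h3, h4⟩ := h
  refine ⟨fun h u hu huS hqu => ?_, fun h => by simpa using h2 (by simpa using h), by simp,
    fun _ => ⟨y, by simp, hyU, hyS, hd, by simp, fun u hu huS hqu hdu => ?_⟩⟩
  · rcases hq u hqu with h' | rfl
    · exact h1 (by simpa using h) u hu huS h'
    · omega
  · rcases hq u hqu with h' | rfl
    · by_cases h10 : s.var 10 = 0
      · exact absurd hdu (h3 h10 u hu huS h')
      · obtain ⟨v, -, -, -, -, h9, h12⟩ := h4 h10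
        have := h11 h10
        have := h12 u hu huS h' hdu
        omega
    · exact le_rfl

theorem runs_examineProg (hE : Env G k s) (hL : n ≤ L) {p q : Fin n → Prop} {y : Fin n}
    (hq : ∀ u, q u → p u ∨ u = y) (h3 : s.var 3 = y)
    (hyU : y ∈ sset n s 4) (hyS : y ∉ sset n s 5)
    (h : Scanned G (sset n s 4) (sset n s 5) (depths n s) p s) :
    Runs L examineProg s fun s' => Scanned G (sset n s 4) (sset n s 5) (depths n s) q s' := by
  refine Runs.seq ((runs_countProg hE hL (by decide) h3).mono fun s₁ hf₁ ⟨hc, hsum⟩ => ?_)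
  have hE₁ := hE.frame hf₁ rfl
  have hS₁ := h.congr (hf₁.var 8 rfl) (hf₁.var 10 rfl) (hf₁.var 11 rfl)
  have h3₁ : s₁.var 3 = y := (hf₁.var 3 rfl).trans h3
  refine Runs.ite (fun he => Runs.ite (fun he2 => Runs.assign ?_) fun he2 => ?_) fun he => ?_
  · simp only [Expr.eval, hc] at he2
    simp only [Expr.eval, h3₁]
    exact hS₁.addFound hq hyU hyS (by omega)
  · simp only [Expr.eval, hc] at he he2
    have hd : dg G (sset n s 5) y = 1 := by omega
    -- The depth of the only neighbour is saved in variable `12`, because counting in the set `4`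
    -- overwrites variable `6`; the branch test then completes the value.
    refine Runs.seq (Runs.assign (Runs.seq ?_))
    refine (runs_countProg (hE₁.set (by decide) (by decide)) hL (by decide) (u := y)
      (by simp [h3₁])).mono fun s₂ hf₂ ⟨hc2, _⟩ => ?_
    have hU : sset n (s₁.set 12 ((Expr.var 6).eval s₁)) 4 = sset n s 4 := by
      rw [sset_set]
      exact sset_congr (hf₁.arr 4 rfl)
    rw [hU] at hc2
    have hS₂ := hS₁.congr (s' := s₂) (by rw [hf₂.var 8 rfl]; simp) (by rw [hf₂.var 10 rfl]; simp)
      (by rw [hf₂.var 11 rfl]; simp)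
    have h3₂ : s₂.var 3 = y := by rw [hf₂.var 3 rfl]; simp [h3₁]
    have h12₂ : s₂.var 12 = ∑ w ∈ (sset n s 5).filter (G.Adj y), s.arr 6 w := by
      rw [hf₂.var 12 rfl]
      simp [Expr.eval, hsum]
    refine Runs.seq (Runs.mono (Q := fun s₃ => s₃.var 12 = gval G (sset n s 4) (sset n s 5)
      (depths n s) y) (Runs.ite (fun he3 => Runs.assign ?_) fun he3 => Runs.skip ?_)
      fun s₃ hf₃ h12₃ => ?_)
    · simp only [Expr.eval, hc2] at he3
      simp only [State.set_var, if_true, Expr.eval, h12₂]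
      rw [gval, if_pos (by omega)]
      rfl
    · simp only [Expr.eval, hc2] at he3
      rw [gval, if_neg (by omega), h12₂]
      rfl
    · have hS₃ := hS₂.congr (hf₃.var 8 rfl) (hf₃.var 10 rfl) (hf₃.var 11 rfl)
      have h3₃ : s₃.var 3 = y := (hf₃.var 3 rfl).trans h3₂
      have hrec : (s₃.var 10 ≠ 0 → gval G (sset n s 4) (sset n s 5) (depths n s) y ≤ s₃.var 11) →
          Runs L recordProg s₃ fun s' =>
            Scanned G (sset n s 4) (sset n s 5) (depths n s) q s' := by
        intro hle
        refine Runs.seq (Runs.assign (Runs.assign ?_))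
        have := hS₃.newBest hq hyU hyS hd hle
        simpa [Expr.eval, h3₃, h12₃] using this
      refine Runs.ite (fun he4 => Runs.ite (fun he5 => ?_) fun he5 => ?_) fun he4 => ?_
      · simp only [Expr.eval, h12₃] at he5
        exact hrec fun _ => by omega
      · simp only [Expr.eval, h12₃] at he5
        exact Runs.skip (hS₃.keepBest hq hd he4 (by omega))
      · exact hrec fun h => absurd he4 h
  · simp only [Expr.eval, hc] at he
    refine Runs.skip (hS₁.skip fun u _ _ hu => ?_)
    rcases hq u hu with h' | rfl
    · exact Or.inl h'
    · exact Or.inr he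

theorem runs_scanProg (hE : Env G k s) (hL : n ≤ L) (h8 : s.var 8 = 0) (h10 : s.var 10 = 0) :
    Runs L scanProg s fun s' =>
      Scanned G (sset n s 4) (sset n s 5) (depths n s) (fun _ => True) s' := by
  refine (Runs.forTo (by decide) (n := n) hE.n_eq hL rfl rfl (fun j s' => Env G k s' ∧
      s'.arr = s.arr ∧
      Scanned G (sset n s 4) (sset n s 5) (depths n s) (fun u => u.val < j) s') ?_ ?_ ?_).mono ?_
  · rintro j s' c ⟨h1, h2, h3⟩
    exact ⟨h1.set (by decide) (by decide), h2, h3.congr (by simp) (by simp) (by simp)⟩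
  · exact ⟨hE, rfl, by simp, fun h => absurd h8 h, by simp, fun h => absurd h10 h⟩
  · rintro j s' hj h3 - ⟨hE', harr, hS⟩
    have h4 : sset n s 4 = sset n s' 4 := (sset_congr (by rw [harr])).symm
    have h5 : sset n s 5 = sset n s' 5 := (sset_congr (by rw [harr])).symm
    have h6 : depths n s = depths n s' := by
      funext u
      simp [depths, harr]
    have hq : ∀ u : Fin n, u.val < j + 1 → u.val < j ∨ u = ⟨j, hj⟩ := by
      intro u hu
      rw [Fin.ext_iff]
      simp only
      omega
    have hskip : ((⟨j, hj⟩ : Fin n) ∈ sset n s 4 → (⟨j, hj⟩ : Fin n) ∈ sset n s 5) →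
        Scanned G (sset n s 4) (sset n s 5) (depths n s) (fun u => u.val < j + 1) s' := by
      intro himp
      refine hS.skip fun u hu huS huj => ?_
      rcases hq u huj with h' | rfl
      · exact Or.inl h'
      · exact absurd (himp hu) huS
    refine Runs.ite (fun he => Runs.ite (fun he2 => Runs.skip ⟨hE', harr, hskip ?_⟩)
      fun he2 => ?_) fun he => Runs.skip ⟨hE', harr, hskip ?_⟩
    · simp only [Expr.eval, h3] at he2
      simpa [harr] using fun _ => harr ▸ he2
    · simp only [Expr.eval, h3] at he he2
      rw [h4, h5, h6] at hS ⊢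
      refine (runs_examineProg hE' hL hq h3 (by simpa using he) (by simpa using he2) hS).mono
        fun s₁ hf h => ⟨hE'.frame hf rfl, ?_, h⟩
      rw [← harr]
      funext a
      exact hf.arr a rfl
    · simp only [Expr.eval, h3] at he
      simp [← harr, he]
  · rintro s' - ⟨-, -, h⟩
    exact h.skip fun u _ _ _ => Or.inl u.2

theorem runs_growProg (hE : Env G k s) (hL : n + 1 ≤ L) (hD : ∀ v : Fin n, s.arr 6 v = 0) :
    Runs L growProg s fun s' =>
      Grown G (sset n s 4) (sset n s 5) (sset n s' 5) (depths n s') ∧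
      (s'.var 8 = 0 → ∀ u ∈ sset n s 4, u ∉ sset n s' 5 → dg G (sset n s' 5) u = 0) ∧
      (s'.var 8 ≠ 0 → ∃ y : Fin n, s'.var 8 = y + 1 ∧ y ∈ sset n s 4 ∧ y ∉ sset n s' 5 ∧
        2 ≤ dg G (sset n s' 5) y) := by
  refine Runs.seq (Runs.assign (Runs.seq (Runs.assign ?_)))
  set U := sset n s 4 with hU
  -- Each continuing round moves a vertex of `U` into the set `5`. The bound `n + 1` leaves room for
  -- the round that finds nothing to add.
  refine (Runs.loop (fun m s' => Env G k s' ∧ s'.arr 4 = s.arr 4 ∧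
    Grown G U (sset n s 5) (sset n s' 5) (depths n s') ∧
    (s'.var 9 ≠ 0 → s'.var 8 = 0 ∧ (U \ sset n s' 5).card < m) ∧
    (s'.var 9 = 0 → s'.var 8 = 0 → ∀ u ∈ U, u ∉ sset n s' 5 → dg G (sset n s' 5) u = 0) ∧
    (s'.var 8 ≠ 0 → ∃ y : Fin n, s'.var 8 = y + 1 ∧ y ∈ U ∧ y ∉ sset n s' 5 ∧
        2 ≤ dg G (sset n s' 5) y)) ?_ (m := n + 1) hL ?_).mono ?_
  · rintro m s₁ ⟨hE₁, h4, hG, hgo, -, -⟩ he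
    simp only [Expr.eval] at he
    obtain ⟨h8, hm⟩ := hgo he
    refine Runs.seq (Runs.assign (Runs.seq ?_))
    have hE₁' : Env G k (s₁.set 10 0) := hE₁.set (by decide) (by decide)
    refine (runs_scanProg (s := s₁.set 10 0) hE₁' (by omega) (by simpa using h8) (by simp)).mono
      fun s₂ hf hS => ?_
    have hE₂ := hE₁'.frame hf rfl
    have hU₁ : sset n (s₁.set 10 0) 4 = U := sset_congr h4
    have hI₁ : sset n (s₁.set 10 0) 5 = sset n s₁ 5 := rfl
    have hD₁ : depths n (s₁.set 10 0) = depths n s₁ := rfl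
    rw [hU₁, hI₁, hD₁] at hS
    have hI₂ : sset n s₂ 5 = sset n s₁ 5 := sset_congr (hf.arr 5 rfl)
    have hD₂ : depths n s₂ = depths n s₁ := by
      funext u
      simp [depths, hf.arr 6 rfl]
    have h4₂ : s₂.arr 4 = s.arr 4 := (hf.arr 4 rfl).trans h4
    refine Runs.ite (fun he2 => Runs.assign ?_) fun he2 => Runs.ite (fun he3 => ?_)
      fun he3 => Runs.assign ?_
    · simp only [Expr.eval] at he2
      refine ⟨0, by omega, hE₂.set (by decide) (by decide), h4₂, ?_, by simp [Expr.eval],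
        fun _ h => ?_, fun _ => ?_⟩
      · rw [sset_set, hI₂]
        exact hD₂ ▸ hG
      · exact absurd (by simpa using h) he2
      · rw [sset_set, hI₂]
        simpa using hS.found he2
    · simp only [Expr.eval] at he2 he3
      obtain ⟨v, hv, hvU, hvS, hd, h11, hmin⟩ := hS.best he3
      refine Runs.seq (Runs.store (Runs.store ?_))
      have hv' : s₂.var 10 - 1 = v.val := by omega
      simp only [Expr.eval, State.put_var, hv', h11]
      have hI₃ : sset n ((s₂.put 5 v 1).put 6 v (gval G U (sset n s₁ 5) (depths n s₁) v)) 5 =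
          insert v (sset n s₁ 5) := by
        rw [sset_put_ne (by decide), sset_put_ne_zero _ (by decide), hI₂]
      have hD₃ : depths n ((s₂.put 5 v 1).put 6 v (gval G U (sset n s₁ 5) (depths n s₁) v)) =
          Function.update (depths n s₁) v (gval G U (sset n s₁ 5) (depths n s₁) v) := by
        funext u
        rw [Function.update_apply, ← hD₂]
        simp [depths, Fin.ext_iff]
      refine ⟨m - 1, by omega, (hE₂.put (by decide) (by decide)).put (by decide) (by decide), ?_,
        ?_, fun _ => ⟨by simpa using he2, ?_⟩, fun h => ?_, fun h => ?_⟩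
      · rw [State.put_arr, if_neg (by decide), State.put_arr, if_neg (by decide), h4₂]
      · rw [hI₃, hD₃]
        exact hG.step (fun u hu huS => hS.le_one he2 u hu huS trivial) hvU hvS hd
          fun u hu huS hdu => hmin u hu huS trivial hdu
      · rw [hI₃]
        have : (U \ insert v (sset n s₁ 5)).card < (U \ sset n s₁ 5).card :=
          Finset.card_lt_card ⟨Finset.sdiff_subset_sdiff subset_rfl (Finset.subset_insert _ _),
            fun h => (Finset.mem_sdiff.1 (h (Finset.mem_sdiff.2 ⟨hvU, hvS⟩))).2
              (Finset.mem_insert_self _ _)⟩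
        omega
      · change s₂.var 9 = 0 at h
        rw [hf.var 9 rfl] at h
        exact absurd (by simpa using h) he
      · exact absurd he2 h
    · simp only [Expr.eval] at he2 he3
      refine ⟨0, by omega, hE₂.set (by decide) (by decide), h4₂, ?_, by simp [Expr.eval],
        fun _ _ u hu huS => ?_, fun h => ?_⟩
      · rw [sset_set, hI₂]
        exact hD₂ ▸ hG
      · rw [sset_set, hI₂] at huS ⊢
        have h1 := hS.le_one he2 u hu huS trivial
        have h2 := hS.none he3 u hu huS trivial
        omega
      · exact absurd he2 (by simpa using h)
  · refine ⟨(hE.set (by decide) (by decide)).set (by decide) (by decide), rfl, .base hD, ?_, ?_, ?_⟩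
    · intro _
      refine ⟨by simp [Expr.eval], Nat.lt_succ_of_le ((Finset.card_le_univ _).trans (by simp))⟩
    · simp [Expr.eval]
    · simp [Expr.eval]
  · rintro s' - ⟨he, m, -, -, h1, -, h2, h3⟩
    exact ⟨h1, h2 he, h3⟩

end

end InducedPacking

/-! ### The program that finds a cycle in a core. -/

namespace InducedPacking
open RAM

section

variable {n k : ℕ} {G : SimpleGraph (Fin n)} {s s' : State} {a b x v i L : ℕ}

/-- Move the set `5` to the set `4`, clear the sets `5` and `6`, and let `13` point to an element. -/
def moveProg : Prog :=
  .seq (.assign 13 (.const 0)) <| .forTo 3 1 <|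
    .seq (.store 4 (.var 3) (.get 5 (.var 3))) <|
    .seq (.ite (.get 5 (.var 3)) (.assign 13 (.add (.var 3) (.const 1))) .skip) <|
    .seq (.store 5 (.var 3) (.const 0)) (.store 6 (.var 3) (.const 0))

/-- Find an induced cycle in the subgraph induced by the set `5`. -/
def cycleProg : Prog :=
  .seq pruneProg <| .seq moveProg <| .ite (.var 13)
    (.seq (.store 5 (.sub (.var 13) (.const 1)) (.const 1)) <| .seq growProg <|
      .seq (.store 5 (.sub (.var 8) (.const 1)) (.const 1)) pruneProg) .skip

theorem runs_moveProg (hE : Env G k s) (hL : n ≤ L) :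
    Runs L moveProg s fun s' => sset n s' 4 = sset n s 5 ∧ sset n s' 5 = ∅ ∧
      (∀ v : Fin n, s'.arr 6 v = 0) ∧ (s'.var 13 = 0 → sset n s 5 = ∅) ∧
      (s'.var 13 ≠ 0 → ∃ r : Fin n, s'.var 13 = r + 1 ∧ r ∈ sset n s 5) := by
  refine Runs.seq (Runs.assign ?_)
  refine (Runs.forTo (by decide) (n := n) (by simp [hE.n_eq]) hL rfl rfl (fun j s' =>
      (∀ u : Fin n, u.val < j → s'.arr 4 u = s.arr 5 u ∧ s'.arr 5 u = 0 ∧ s'.arr 6 u = 0) ∧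
      (∀ u : Fin n, j ≤ u.val → s'.arr 5 u = s.arr 5 u) ∧
      (s'.var 13 = 0 → ∀ u : Fin n, u.val < j → s.arr 5 u = 0) ∧
      (s'.var 13 ≠ 0 → ∃ r : Fin n, s'.var 13 = r + 1 ∧ r ∈ sset n s 5)) ?_ ?_ ?_).mono ?_
  · rintro j s' c ⟨h1, h2, h3, h4⟩
    exact ⟨h1, h2, by simpa using h3, by simpa using h4⟩
  · simp [Expr.eval]
  · rintro j s' hj h3 - ⟨h1, h2, h4, h5⟩
    have hlt : ∀ u : Fin n, u.val ≤ j → u.val < j ∨ u = ⟨j, hj⟩ := by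
      intro u hu
      rw [Fin.ext_iff]
      simp only
      omega
    refine Runs.seq (Runs.store (Runs.seq ?_))
    have hj5 := h2 ⟨j, hj⟩ le_rfl
    simp only at hj5
    refine Runs.ite (fun he => Runs.assign ?_) fun he => Runs.skip ?_
    all_goals
      simp only [Expr.eval, State.put_arr_apply, State.put_var, h3, hj5] at he ⊢
      norm_num at he
      refine Runs.seq (Runs.store (Runs.store ?_))
      simp only [Expr.eval, State.put_arr_apply, State.put_var, State.set_var, State.set_arr, h3]
      norm_num
      refine ⟨fun u hu => ?_, fun u hu => ?_, ?_⟩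
    · rcases hlt u hu with h' | rfl
      · have := h1 u h'
        simp [this, h'.ne]
      · simp
    · have : u.val ≠ j := by omega
      simp [this, h2 u (by omega)]
    · exact ⟨⟨j, hj⟩, rfl, by simpa using he⟩
    · rcases hlt u hu with h' | rfl
      · have := h1 u h'
        simp [this, h'.ne]
      · simp
    · have : u.val ≠ j := by omega
      simp [this, h2 u (by omega)]
    · refine ⟨fun h u hu => ?_, fun h => ?_⟩
      · rcases hlt u hu with h' | rfl
        · exact h4 h u h'
        · exact he
      · simpa using h5 h
  · rintro s' - ⟨h1, -, h3, h4⟩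
    refine ⟨?_, ?_, fun v => (h1 v v.2).2.2, fun h => ?_, h4⟩
    · ext u
      simp [h1 u u.2]
    · ext u
      simp [h1 u u.2]
    · ext u
      simp [h3 h u u.2]

variable [DecidableRel G.Adj]

theorem runs_cycleProg (hE : Env G k s) (hL : n + 1 ≤ L) :
    Runs L cycleProg s fun s' => Pruned G (sset n s 5) (sset n s' 4) ∧ Core G (sset n s' 4) ∧
      (s'.var 13 = 0 → sset n s' 4 = ∅) ∧
      (s'.var 13 ≠ 0 → ∃ y : Fin n, s'.var 8 = y + 1 ∧
        IsNewCycle G (sset n s' 4) (sset n s' 5) y) := by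
  refine Runs.seq ((runs_pruneProg hE hL).mono fun s₁ hf₁ ⟨hP, hC⟩ => Runs.seq ?_)
  have hE₁ := hE.frame hf₁ rfl
  refine (runs_moveProg hE₁ (by omega)).mono fun s₂ hf₂ ⟨h4, h5, h6, h0, h13⟩ => ?_
  have hE₂ := hE₁.frame hf₂ rfl
  rw [← h4] at hP hC h0 h13
  refine Runs.ite (fun he => ?_) fun he => Runs.skip ⟨hP, hC, h0, fun h => absurd he h⟩
  obtain ⟨r, hr, hrU⟩ := h13 he
  refine Runs.seq (Runs.store (Runs.seq ?_))
  have hr' : s₂.var 13 - 1 = r.val := by omega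
  simp only [Expr.eval, hr']
  have hE₃ : Env G k (s₂.put 5 r 1) := hE₂.put (by decide) (by decide)
  refine (runs_growProg hE₃ hL (by simpa using h6)).mono fun s₄ hf₄ ⟨hG, hno, hyes⟩ => ?_
  have hE₄ := hE₃.frame hf₄ rfl
  rw [sset_put_ne (by decide), sset_put_ne_zero _ (by decide), h5] at hG
  rw [sset_put_ne (by decide)] at hno hyes
  have hG' : Grown G (sset n s₂ 4) {r} (sset n s₄ 5) (depths n s₄) := hG
  -- A tree in a core cannot be closed off, so growth must have stopped at a vertex that closes a
  -- cycle.
  have h8 : s₄.var 8 ≠ 0 := by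
    intro h8
    obtain ⟨u, hu, huS, hd⟩ := hG'.exists_dg_ne_zero hrU hC
    exact hd (hno h8 u hu huS)
  obtain ⟨y, hy, hyU, hyS, hd⟩ := hyes h8
  have hd2 : dg G (sset n s₄ 5) y = 2 := by
    refine le_antisymm (hG'.dg_le_two (fun u _ _ => ?_) y hyU hyS) hd
    exact (Finset.card_filter_le _ _).trans (by simp)
  refine Runs.seq (Runs.store ?_)
  have hy' : s₄.var 8 - 1 = y.val := by omega
  simp only [Expr.eval, hy']
  have hE₅ : Env G k (s₄.put 5 y 1) := hE₄.put (by decide) (by decide)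
  refine (runs_pruneProg hE₅ hL).mono fun s₆ hf₆ ⟨hP₆, hC₆⟩ => ?_
  rw [sset_put_ne_zero _ (by decide)] at hP₆
  have h4₆ : sset n s₆ 4 = sset n s₂ 4 := by
    rw [sset_congr (hf₆.arr 4 rfl), sset_put_ne (by decide), sset_congr (hf₄.arr 4 rfl),
      sset_put_ne (by decide)]
  have h13₆ : s₆.var 13 = s₂.var 13 := by
    rw [hf₆.var 13 rfl, State.put_var, hf₄.var 13 rfl, State.put_var]
  rw [h4₆, h13₆]
  refine ⟨hP, hC, h0, fun _ => ⟨y, ?_, hG'.isNewCycle hrU hC hyU hyS hd2 hP₆ hC₆⟩⟩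
  rw [hf₆.var 8 rfl, State.put_var, hy]

end

end InducedPacking

/-! ### Tracing a 2-regular set into the output buffer. -/

namespace InducedPacking
open RAM

section

variable {n k : ℕ} {G : SimpleGraph (Fin n)} {s s' : State} {L : ℕ}

/-- The contents of the buffer: the first `14` entries of array `8`. -/
def buf (s : State) : List ℕ := (List.range (s.var 14)).map (s.arr 8)

/-- Let `17` point to a neighbour of the vertex `18` in the set `5`, if there is one. -/
def nextProg : Prog :=
  .seq (.assign 17 (.const 0)) <| .forTo 3 1 <|
    .ite (.get 5 (.var 3)) (.ite (.get 0 (.add (.get 1 (.var 18)) (.var 3)))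
      (.assign 17 (.add (.var 3) (.const 1))) .skip) .skip

/-- Write the vertex that `15` points to into the buffer, delete it from the set `5`, and move on to
a neighbour. -/
def traceStep : Prog :=
  .seq (.assign 18 (.sub (.var 15) (.const 1))) <|
  .seq (.store 8 (.add (.var 14) (.add (.var 16) (.const 1))) (.var 18)) <|
  .seq (.assign 16 (.add (.var 16) (.const 1))) <|
  .seq (.store 5 (.var 18) (.const 0)) <| .seq nextProg (.assign 15 (.var 17))

/-- Append the cycle with vertex set `5` to the buffer and count it in `19`. -/
def traceProg : Prog :=
  .seq (.assign 15 (.var 8)) <| .seq (.assign 16 (.const 0)) <| .seq (.loop (.var 15) traceStep) <|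
  .seq (.store 8 (.var 14) (.var 16)) <|
  .seq (.assign 14 (.add (.var 14) (.add (.var 16) (.const 1)))) <|
  .assign 19 (.add (.var 19) (.const 1))

theorem runs_nextProg (hE : Env G k s) (hL : n ≤ L) {u : Fin n} (hu : s.var 18 = u) :
    Runs L nextProg s fun s' =>
      (s'.var 17 = 0 → ∀ w ∈ sset n s 5, ¬ G.Adj u w) ∧
      (s'.var 17 ≠ 0 → ∃ w ∈ sset n s 5, s'.var 17 = w + 1 ∧ G.Adj u w) := by
  refine Runs.seq (Runs.assign ?_)
  refine (Runs.forTo (by decide) (n := n) (by simp [hE.n_eq]) hL rfl rfl (fun j s' =>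
      s'.arr = s.arr ∧ s'.var 18 = u ∧
      (s'.var 17 = 0 → ∀ w ∈ sset n s 5, w.val < j → ¬ G.Adj u w) ∧
      (s'.var 17 ≠ 0 → ∃ w ∈ sset n s 5, s'.var 17 = w + 1 ∧ G.Adj u w)) ?_ ?_ ?_).mono ?_
  · rintro j s' c ⟨h1, h2, h3, h4⟩
    exact ⟨h1, by simpa using h2, by simpa using h3, by simpa using h4⟩
  · simp [Expr.eval, hu]
  · rintro j s' hj h3 - ⟨h1, h2, h4, h5⟩
    have hadj := hE.adj u ⟨j, hj⟩
    simp only at hadj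
    have hskip : ((⟨j, hj⟩ : Fin n) ∈ sset n s 5 → ¬ G.Adj u ⟨j, hj⟩) → s'.var 17 = 0 →
        ∀ w ∈ sset n s 5, w.val < j + 1 → ¬ G.Adj u w := by
      intro himp h0 w hw hwj
      rcases Nat.lt_succ_iff_lt_or_eq.1 hwj with h' | h'
      · exact h4 h0 w hw h'
      · obtain rfl : w = ⟨j, hj⟩ := Fin.ext h'
        exact himp hw
    have hcond : (Expr.get 0 (.add (.get 1 (.var 18)) (.var 3))).eval s' =
        s.arr 0 (2 + u * n + j) := by
      simp [Expr.eval, h1, h2, h3, hE.row u u.2]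
    refine Runs.ite (fun he => Runs.ite (fun he2 => Runs.assign ?_) fun he2 => Runs.skip ?_)
      fun he => Runs.skip ?_
    · rw [hcond] at he2
      simp only [Expr.eval, h3, h1] at he
      refine ⟨h1, by simpa using h2, by simp [Expr.eval], fun _ => ?_⟩
      exact ⟨⟨j, hj⟩, by simpa using he, by simp [Expr.eval, h3], hadj.1 he2⟩
    · rw [hcond] at he2
      exact ⟨h1, h2, hskip fun _ h => hadj.2 h he2, h5⟩
    · simp only [Expr.eval, h3, h1] at he
      exact ⟨h1, h2, hskip fun h => absurd he (by simpa using h), h5⟩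
  · rintro s' - ⟨-, -, h3, h4⟩
    exact ⟨fun h w hw => h3 h w hw w.2, h4⟩

/-- The invariant while a cycle in `Z` is traced: `l` is the path written so far. -/
structure Tracing (G : SimpleGraph (Fin n)) (k : ℕ) (Z : Finset (Fin n)) (s s' : State)
    (l : List (Fin n)) : Prop where
  env : Env G k s'
  nodup : l.Nodup
  isChain : l.IsChain G.Adj
  subset : ∀ v ∈ l, v ∈ Z
  rest : sset n s' 5 = Z \ l.toFinset
  pos : s'.var 14 = s.var 14
  len : s'.var 16 = l.length
  old : ∀ i < s.var 14, s'.arr 8 i = s.arr 8 i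
  -- The cell at `s.var 14` is left free for the length, which is known only at the end; hence the
  -- shift by one.
  new : (List.range l.length).map (fun i => s'.arr 8 (s.var 14 + (i + 1))) = l.map Fin.val
  final : s'.var 15 = 0 → ∃ hne : l ≠ [], ∀ v ∈ Z, G.Adj (l.getLast hne) v → v ∈ l
  next : s'.var 15 ≠ 0 → ∃ c ∈ Z, c ∉ l ∧ s'.var 15 = c + 1 ∧ ∀ u ∈ l.getLast?, G.Adj u c

variable [DecidableRel G.Adj]

theorem runs_traceStep (hL : n ≤ L) {Z : Finset (Fin n)} {l : List (Fin n)}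
    (h : Tracing G k Z s s' l) (h15 : s'.var 15 ≠ 0) :
    Runs L traceStep s' fun s'' => ∃ c ∈ Z, c ∉ l ∧ Tracing G k Z s s'' (l ++ [c]) := by
  obtain ⟨c, hcZ, hcl, hc, hadj⟩ := h.next h15
  have hc' : s'.var 15 - 1 = c.val := by omega
  refine Runs.seq (Runs.assign (Runs.seq (Runs.store (Runs.seq (Runs.assign (Runs.seq
    (Runs.store (Runs.seq ?_))))))))
  simp only [Expr.eval, State.set_var, State.put_var, hc', h.pos, h.len]
  norm_num
  set s₁ := (((s'.set 18 c).put 8 (s.var 14 + (l.length + 1)) c).set 16 (l.length + 1)).put 5 c 0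
    with hs₁
  have hE₁ : Env G k s₁ := (((h.env.set (by decide) (by decide)).put (by decide) (by decide)).set
    (by decide) (by decide)).put (by decide) (by decide)
  have hrest : sset n s₁ 5 = Z \ (l ++ [c]).toFinset := by
    rw [hs₁, sset_put_zero, sset_set, sset_put_ne (by decide), sset_set, h.rest]
    ext w
    simp only [Finset.mem_erase, Finset.mem_sdiff, List.mem_toFinset, List.mem_append,
      List.mem_singleton]
    tauto
  refine (runs_nextProg hE₁ hL (u := c) (by simp [hs₁])).mono fun s₂ hf ⟨hno, hyes⟩ =>
    Runs.assign ⟨c, hcZ, hcl, ?_⟩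
  rw [hrest] at hno hyes
  have hne : l ++ [c] ≠ [] := by simp
  refine ⟨(hE₁.frame hf rfl).set (by decide) (by decide), ?_, ?_, ?_, ?_, ?_, ?_, ?_, ?_, ?_, ?_⟩
  · rw [List.nodup_append]
    refine ⟨h.nodup, by simp, ?_⟩
    intro a ha b hb
    rw [List.mem_singleton] at hb
    rintro rfl
    exact hcl (hb ▸ ha)
  · rw [List.isChain_append]
    refine ⟨h.isChain, by simp, ?_⟩
    intro x hx y hy
    simp only [List.head?_cons, Option.mem_def, Option.some.injEq] at hy
    rw [← hy]
    exact hadj x hx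
  · intro w hw
    rcases List.mem_append.1 hw with h' | h'
    · exact h.subset w h'
    · rw [List.mem_singleton.1 h']
      exact hcZ
  · rw [sset_set, sset_congr (hf.arr 5 rfl), hrest]
  · simp [hf.var 14 rfl, hs₁, h.pos]
  · simp [hf.var 16 rfl, hs₁]
  · intro i hi
    rw [State.set_arr, hf.arr 8 rfl, ← h.old i hi]
    simp [hs₁]
    omega
  · rw [State.set_arr, hf.arr 8 rfl, List.length_append, List.length_singleton, List.range_succ,
      List.map_append, List.map_append, ← h.new]
    congr 1
    · refine List.map_congr_left fun i hi => ?_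
      have := List.mem_range.1 hi
      simp [hs₁]
      omega
    · simp [hs₁]
  · intro h0
    simp only [State.set_var, if_true, Expr.eval] at h0
    refine ⟨hne, fun v hv ha => ?_⟩
    rw [List.getLast_concat] at ha
    by_contra hvl
    -- Visited vertices have been deleted from the set `5`, so finding no next vertex means that the
    -- path is maximal.
    exact hno h0 v (Finset.mem_sdiff.2 ⟨hv, by rwa [List.mem_toFinset]⟩) ha
  · intro h0
    simp only [State.set_var, if_true, Expr.eval] at h0
    obtain ⟨w, hw, h17, ha⟩ := hyes h0
    rw [Finset.mem_sdiff, List.mem_toFinset] at hw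
    refine ⟨w, hw.1, hw.2, by simpa [Expr.eval] using h17, ?_⟩
    intro u hu
    rw [List.getLast?_concat, Option.mem_def, Option.some.injEq] at hu
    exact hu ▸ ha

theorem runs_traceProg (hE : Env G k s) (hL : n + 1 ≤ L) {y : Fin n} (hy : s.var 8 = y + 1)
    (hyZ : y ∈ sset n s 5) (hZ : ∀ v ∈ sset n s 5, dg G (sset n s 5) v = 2) :
    Runs L traceProg s fun s' => ∃ l : List (Fin n), IsCycleList G l ∧
      (∀ v ∈ l, v ∈ sset n s 5) ∧ buf s' = buf s ++ l.length :: l.map Fin.val ∧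
      s'.var 19 = s.var 19 + 1 := by
  set Z := sset n s 5 with hZdef
  refine Runs.seq (Runs.assign (Runs.seq (Runs.assign (Runs.seq ?_))))
  refine (Runs.loop (fun m s' => ∃ l, Tracing G k Z s s' l ∧ (Z \ l.toFinset).card < m) ?_
    (m := n + 1) hL ?_).mono ?_
  · rintro m s' ⟨l, hT, hm⟩ he
    refine (runs_traceStep (by omega) hT he).mono fun s'' _ ⟨c, hcZ, hcl, hT'⟩ =>
      ⟨m - 1, by omega, _, hT', ?_⟩
    have : (Z \ (l ++ [c]).toFinset).card < (Z \ l.toFinset).card := by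
      refine Finset.card_lt_card ⟨Finset.sdiff_subset_sdiff subset_rfl (by simp), fun h => ?_⟩
      have := h (Finset.mem_sdiff.2 ⟨hcZ, by simpa using hcl⟩)
      simp at this
    omega
  · refine ⟨[], ⟨(hE.set (by decide) (by decide)).set (by decide) (by decide), by simp, by simp,
      by simp, by simp [hZdef], by simp, by simp [Expr.eval], by simp, by simp,
      by simp [Expr.eval, hy], fun _ => ⟨y, hyZ, by simp, by simp [Expr.eval, hy], by simp⟩⟩, ?_⟩
    exact Nat.lt_succ_of_le ((Finset.card_le_univ _).trans (by simp))
  · rintro s' hf ⟨he, m, l, hT, -⟩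
    obtain ⟨hne, hmax⟩ := hT.final he
    refine Runs.seq (Runs.store (Runs.seq (Runs.assign (Runs.assign ?_))))
    refine ⟨l, isCycleList_of_maximal hZ hT.nodup hT.isChain hT.subset hne hmax, hT.subset, ?_, ?_⟩
    · simp only [buf, Expr.eval, State.set_var, State.set_arr, State.put_var, hT.pos, hT.len]
      norm_num
      -- The new buffer range splits into the old entries, the one cell for the length, and the
      -- vertices of the cycle.
      rw [List.range_add, List.map_append, add_comm l.length 1, List.range_add]
      congr 1
      · refine List.map_congr_left fun i hi => ?_
        have := List.mem_range.1 hi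
        rw [State.put_arr_apply, if_neg (by omega), hT.old i this]
      · simp only [List.range_one, List.map_append, List.map_map, List.map_cons, List.map_nil]
        rw [List.singleton_append]
        congr 1
        · simp
        · rw [← hT.new]
          refine List.map_congr_left fun i hi => ?_
          simp only [Function.comp_apply, State.put_arr_apply]
          rw [if_neg (by omega), add_comm 1 i]
    · simp [Expr.eval, hf.var 19 rfl]

end

end InducedPacking

/-! ### Programs that act vertex by vertex. -/

namespace InducedPacking
open RAM

section

variable {n k : ℕ} {G : SimpleGraph (Fin n)} {s s' : State} {L : ℕ}

/-- The rule for a loop over all vertices whose body changes only the cells of the current vertex. -/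
theorem runs_cells {P : Prog} (hE : Env G k s) (hL : n ≤ L) (hP3 : P.writesVar 3 = false)
    (hPE : keepsEnv P = true) (Φ : Fin n → (ℕ → ℕ) → Prop)
    (hbody : ∀ (u : Fin n) (s' : State), Env G k s' → s'.var 3 = u →
      (∀ b, P.writesArr b = false → s'.arr b = s.arr b) → (∀ b, s'.arr b u = s.arr b u) →
      Runs L P s' fun s'' => (∀ b i, i ≠ u.val → s''.arr b i = s'.arr b i) ∧
        Φ u fun b => s''.arr b u) :
    Runs L (Prog.forTo 3 1 P) s fun s' => ∀ u, Φ u fun b => s'.arr b u := by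
  have hP1 : P.writesVar 1 = false := by
    simp only [keepsEnv, Bool.and_eq_true, Bool.not_eq_true'] at hPE
    exact hPE.1.1.1
  refine (Runs.forTo (by decide) (n := n) hE.n_eq hL hP3 hP1 (fun j s' => Env G k s' ∧
    (∀ b, P.writesArr b = false → s'.arr b = s.arr b) ∧
    (∀ b i, j ≤ i → s'.arr b i = s.arr b i) ∧
    ∀ u : Fin n, u.val < j → Φ u fun b => s'.arr b u) ?_ ?_ ?_).mono ?_
  · rintro j s' c ⟨h1, h2, h3, h4⟩
    exact ⟨h1.set (by decide) (by decide), h2, h3, h4⟩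
  · exact ⟨hE, by simp, by simp, by simp⟩
  · rintro j s' hj h3 - ⟨hE', hfr, hge, hlt⟩
    refine (hbody ⟨j, hj⟩ s' hE' h3 hfr fun b => hge b j le_rfl).mono fun s'' hf ⟨ho, hΦ⟩ =>
      ⟨hE'.frame hf hPE, fun b hb => ?_, fun b i hi => ?_, fun u hu => ?_⟩
    · rw [hf.arr b hb, hfr b hb]
    · rw [ho b i (by simp only; omega), hge b i (by omega)]
    · rcases Nat.lt_succ_iff_lt_or_eq.1 hu with h' | h'
      · have : (fun b => s''.arr b u) = fun b => s'.arr b u := by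
          funext b
          exact ho b u (by simp only; omega)
        rw [this]
        exact hlt u h'
      · obtain rfl : u = ⟨j, hj⟩ := Fin.ext h'
        exact hΦ
  · rintro s' - ⟨-, -, -, h⟩
    exact fun u => h u u.2

/-- `H` to the set `5`, the vertices outside `H` and the ball around `X` to the set `4`, and zero to
the depths. Here `H` is the set `2` and `X` the set `3`. -/
def setupProg : Prog :=
  .forTo 3 1 <| .seq (.store 6 (.var 3) (.const 0)) <| .seq (.store 5 (.var 3) (.get 2 (.var 3))) <|
    .seq (.store 4 (.var 3) (.const 0)) <| .ite (.get 2 (.var 3)) .skip <|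
    .ite (.get 3 (.var 3)) .skip <| .seq (countProg 3 3) <|
    .ite (.var 5) .skip (.store 4 (.var 3) (.const 1))

/-- Copy the array `a` to the array `b`. -/
def copyProg (a b : ℕ) : Prog := .forTo 3 1 (.store b (.var 3) (.get a (.var 3)))

/-- Replace the set `5` by the set `4` minus the set `5`. -/
def complProg : Prog :=
  .forTo 3 1 <| .ite (.get 5 (.var 3)) (.store 5 (.var 3) (.const 0))
    (.store 5 (.var 3) (.get 4 (.var 3)))

/-- Replace `H` by the set `5` and add its branch vertices to `X`. -/
def branchProg : Prog :=
  .forTo 3 1 <| .seq (.store 2 (.var 3) (.get 5 (.var 3))) <| .ite (.get 5 (.var 3))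
    (.seq (countProg 5 3) (.ite (.sub (.var 5) (.const 2)) (.store 3 (.var 3) (.const 1)) .skip))
    .skip

/-- Add the set `5` to `H`. -/
def joinProg : Prog := .forTo 3 1 <| .ite (.get 5 (.var 3)) (.store 2 (.var 3) (.const 1)) .skip

/-- Let the set `7` consist of the vertices in the set `4` that are outside the closed neighbourhood
of the set `5`. -/
def removeProg : Prog :=
  .forTo 3 1 <| .seq (.store 7 (.var 3) (.const 0)) <| .ite (.get 4 (.var 3))
    (.ite (.get 5 (.var 3)) .skip <| .seq (countProg 5 3) <|
      .ite (.var 5) .skip (.store 7 (.var 3) (.const 1))) .skip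

theorem runs_copyProg {a b : ℕ} (hE : Env G k s) (hL : n ≤ L) (hb : 0 ≠ b ∧ 1 ≠ b) :
    Runs L (copyProg a b) s fun s' => sset n s' b = sset n s a := by
  refine (runs_cells hE hL rfl (by simp [keepsEnv, Prog.writesVar, Prog.writesArr, hb])
    (fun u c => c b = s.arr a u) fun u s' _ h3 _ hu => Runs.store ⟨?_, ?_⟩).mono ?_
  · intro c i hi
    simp [Expr.eval, h3, hi]
  · simp [Expr.eval, h3, hu]
  · intro s' _ h
    ext u
    simp [h u]

theorem runs_complProg (hE : Env G k s) (hL : n ≤ L) :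
    Runs L complProg s fun s' => sset n s' 5 = sset n s 4 \ sset n s 5 := by
  refine (runs_cells hE hL rfl rfl
    (fun u c => c 5 ≠ 0 ↔ s.arr 4 u ≠ 0 ∧ s.arr 5 u = 0) fun u s' _ h3 _ hu =>
      Runs.ite (fun he => Runs.store ⟨?_, ?_⟩) fun he => Runs.store ⟨?_, ?_⟩).mono ?_
  · intro c i hi
    simp [Expr.eval, h3, hi]
  · simp only [Expr.eval, h3, hu] at he
    simp [Expr.eval, h3, he]
  · intro c i hi
    simp [Expr.eval, h3, hi]
  · simp only [Expr.eval, h3, hu] at he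
    simp [Expr.eval, h3, he, hu]
  · intro s' _ h
    ext u
    rw [mem_sset, h u]
    simp

theorem runs_joinProg (hE : Env G k s) (hL : n ≤ L) :
    Runs L joinProg s fun s' => sset n s' 2 = sset n s 2 ∪ sset n s 5 := by
  refine (runs_cells hE hL rfl rfl
    (fun u c => c 2 ≠ 0 ↔ s.arr 2 u ≠ 0 ∨ s.arr 5 u ≠ 0) fun u s' _ h3 _ hu =>
      Runs.ite (fun he => Runs.store ⟨?_, ?_⟩) fun he => Runs.skip ⟨fun _ _ _ => rfl, ?_⟩).mono ?_
  · intro c i hi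
    simp [Expr.eval, h3, hi]
  · simp only [Expr.eval, h3, hu] at he
    simp [Expr.eval, h3, he]
  · simp only [Expr.eval, h3, hu] at he
    simp [hu, he]
  · intro s' _ h
    ext u
    rw [mem_sset, h u]
    simp

variable [DecidableRel G.Adj]

theorem runs_setupProg (hE : Env G k s) (hL : n ≤ L) :
    Runs L setupProg s fun s' => sset n s' 5 = sset n s 2 ∧ (∀ v : Fin n, s'.arr 6 v = 0) ∧
      ∀ v, v ∈ sset n s' 4 ↔ v ∉ sset n s 2 ∧ v ∉ sset n s 3 ∧ dg G (sset n s 3) v = 0 := by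
  refine (runs_cells hE hL rfl rfl (fun u c => c 5 = s.arr 2 u ∧ c 6 = 0 ∧
    (c 4 ≠ 0 ↔ s.arr 2 u = 0 ∧ s.arr 3 u = 0 ∧ dg G (sset n s 3) u = 0))
    fun u s' hE' h3 hfr hu => ?_).mono ?_
  · refine Runs.seq (Runs.store (Runs.seq (Runs.store (Runs.seq (Runs.store ?_)))))
    simp only [Expr.eval, State.put_var, h3]
    set s₁ := ((s'.put 6 u 0).put 5 u _).put 4 u 0 with hs₁
    have hE₁ : Env G k s₁ := ((hE'.put (by decide) (by decide)).put (by decide) (by decide)).put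
      (by decide) (by decide)
    have ho : ∀ b i, i ≠ u.val → s₁.arr b i = s'.arr b i := fun b i hi => by simp [hs₁, hi]
    have h2 : s₁.arr 2 u = s.arr 2 u := by simp [hs₁, hu]
    have h3' : s₁.arr 3 u = s.arr 3 u := by simp [hs₁, hu]
    have h4 : s₁.arr 4 u = 0 := by simp [hs₁]
    have h5 : s₁.arr 5 u = s.arr 2 u := by simp [hs₁, hu]
    have h6 : s₁.arr 6 u = 0 := by simp [hs₁]
    have hv3 : s₁.var 3 = u := by simp [hs₁, h3]
    have hX : sset n s₁ 3 = sset n s 3 := by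
      rw [hs₁, sset_put_ne (by decide), sset_put_ne (by decide), sset_put_ne (by decide)]
      exact sset_congr (hfr 3 rfl)
    clear_value s₁
    refine Runs.ite (fun he => Runs.skip ⟨ho, h5, h6, ?_⟩) fun he =>
      Runs.ite (fun he2 => Runs.skip ⟨ho, h5, h6, ?_⟩) fun he2 => Runs.seq ?_
    · simp only [Expr.eval, hv3, h2] at he
      simp [h4, he]
    · simp only [Expr.eval, hv3, h3'] at he2
      simp [h4, he2]
    · simp only [Expr.eval, hv3, h2, h3'] at he he2
      refine (runs_countProg hE₁ hL (by decide) hv3).mono fun s₂ hf ⟨hc, _⟩ => ?_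
      rw [hX] at hc
      have harr : s₂.arr = s₁.arr := funext fun a => hf.arr a rfl
      refine Runs.ite (fun he3 => Runs.skip ?_) fun he3 => Runs.store ?_
      · simp only [Expr.eval, hc] at he3
        rw [harr]
        refine ⟨ho, h5, h6, ?_⟩
        simp [h4, he3]
      · simp only [Expr.eval, hc] at he3
        simp only [Expr.eval, hf.var 3 rfl, hv3]
        refine ⟨fun b i hi => ?_, ?_, ?_, ?_⟩
        · simp [hi, harr, ho]
        · simp [harr, h5]
        · simp [harr, h6]
        · simp [he, he2, he3]
  · intro s' _ h
    refine ⟨?_, fun v => (h v).2.1, fun v => ?_⟩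
    · ext v
      simp [(h v).1]
    · rw [mem_sset, (h v).2.2]
      simp

theorem runs_branchProg (hE : Env G k s) (hL : n ≤ L) :
    Runs L branchProg s fun s' => sset n s' 2 = sset n s 5 ∧
      sset n s' 3 = sset n s 3 ∪ (sset n s 5).filter fun v => 3 ≤ dg G (sset n s 5) v := by
  refine (runs_cells hE hL rfl rfl (fun u c => c 2 = s.arr 5 u ∧
    (c 3 ≠ 0 ↔ s.arr 3 u ≠ 0 ∨ s.arr 5 u ≠ 0 ∧ 3 ≤ dg G (sset n s 5) u))
    fun u s' hE' h3 hfr hu => ?_).mono ?_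
  · refine Runs.seq (Runs.store ?_)
    simp only [Expr.eval, h3]
    set s₁ := s'.put 2 u _ with hs₁
    have hE₁ : Env G k s₁ := hE'.put (by decide) (by decide)
    have ho : ∀ b i, i ≠ u.val → s₁.arr b i = s'.arr b i := fun b i hi => by simp [hs₁, hi]
    have h2 : s₁.arr 2 u = s.arr 5 u := by simp [hs₁, hu]
    have h3' : s₁.arr 3 u = s.arr 3 u := by simp [hs₁, hu]
    have h5 : s₁.arr 5 u = s.arr 5 u := by simp [hs₁, hu]
    have hv3 : s₁.var 3 = u := by simp [hs₁, h3]
    have hS : sset n s₁ 5 = sset n s 5 := by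
      rw [hs₁, sset_put_ne (by decide)]
      exact sset_congr (hfr 5 rfl)
    clear_value s₁
    refine Runs.ite (fun he => Runs.seq ?_) fun he => Runs.skip ⟨ho, h2, ?_⟩
    · simp only [Expr.eval, hv3, h5] at he
      refine (runs_countProg hE₁ hL (by decide) hv3).mono fun s₂ hf ⟨hc, _⟩ => ?_
      rw [hS] at hc
      have harr : s₂.arr = s₁.arr := funext fun a => hf.arr a rfl
      refine Runs.ite (fun he3 => Runs.store ?_) fun he3 => Runs.skip ?_
      · simp only [Expr.eval, hc] at he3
        simp only [Expr.eval, hf.var 3 rfl, hv3]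
        refine ⟨fun b i hi => ?_, ?_, ?_⟩
        · simp [hi, harr, ho]
        · simp [harr, h2]
        · simp only [State.put_arr_apply, and_self, if_true]
          exact ⟨fun _ => Or.inr ⟨he, by omega⟩, fun _ => by decide⟩
      · simp only [Expr.eval, hc] at he3
        rw [harr]
        refine ⟨ho, h2, ?_⟩
        rw [h3']
        exact ⟨Or.inl, fun h => h.resolve_right fun h' => by omega⟩
    · simp only [Expr.eval, hv3, h5] at he
      rw [h3']
      exact ⟨Or.inl, fun h => h.resolve_right fun h' => h'.1 he⟩
  · intro s' _ h
    refine ⟨?_, ?_⟩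
    · ext v
      simp [(h v).1]
    · ext v
      rw [mem_sset, (h v).2]
      simp

theorem runs_removeProg (hE : Env G k s) (hL : n ≤ L) :
    Runs L removeProg s fun s' => sset n s' 7 =
      (sset n s 4).filter fun v => v ∉ sset n s 5 ∧ dg G (sset n s 5) v = 0 := by
  refine (runs_cells hE hL rfl rfl (fun u c =>
    (c 7 ≠ 0 ↔ s.arr 4 u ≠ 0 ∧ s.arr 5 u = 0 ∧ dg G (sset n s 5) u = 0))
    fun u s' hE' h3 hfr hu => ?_).mono ?_
  · refine Runs.seq (Runs.store ?_)
    simp only [Expr.eval, h3]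
    set s₁ := s'.put 7 u 0 with hs₁
    have hE₁ : Env G k s₁ := hE'.put (by decide) (by decide)
    have ho : ∀ b i, i ≠ u.val → s₁.arr b i = s'.arr b i := fun b i hi => by simp [hs₁, hi]
    have h4 : s₁.arr 4 u = s.arr 4 u := by simp [hs₁, hu]
    have h5 : s₁.arr 5 u = s.arr 5 u := by simp [hs₁, hu]
    have h7 : s₁.arr 7 u = 0 := by simp [hs₁]
    have hv3 : s₁.var 3 = u := by simp [hs₁, h3]
    have hS : sset n s₁ 5 = sset n s 5 := by
      rw [hs₁, sset_put_ne (by decide)]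
      exact sset_congr (hfr 5 rfl)
    clear_value s₁
    refine Runs.ite (fun he => Runs.ite (fun he2 => Runs.skip ⟨ho, ?_⟩) fun he2 => Runs.seq ?_)
      fun he => Runs.skip ⟨ho, ?_⟩
    · simp only [Expr.eval, hv3, h5] at he2
      simp [h7, he2]
    · simp only [Expr.eval, hv3, h5, h4] at he he2
      refine (runs_countProg hE₁ hL (by decide) hv3).mono fun s₂ hf ⟨hc, _⟩ => ?_
      rw [hS] at hc
      have harr : s₂.arr = s₁.arr := funext fun a => hf.arr a rfl
      refine Runs.ite (fun he3 => Runs.skip ?_) fun he3 => Runs.store ?_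
      · simp only [Expr.eval, hc] at he3
        rw [harr]
        refine ⟨ho, ?_⟩
        simp [h7, he3]
      · simp only [Expr.eval, hc] at he3
        simp only [Expr.eval, hf.var 3 rfl, hv3]
        refine ⟨fun b i hi => ?_, ?_⟩
        · simp [hi, harr, ho]
        · simp [he, he2, he3]
    · simp only [Expr.eval, hv3, h4] at he
      simp [h7, he]
  · intro s' _ h
    ext v
    rw [mem_sset, h v]
    simp

end

end InducedPacking

/-! ### The two main loops: building and extraction. -/

namespace InducedPacking
open RAM

/-- The encoding of a list of cycles. -/
def encodeCycles {n : ℕ} (C : List (List (Fin n))) : List ℕ :=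
  C.flatMap fun l => l.length :: l.map Fin.val

theorem encodeCycles_snoc {n : ℕ} (C : List (List (Fin n))) (l : List (Fin n)) :
    encodeCycles (C ++ [l]) = encodeCycles C ++ l.length :: l.map Fin.val := by
  simp [encodeCycles]

/-- Stop (by clearing `20`) when `k` cycles have been counted in `19`. -/
def checkProg : Prog := .ite (.sub (.var 2) (.var 19)) .skip (.assign 20 (.const 0))

/-- Turn the ear that has been found into a part of `H`. -/
def earProg : Prog :=
  .seq (.store 5 (.sub (.var 8) (.const 1)) (.const 1)) <| .seq pruneProg <|
    .seq (.store 3 (.sub (.var 8) (.const 1)) (.const 1)) branchProg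

/-- Look for a cycle apart from `H`. -/
def apartProg : Prog :=
  .seq complProg <| .seq cycleProg <| .ite (.var 13)
    (.seq (.store 3 (.sub (.var 8) (.const 1)) (.const 1)) <| .seq joinProg <|
      .seq traceProg checkProg)
    (.assign 20 (.const 0))

/-- Build the structure `H` and the hitting set `X`. -/
def buildProg : Prog :=
  .seq (.assign 20 (.const 1)) <| .loop (.var 20) <|
    .seq setupProg <| .seq growProg <| .ite (.var 8) earProg apartProg

/-- Extract cycles from `H`. -/
def extractProg : Prog :=
  .seq (copyProg 2 7) <| .seq (.assign 14 (.const 0)) <| .seq (.assign 19 (.const 0)) <|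
  .seq (.assign 20 (.const 1)) <| .loop (.var 20) <|
    .seq (copyProg 7 5) <| .seq cycleProg <| .ite (.var 13)
      (.seq removeProg <| .seq traceProg checkProg) (.assign 20 (.const 0))

section

variable {n k : ℕ} {G : SimpleGraph (Fin n)} {s s' : State} {L : ℕ} [DecidableRel G.Adj]

variable (G) in
/-- The buffer holds the packing `C`. -/
structure Holds (C : List (List (Fin n))) (s : State) : Prop where
  packing : IsPackingList G C
  buf_eq : buf s = encodeCycles C
  count : s.var 19 = C.length

theorem Holds.congr {C : List (List (Fin n))} (h : Holds G C s) (h8 : s'.arr 8 = s.arr 8)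
    (h14 : s'.var 14 = s.var 14) (h19 : s'.var 19 = s.var 19) : Holds G C s' :=
  ⟨h.packing, by rw [← h.buf_eq, buf, buf, h8, h14], by rw [h19, h.count]⟩

variable (G k) in
/-- The invariant of `buildProg`. -/
structure Built (C : List (List (Fin n))) (e : ℕ) (s : State) : Prop where
  env : Env G k s
  inv : Inv G (sset n s 2) (sset n s 3) C.length e
  holds : Holds G C s
  mem : ∀ l ∈ C, ∀ v ∈ l, v ∈ sset n s 2
  lt : s.var 20 ≠ 0 → C.length < k
  final : s.var 20 = 0 → C.length = k ∨ C.length < k ∧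
    ∀ K : Finset (Fin n), Core G K → (∀ v ∈ K, v ∉ sset n s 3 ∧ dg G (sset n s 3) v = 0) → K = ∅

theorem runs_earProg (hL : n + 1 ≤ L) {C : List (List (Fin n))} {e : ℕ} {U H X : Finset (Fin n)}
    (hE : Env G k s) (hI : Inv G H X C.length e) (hX : sset n s 3 = X)
    (hU : ∀ v, v ∈ U ↔ v ∉ H ∧ v ∉ X ∧ dg G X v = 0)
    (hG : Grown G U H (sset n s 5) (depths n s)) {y : Fin n} (hy : s.var 8 = y + 1)
    (hyU : y ∈ U) (hyS : y ∉ sset n s 5) (hd : 2 ≤ dg G (sset n s 5) y) :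
    Runs L earProg s fun s' => Inv G (sset n s' 2) (sset n s' 3) C.length (e + 1) ∧
      H ⊆ sset n s' 2 ∧ insert y X ⊆ sset n s' 3 := by
  have hy' : s.var 8 - 1 = y.val := by omega
  have hd2 : dg G (sset n s 5) y = 2 := by
    refine le_antisymm (hG.dg_le_two (fun u hu _ => ?_) y hyU hyS) hd
    obtain ⟨h3, h4, h5⟩ := (hU u).1 hu
    exact hI.outside u h3 h4 h5
  refine Runs.seq (Runs.store (Runs.seq ?_))
  simp only [Expr.eval, hy']
  have hE₁ : Env G k (s.put 5 y 1) := hE.put (by decide) (by decide)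
  refine (runs_pruneProg hE₁ hL).mono fun s₂ hf₂ ⟨hP, hC⟩ => Runs.seq (Runs.store ?_)
  rw [sset_put_ne_zero _ (by decide)] at hP
  have hy₂ : s₂.var 8 - 1 = y.val := by rw [hf₂.var 8 rfl, State.put_var, hy']
  simp only [Expr.eval, hy₂]
  have hE₃ : Env G k (s₂.put 3 y 1) := (hE₁.frame hf₂ rfl).put (by decide) (by decide)
  have hX₃ : sset n (s₂.put 3 y 1) 3 = insert y X := by
    rw [sset_put_ne_zero _ (by decide), sset_congr (hf₂.arr 3 rfl), sset_put_ne (by decide), hX]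
  refine (runs_branchProg hE₃ (by omega)).mono fun s₄ hf₄ ⟨h2, h3⟩ => ?_
  rw [hX₃] at h3
  rw [sset_put_ne (by decide)] at h2 h3
  refine ⟨?_, ?_, ?_⟩
  · rw [h2]
    exact hI.ear hU hG hyU hyS hd2 hP hC h3
  · rw [h2]
    exact hP.core_subset hI.core (hG.subset.trans (Finset.subset_insert _ _))
  · rw [h3]
    exact Finset.subset_union_left

theorem runs_checkProg {C : List (List (Fin n))} (hE : Env G k s) (h : Holds G C s)
    (hC : C.length ≤ k) (h20 : s.var 20 ≠ 0) :
    Runs L checkProg s fun s' => (s'.var 20 ≠ 0 → C.length < k) ∧ (s'.var 20 = 0 → C.length = k) := by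
  refine Runs.ite (fun he => Runs.skip ?_) fun he => Runs.assign ?_
  · simp only [Expr.eval, hE.k_eq, h.count] at he
    exact ⟨fun _ => by omega, fun h => absurd h h20⟩
  · simp only [Expr.eval, hE.k_eq, h.count] at he
    exact ⟨fun h => absurd (by simp [Expr.eval]) h, fun _ => by omega⟩

theorem runs_apartProg (hL : n + 1 ≤ L) {C : List (List (Fin n))} {e : ℕ}
    {U H X S : Finset (Fin n)} {D : Fin n → ℕ}
    (hE : Env G k s) (hI : Inv G H X C.length e) (hH : sset n s 2 = H) (hX : sset n s 3 = X)
    (hB : Holds G C s) (hmem : ∀ l ∈ C, ∀ v ∈ l, v ∈ H) (hk : C.length < k) (h20 : s.var 20 ≠ 0)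
    (hU : ∀ v, v ∈ U ↔ v ∉ H ∧ v ∉ X ∧ dg G X v = 0) (hU4 : sset n s 4 = U) (hS : sset n s 5 = S)
    (hG : Grown G U H S D) (hclosed : ∀ u ∈ U, u ∉ S → dg G S u = 0) :
    Runs L apartProg s fun s' => ∃ C', Built k G C' e s' ∧
      (s'.var 20 ≠ 0 → X ⊆ sset n s' 3 ∧ ∃ y ∈ sset n s' 3, y ∉ X) := by
  refine Runs.seq ((runs_complProg hE (by omega)).mono fun s₁ hf₁ h5 => Runs.seq ?_)
  rw [hU4, hS] at h5
  have hE₁ := hE.frame hf₁ rfl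
  refine (runs_cycleProg hE₁ hL).mono fun s₂ hf₂ ⟨hP, hC, h0, hyes⟩ => ?_
  rw [h5] at hP
  have hE₂ := hE₁.frame hf₂ rfl
  have hB₂ : Holds G C s₂ := hB.congr (by rw [hf₂.arr 8 rfl, hf₁.arr 8 rfl])
    (by rw [hf₂.var 14 rfl, hf₁.var 14 rfl]) (by rw [hf₂.var 19 rfl, hf₁.var 19 rfl])
  have hH₂ : sset n s₂ 2 = H := by
    rw [sset_congr (hf₂.arr 2 rfl), sset_congr (hf₁.arr 2 rfl), hH]
  have hX₂ : sset n s₂ 3 = X := by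
    rw [sset_congr (hf₂.arr 3 rfl), sset_congr (hf₁.arr 3 rfl), hX]
  refine Runs.ite (fun he => ?_) fun he => Runs.assign ⟨C, ?_, by simp [Expr.eval]⟩
  · obtain ⟨y, hy, hZ⟩ := hyes he
    obtain ⟨hZH, hI'⟩ := hI.newCycle hU hG hclosed hP hC hZ
    have hyU : y ∈ U := (Finset.mem_sdiff.1 (hP.subset (hZ.subset hZ.mem))).1
    have hyX : y ∉ X := ((hU y).1 hyU).2.1
    have hy' : s₂.var 8 - 1 = y.val := by omega
    refine Runs.seq (Runs.store (Runs.seq ?_))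
    simp only [Expr.eval, hy']
    have hE₃ : Env G k (s₂.put 3 y 1) := hE₂.put (by decide) (by decide)
    -- The cycle is joined to `H` before it is traced, since tracing erases the set `5`.
    refine (runs_joinProg hE₃ (by omega)).mono fun s₄ hf₄ h2 => Runs.seq ?_
    rw [sset_put_ne (by decide), sset_put_ne (by decide), hH₂] at h2
    have hE₄ := hE₃.frame hf₄ rfl
    have hX₄ : sset n s₄ 3 = insert y X := by
      rw [sset_congr (hf₄.arr 3 rfl), sset_put_ne_zero _ (by decide), hX₂]
    have hZ₄ : sset n s₄ 5 = sset n s₂ 5 := by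
      rw [sset_congr (hf₄.arr 5 rfl), sset_put_ne (by decide)]
    have hB₄ : Holds G C s₄ := hB₂.congr
      (by rw [hf₄.arr 8 rfl, State.put_arr, if_neg (by decide)])
      (by rw [hf₄.var 14 rfl, State.put_var]) (by rw [hf₄.var 19 rfl, State.put_var])
    have h20₄ : s₄.var 20 = s.var 20 := by
      rw [hf₄.var 20 rfl, State.put_var, hf₂.var 20 rfl, hf₁.var 20 rfl]
    refine (runs_traceProg hE₄ hL (y := y) (by rw [hf₄.var 8 rfl, State.put_var, hy])
      (by rw [hZ₄]; exact hZ.mem) (by rw [hZ₄]; exact hZ.dg_eq)).mono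
      fun s₅ hf₅ ⟨l, hl, hlZ, hbuf, hcnt⟩ => ?_
    rw [hZ₄] at hlZ
    have hE₅ := hE₄.frame hf₅ rfl
    have hB₅ : Holds G (C ++ [l]) s₅ := by
      refine ⟨hB₄.packing.snoc hl fun l' hl' u hu w hw => ?_, ?_, ?_⟩
      · have h1 := hZH w (hlZ w hw)
        have h2 := hmem l' hl' u hu
        exact ⟨fun h => h1.1 (h ▸ h2), fun ha => dg_eq_zero.1 h1.2 u h2 ha.symm⟩
      · rw [hbuf, hB₄.buf_eq, encodeCycles_snoc]
      · rw [hcnt, hB₄.count]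
        simp
    refine (runs_checkProg hE₅ hB₅ (by simpa using hk)
      (by rw [hf₅.var 20 rfl, h20₄]; exact h20)).mono fun s₆ hf₆ ⟨hlt, hfin⟩ => ?_
    have hH₆ : sset n s₆ 2 = H ∪ sset n s₂ 5 := by
      rw [sset_congr (hf₆.arr 2 rfl), sset_congr (hf₅.arr 2 rfl), h2]
    have hX₆ : sset n s₆ 3 = insert y X := by
      rw [sset_congr (hf₆.arr 3 rfl), sset_congr (hf₅.arr 3 rfl), hX₄]
    refine ⟨C ++ [l], ⟨hE₅.frame hf₆ rfl, ?_, hB₅.congr (hf₆.arr 8 rfl) (hf₆.var 14 rfl)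
      (hf₆.var 19 rfl), ?_, hlt, fun h => Or.inl (hfin h)⟩, fun _ => ⟨?_, y, ?_, hyX⟩⟩
    · rw [hH₆, hX₆, List.length_append, List.length_singleton]
      exact hI'
    · rw [hH₆]
      intro l' hl' v hv
      rcases List.mem_append.1 hl' with h' | h'
      · exact Finset.mem_union_left _ (hmem l' h' v hv)
      · rw [List.mem_singleton.1 h'] at hv
        exact Finset.mem_union_right _ (hlZ v hv)
    · rw [hX₆]
      exact Finset.subset_insert _ _
    · rw [hX₆]
      exact Finset.mem_insert_self _ _
  · rw [h0 he] at hP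
    refine ⟨hE₂.set (by decide) (by decide), ?_, hB₂.congr rfl (by simp) (by simp), ?_,
      by simp [Expr.eval], fun _ => Or.inr ⟨hk, ?_⟩⟩
    · rw [sset_set, sset_set, hH₂, hX₂]
      exact hI
    · rw [sset_set, hH₂]
      exact hmem
    · rw [sset_set, hX₂]
      exact fun K hK hKX => hI.core_eq_empty hU hG hclosed hP hK hKX

theorem runs_buildProg (hL : n + 1 ≤ L) (hE : Env G k s) (hk : 0 < k) (h2 : s.arr 2 = fun _ => 0)
    (h3 : s.arr 3 = fun _ => 0) (h14 : s.var 14 = 0) (h19 : s.var 19 = 0) :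
    Runs L buildProg s fun s' => s'.var 20 = 0 ∧ ∃ C e, Built k G C e s' := by
  refine Runs.seq (Runs.assign ?_)
  -- Every round that does not stop the loop adds a new vertex to `X`, so `n - |X|` decreases; the
  -- number of rounds does not depend on `k`.
  refine (Runs.loop (fun m s' => (∃ C e, Built k G C e s') ∧
    (s'.var 20 ≠ 0 → n - (sset n s' 3).card < m)) ?_ (m := n + 1) hL ?_).mono ?_
  · rintro m s₁ ⟨⟨C, e, hB⟩, hm⟩ he
    simp only [Expr.eval] at he
    have hm' := hm he
    have hcard : ∀ {X' : Finset (Fin n)} {y : Fin n}, sset n s₁ 3 ⊆ X' → y ∈ X' →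
        y ∉ sset n s₁ 3 → n - X'.card < m - 1 := by
      intro X' y hX' hy hy'
      have h1 : (sset n s₁ 3).card < X'.card :=
        Finset.card_lt_card ⟨hX', fun h => hy' (h hy)⟩
      have h2 : X'.card ≤ n := (Finset.card_le_univ _).trans (by simp)
      omega
    refine Runs.seq ((runs_setupProg hB.env (by omega)).mono fun s₂ hf₂ ⟨h5, h6, h4⟩ => Runs.seq ?_)
    have hE₂ := hB.env.frame hf₂ rfl
    refine (runs_growProg hE₂ hL h6).mono fun s₃ hf₃ ⟨hG, hno, hyes⟩ => ?_
    rw [h5] at hG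
    have hE₃ := hE₂.frame hf₃ rfl
    have hH₃ : sset n s₃ 2 = sset n s₁ 2 := by
      rw [sset_congr (hf₃.arr 2 rfl), sset_congr (hf₂.arr 2 rfl)]
    have hX₃ : sset n s₃ 3 = sset n s₁ 3 := by
      rw [sset_congr (hf₃.arr 3 rfl), sset_congr (hf₂.arr 3 rfl)]
    have hB₃ : Holds G C s₃ := hB.holds.congr (by rw [hf₃.arr 8 rfl, hf₂.arr 8 rfl])
      (by rw [hf₃.var 14 rfl, hf₂.var 14 rfl]) (by rw [hf₃.var 19 rfl, hf₂.var 19 rfl])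
    have h20₃ : s₃.var 20 = s₁.var 20 := by rw [hf₃.var 20 rfl, hf₂.var 20 rfl]
    refine Runs.ite (fun he2 => ?_) fun he2 => ?_
    · obtain ⟨y, hy, hyU, hyS, hd⟩ := hyes he2
      refine (runs_earProg hL hE₃ hB.inv hX₃ h4 hG hy hyU hyS hd).mono
        fun s₄ hf₄ ⟨hI, hsub, hsub2⟩ => ?_
      have h20₄ : s₄.var 20 ≠ 0 := by rw [hf₄.var 20 rfl, h20₃]; exact he
      refine ⟨m - 1, by omega, ⟨C, e + 1, hE₃.frame hf₄ rfl, hI,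
        hB₃.congr (hf₄.arr 8 rfl) (hf₄.var 14 rfl) (hf₄.var 19 rfl),
        fun l hl v hv => hsub (hB.mem l hl v hv), fun _ => hB.lt he, fun h => absurd h h20₄⟩, fun _ =>
        hcard ((Finset.subset_insert _ _).trans hsub2) (hsub2 (Finset.mem_insert_self _ _))
          ((h4 y).1 hyU).2.1⟩
    · refine (runs_apartProg hL hE₃ hB.inv hH₃ hX₃ hB₃ hB.mem (hB.lt he) (by rw [h20₃]; exact he)
        h4 (sset_congr (hf₃.arr 4 rfl)) rfl hG (hno he2)).mono fun s₄ _ ⟨C', hB', hlt⟩ =>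
        ⟨m - 1, by omega, ⟨C', e, hB'⟩, fun h => ?_⟩
      obtain ⟨h1, y, h2, h3⟩ := hlt h
      exact hcard h1 h2 h3
  · have hH : sset n (s.set 20 1) 2 = ∅ := by ext u; simp [h2]
    have hX : sset n (s.set 20 1) 3 = ∅ := by ext u; simp [h3]
    refine ⟨⟨[], 0, hE.set (by decide) (by decide), ?_, ⟨.nil, ?_, ?_⟩, by simp, fun _ => hk,
      by simp [Expr.eval]⟩, fun _ => by omega⟩
    · simp only [Expr.eval]
      rw [hH, hX]
      exact Inv.empty
    · simp [buf, h14, encodeCycles]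
    · simp [h19]
  · rintro s' - ⟨h, m, h1, -⟩
    exact ⟨h, h1⟩

/-- Each extracted cycle costs at most `q` of `mu`. When the remaining set prunes to the empty set
its `mu` is at most zero, so all of `mu G H` was spent on the extracted cycles. Variables `14` and
`19` are reset, which discards the fewer than `k` cycles of the building phase. -/
theorem runs_extractProg (hL : n + 1 ≤ L) (hE : Env G k s) (hk : 0 < k) {H X : Finset (Fin n)}
    (hH : sset n s 2 = H) {c e : ℕ} (hI : Inv G H X c e) :
    Runs L extractProg s fun s' => ∃ C, Holds G C s' ∧ (C.length = k ∨ C.length < k ∧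
      mu G H ≤ 16 * (2 * Nat.log 2 (X.card + 1) + 3) * C.length) := by
  refine Runs.seq ((runs_copyProg hE (by omega) (by decide)).mono fun s₁ hf₁ h7 => ?_)
  have hE₁ := hE.frame hf₁ rfl
  rw [hH] at h7
  refine Runs.seq (Runs.assign (Runs.seq (Runs.assign (Runs.seq (Runs.assign ?_)))))
  simp only [Expr.eval]
  set q : ℤ := 16 * (2 * Nat.log 2 (X.card + 1) + 3) with hq
  refine (Runs.loop (fun m s' => Env G k s' ∧ ∃ C, Holds G C s' ∧ sset n s' 7 ⊆ H ∧
    (∀ l ∈ C, ∀ u ∈ l, ∀ w ∈ sset n s' 7, u ≠ w ∧ ¬ G.Adj u w) ∧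
    mu G H - q * C.length ≤ mu G (sset n s' 7) ∧
    (s'.var 20 ≠ 0 → C.length < k ∧ (sset n s' 7).card < m) ∧
    (s'.var 20 = 0 → C.length = k ∨ C.length < k ∧ mu G (sset n s' 7) ≤ 0)) ?_
    (m := n + 1) hL ?_).mono ?_
  · rintro m s₂ ⟨hE₂, C, hB, hWH, hap, hmu, hgo, -⟩ he
    simp only [Expr.eval] at he
    obtain ⟨hCk, hm⟩ := hgo he
    refine Runs.seq ((runs_copyProg hE₂ (by omega) (by decide)).mono fun s₃ hf₃ h5 => Runs.seq ?_)
    have hE₃ := hE₂.frame hf₃ rfl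
    refine (runs_cycleProg hE₃ hL).mono fun s₄ hf₄ ⟨hP, hC, h0, hyes⟩ => ?_
    rw [h5] at hP
    have hE₄ := hE₃.frame hf₄ rfl
    have hB₄ : Holds G C s₄ := hB.congr (by rw [hf₄.arr 8 rfl, hf₃.arr 8 rfl])
      (by rw [hf₄.var 14 rfl, hf₃.var 14 rfl]) (by rw [hf₄.var 19 rfl, hf₃.var 19 rfl])
    have hW₄ : sset n s₄ 7 = sset n s₂ 7 := by
      rw [sset_congr (hf₄.arr 7 rfl), sset_congr (hf₃.arr 7 rfl)]
    refine Runs.ite (fun he2 => ?_) fun he2 => Runs.assign ?_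
    · obtain ⟨y, hy, hZ⟩ := hyes he2
      refine Runs.seq ((runs_removeProg hE₄ (by omega)).mono fun s₅ hf₅ h7' => Runs.seq ?_)
      have hE₅ := hE₄.frame hf₅ rfl
      have hZ₅ : sset n s₅ 5 = sset n s₄ 5 := sset_congr (hf₅.arr 5 rfl)
      have hB₅ : Holds G C s₅ := hB₄.congr (hf₅.arr 8 rfl) (hf₅.var 14 rfl) (hf₅.var 19 rfl)
      refine (runs_traceProg hE₅ hL (y := y) (by rw [hf₅.var 8 rfl, hy])
        (by rw [hZ₅]; exact hZ.mem) (by rw [hZ₅]; exact hZ.dg_eq)).mono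
        fun s₆ hf₆ ⟨l, hl, hlZ, hbuf, hcnt⟩ => ?_
      rw [hZ₅] at hlZ
      have hE₆ := hE₅.frame hf₆ rfl
      have hlW : ∀ v ∈ l, v ∈ sset n s₂ 7 := fun v hv => hP.subset (hZ.subset (hlZ v hv))
      have hB₆ : Holds G (C ++ [l]) s₆ := by
        refine ⟨hB₅.packing.snoc hl fun l' hl' u hu w hw => hap l' hl' u hu w (hlW w hw), ?_, ?_⟩
        · rw [hbuf, hB₅.buf_eq, encodeCycles_snoc]
        · rw [hcnt, hB₅.count]
          simp
      have h20 : s₆.var 20 = s₂.var 20 := by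
        rw [hf₆.var 20 rfl, hf₅.var 20 rfl, hf₄.var 20 rfl, hf₃.var 20 rfl]
      refine (runs_checkProg hE₆ hB₆ (by simpa using hCk) (by rw [h20]; exact he)).mono
        fun s₇ hf₇ ⟨hlt, hfin⟩ => ?_
      have hW₇ : sset n s₇ 7 = (sset n s₄ 4).filter fun v =>
          v ∉ sset n s₄ 5 ∧ dg G (sset n s₄ 5) v = 0 := by
        rw [sset_congr (hf₇.arr 7 rfl), sset_congr (hf₆.arr 7 rfl), h7']
      have hsub : sset n s₇ 7 ⊆ sset n s₂ 7 := by
        rw [hW₇]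
        exact (Finset.filter_subset _ _).trans hP.subset
      -- The remaining set loses at least the cycle vertex `y`, so the loop ends within `n + 1`
      -- rounds.
      have hcard : (sset n s₇ 7).card < (sset n s₂ 7).card := by
        refine Finset.card_lt_card ⟨hsub, fun h => ?_⟩
        have := h (hP.subset (hZ.subset hZ.mem))
        rw [hW₇, Finset.mem_filter] at this
        exact this.2.1 hZ.mem
      refine ⟨m - 1, by omega, hE₆.frame hf₇ rfl, C ++ [l], hB₆.congr (hf₇.arr 8 rfl)
        (hf₇.var 14 rfl) (hf₇.var 19 rfl), hsub.trans hWH, ?_, ?_, fun h => ⟨hlt h, by omega⟩,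
        fun h => Or.inl (hfin h)⟩
      · intro l' hl' u hu w hw
        rcases List.mem_append.1 hl' with h' | h'
        · exact hap l' h' u hu w (hsub hw)
        · rw [List.mem_singleton.1 h'] at hu
          rw [hW₇, Finset.mem_filter] at hw
          exact ⟨fun h => hw.2.1 (h ▸ hlZ u hu), fun ha => dg_eq_zero.1 hw.2.2 u (hlZ u hu) ha.symm⟩
      · have h1 := hI.mu_extract hWH hP hZ
        rw [hW₇, List.length_append, List.length_singleton]
        push_cast
        rw [mul_add, mul_one]
        linarith
    · rw [h0 he2] at hP
      have hmu0 := hP.mu_le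
      rw [mu_empty] at hmu0
      refine ⟨0, by omega, hE₄.set (by decide) (by decide), C, hB₄.congr rfl (by simp) (by simp),
        ?_, ?_, ?_, by simp [Expr.eval], fun _ => Or.inr ⟨hCk, ?_⟩⟩
      · rw [sset_set, hW₄]
        exact hWH
      · rw [sset_set, hW₄]
        exact hap
      · rw [sset_set, hW₄]
        exact hmu
      · rw [sset_set, hW₄]
        exact hmu0
  · have hW : sset n (((s₁.set 14 0).set 19 0).set 20 1) 7 = H := h7
    refine ⟨((hE₁.set (by decide) (by decide)).set (by decide) (by decide)).set (by decide)
      (by decide), [], ⟨.nil, by simp [buf, encodeCycles], by simp⟩, hW.subset, by simp, ?_,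
      fun _ => ⟨hk, ?_⟩, by simp⟩
    · rw [hW]
      simp
    · exact Nat.lt_succ_of_le sset_card_le
  · rintro s' - ⟨h20, m, -, C, hB, -, -, hmu, -, hfin⟩
    refine ⟨C, hB, ?_⟩
    rcases hfin h20 with h | ⟨h1, h2⟩
    · exact Or.inl h
    · exact Or.inr ⟨h1, by linarith⟩

end

end InducedPacking

/-! ### Input, output, and the complete algorithm. -/

namespace InducedPacking
open RAM

/-- Read the parameters and tabulate the offsets of the rows of the adjacency matrix. -/
def initProg : Prog :=
  .seq (.assign 1 (.get 0 (.const 1))) <| .seq (.assign 2 (.get 0 (.const 0))) <|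
  .seq (.assign 21 (.const 2)) <| .forTo 3 1 <|
    .seq (.store 1 (.var 3) (.var 21)) (.assign 21 (.add (.var 21) (.var 1)))

/-- Print the packing or the hitting set. -/
def outputProg : Prog :=
  .ite (.sub (.var 2) (.var 19))
    (.seq (.print (.const 0)) <| .forTo 3 1 <| .ite (.get 3 (.var 3)) (.print (.var 3)) .skip)
    (.seq (.print (.const 1)) <| .forTo 3 14 <| .print (.get 8 (.var 3)))

/-- The algorithm. -/
def packingProg : Prog :=
  .seq initProg <| .seq buildProg <|
    .seq (.ite (.sub (.var 2) (.var 19)) extractProg .skip) outputProg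

theorem getD_flatMap {α β : Type*} (f : α → List β) (n : ℕ) (d : β) :
    ∀ (l : List α), (∀ a ∈ l, (f a).length = n) → ∀ (i : ℕ) (hi : i < l.length) (j : ℕ), j < n →
      (l.flatMap f).getD (i * n + j) d = (f l[i]).getD j d
  | [], _, i, hi, _, _ => absurd hi (by simp)
  | a :: l, h, 0, _, j, hj => by
    rw [List.flatMap_cons, zero_mul, zero_add, List.getD_append _ _ _ _ (by simp [h, hj])]
    rfl
  | a :: l, h, i + 1, hi, j, hj => by
    have ha := h a (by simp)
    rw [List.flatMap_cons, List.getD_append_right _ _ _ _ (by rw [ha]; nlinarith), ha,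
      show (i + 1) * n + j - n = i * n + j by rw [add_mul]; omega,
      getD_flatMap f n d l (fun b hb => h b (by simp [hb])) i (by simpa using hi) j hj]
    simp

theorem encode_getD (I : Instance) (u v : Fin I.n) :
    I.encode.getD (2 + u * I.n + v) 0 ≠ 0 ↔ I.G.Adj u v := by
  classical
  have h : I.encode.getD (2 + u * I.n + v) 0 = if I.G.Adj u v then 1 else 0 := by
    rw [Instance.encode, show 2 + u.val * I.n + v = (u * I.n + v) + 1 + 1 by ring,
      List.getD_cons_succ, List.getD_cons_succ,
      getD_flatMap _ I.n 0 _ (by simp) u (by simp) v v.2]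
    simp
  rw [h]
  split_ifs <;> simp_all

theorem n_le_inputSize (I : Instance) : I.n ≤ inputSize I.encode := by
  have h1 : I.encode.length = I.n * I.n + 2 := by
    simp [Instance.encode]
  have h2 : I.n ≤ I.n * I.n := Nat.le_mul_self _
  unfold inputSize
  omega

theorem runs_initProg (I : Instance) {L : ℕ} (hL : I.n ≤ L) :
    Runs L initProg (State.init I.encode) fun s => Env I.G I.k s := by
  refine Runs.seq (Runs.assign (Runs.seq (Runs.assign (Runs.seq (Runs.assign ?_)))))
  set s₀ := State.init I.encode with hs₀
  have hn : s₀.arr 0 1 = I.n := by simp [hs₀, State.init, Instance.encode]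
  have hk : s₀.arr 0 0 = I.k := by simp [hs₀, State.init, Instance.encode]
  simp only [Expr.eval, State.set_arr, hn, hk]
  refine (Runs.forTo (by decide) (n := I.n) (by simp) hL rfl rfl (fun j s =>
    s.var 1 = I.n ∧ s.var 2 = I.k ∧ s.var 21 = 2 + j * I.n ∧ s.arr 0 = s₀.arr 0 ∧
    ∀ v < j, s.arr 1 v = 2 + v * I.n) ?_ ?_ ?_).mono ?_
  · rintro j s v ⟨h1, h2, h3, h4, h5⟩
    exact ⟨by simpa using h1, by simpa using h2, by simpa using h3, h4, h5⟩
  · simp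
  · rintro j s hj h3 - ⟨h1, h2, h21, h0, hrow⟩
    refine Runs.seq (Runs.store (Runs.assign ⟨by simpa using h1, by simpa using h2, ?_, ?_, ?_⟩))
    · simp [Expr.eval, h1, h21]
      ring
    · rw [State.set_arr, State.put_arr, if_neg (by decide), h0]
    · intro v hv
      simp only [State.set_arr, State.put_arr_apply, Expr.eval, h3, h21, true_and]
      split_ifs with hvj
      · rw [hvj]
      · exact hrow v (by omega)
  · rintro s - ⟨h1, h2, -, h0, hrow⟩
    refine ⟨h1, h2, hrow, fun u v => ?_⟩
    rw [h0, ← encode_getD I u v]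
    simp [hs₀, State.init]

section

variable {n k : ℕ} {G : SimpleGraph (Fin n)} {s s' : State} {L : ℕ}

/-- Disjoint cycles have at most `n` vertices altogether. Each is nonempty, so the lengths add at
most `n` further entries. -/
theorem length_encodeCycles_le {C : List (List (Fin n))} (h : IsPackingList G C) :
    (encodeCycles C).length ≤ 2 * n := by
  have h1 : C.flatten.Nodup := by
    rw [List.nodup_flatten]
    refine ⟨fun l hl => (h.cycle l hl).nodup, h.apart.imp ?_⟩
    intro a b hab
    rw [List.disjoint_left]
    exact fun x hx hx' => (hab x hx x hx').1 rfl
  have h2 : C.flatten.length ≤ n := by simpa using h1.length_le_card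
  have h3 : ∀ C : List (List (Fin n)), (∀ l ∈ C, 1 ≤ l.length) →
      (encodeCycles C).length ≤ 2 * C.flatten.length := by
    intro C hC
    induction C with
    | nil => simp [encodeCycles]
    | cons l C ih =>
      have h4 := ih fun l' hl' => hC l' (by simp [hl'])
      have h5 := hC l (by simp)
      simp only [encodeCycles, List.flatMap_cons, List.length_append, List.length_cons,
        List.length_map, List.flatten_cons] at h4 ⊢
      omega
  have h4 := h3 C fun l hl => by have := (h.cycle l hl).three_le; omega
  omega

theorem runs_outputProg_hitting (hE : Env G k s) (hL : n ≤ L) (h19 : s.var 19 < k)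
    (hout : s.out = []) :
    Runs L outputProg s fun s' => ∃ X : List (Fin n), s'.out = 0 :: X.map Fin.val ∧
      X.toFinset = sset n s 3 := by
  refine Runs.ite (fun _ => ?_) fun he => absurd he (by simp only [Expr.eval, hE.k_eq]; omega)
  refine Runs.seq (Runs.print ?_)
  refine (Runs.forTo (by decide) (n := n) (by simp [hE.n_eq]) hL rfl rfl (fun j s' =>
    s'.arr = s.arr ∧ ∃ X : List (Fin n), s'.out = 0 :: X.map Fin.val ∧
      X.toFinset = (sset n s 3).filter fun v => v.val < j) ?_ ?_ ?_).mono ?_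
  · rintro j s' c ⟨h1, h2⟩
    exact ⟨h1, h2⟩
  · exact ⟨rfl, [], by simp [Expr.eval, hout], by simp⟩
  · rintro j s' hj h3 - ⟨harr, X, hX, hXs⟩
    rw [filter_lt_succ _ hj]
    refine Runs.ite (fun he => Runs.print ⟨harr, X ++ [⟨j, hj⟩], ?_, ?_⟩) fun he =>
      Runs.skip ⟨harr, X, hX, ?_⟩
    · simp [Expr.eval, hX, h3]
    · simp only [Expr.eval, h3, harr] at he
      rw [if_pos (by simpa using he), ← hXs]
      ext w
      simp
    · simp only [Expr.eval, h3, harr] at he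
      rw [if_neg (by simpa using he), hXs]
  · rintro s' - ⟨-, X, h1, h2⟩
    rw [filter_lt_self] at h2
    exact ⟨X, h1, h2⟩

theorem runs_outputProg_packing {C : List (List (Fin n))} [DecidableRel G.Adj] (hE : Env G k s)
    (hL : 2 * n ≤ L) (hB : Holds G C s) (hC : C.length = k) (hout : s.out = []) :
    Runs L outputProg s fun s' => s'.out = 1 :: encodeCycles C := by
  refine Runs.ite (fun he => absurd ?_ he) fun _ => ?_
  · simp only [Expr.eval, hE.k_eq, hB.count]
    omega
  refine Runs.seq (Runs.print ?_)
  have hlen : s.var 14 ≤ L := by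
    have h1 := length_encodeCycles_le hB.packing
    rw [← hB.buf_eq] at h1
    simp only [buf, List.length_map, List.length_range] at h1
    omega
  refine (Runs.forTo (by decide) (n := s.var 14) (by simp) hlen rfl rfl (fun j s' =>
    s'.arr = s.arr ∧ s'.out = 1 :: (List.range j).map (s.arr 8)) ?_ ?_ ?_).mono ?_
  · rintro j s' c ⟨h1, h2⟩
    exact ⟨h1, h2⟩
  · exact ⟨rfl, by simp [Expr.eval, hout]⟩
  · rintro j s' hj h3 - ⟨harr, h⟩
    refine Runs.print ⟨harr, ?_⟩
    simp [Expr.eval, h, harr, h3, List.range_succ]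
  · rintro s' - ⟨-, h⟩
    rw [h, ← hB.buf_eq, buf]

end

theorem runs_packingProg (I : Instance) {L : ℕ} (hL : 2 * I.n + 1 ≤ L) :
    Runs L packingProg (State.init I.encode) fun s => ∃ b : Candidate I,
      s.out = b.encode I ∧ b.Correct hitBound I := by
  classical
  refine Runs.seq ((runs_initProg I (by omega)).mono fun s₁ hf₁ hE₁ => Runs.seq ?_)
  refine (runs_buildProg (by omega) hE₁ I.k_pos ?_ ?_ ?_ ?_).mono
    fun s₂ hf₂ ⟨h20, C, e, hB⟩ => Runs.seq ?_
  · rw [hf₁.arr 2 rfl]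
    funext i
    simp [State.init]
  · rw [hf₁.arr 3 rfl]
    funext i
    simp [State.init]
  · rw [hf₁.var 14 rfl]
    simp [State.init]
  · rw [hf₁.var 19 rfl]
    simp [State.init]
  have hout₂ : s₂.out = [] := by
    rw [hf₂.out rfl, hf₁.out rfl]
    rfl
  have hpack : ∀ {C' : List (List (Fin I.n))} {s : State}, Env I.G I.k s → Holds I.G C' s →
      C'.length = I.k → s.out = [] → Runs L outputProg s fun s => ∃ b : Candidate I,
      s.out = b.encode I ∧ b.Correct hitBound I := by
    intro C' s hE hH hC' hout
    obtain ⟨b, hb, henc⟩ := hH.packing.exists_candidate hC' hitBound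
    exact (runs_outputProg_packing hE (by omega) hH hC' hout).mono
      fun s' _ h => ⟨b, by rw [h, henc]; rfl, hb⟩
  rcases hB.final h20 with hCk | ⟨hCk, hhit⟩
  · refine Runs.ite (fun he => absurd ?_ he) fun _ => Runs.skip (hpack hB.env hB.holds hCk hout₂)
    simp only [Expr.eval, hB.env.k_eq, hB.holds.count]
    omega
  · refine Runs.ite (fun _ => ?_) fun he => absurd he ?_
    · refine (runs_extractProg (by omega) hB.env I.k_pos rfl hB.inv).mono
        fun s₃ hf₃ ⟨C', hH, hC'⟩ => ?_
      have hE₃ := hB.env.frame hf₃ rfl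
      have hout₃ : s₃.out = [] := by rw [hf₃.out rfl, hout₂]
      rcases hC' with hC' | ⟨hC', hmu⟩
      · exact hpack hE₃ hH hC' hout₃
      · refine (runs_outputProg_hitting hE₃ (by omega) (by rw [hH.count]; exact hC') hout₃).mono
          fun s₄ _ ⟨X, hX, hXs⟩ => ⟨.hitting X, hX, ?_, ?_⟩
        · rw [sset_congr (hf₃.arr 3 rfl)] at hXs
          rw [hXs]
          refine le_hitBound I.k_pos ?_
          set x := (sset I.n s₂ 3).card with hx
          have h1 := hB.inv.mu_ge
          have h2 := hB.inv.card_le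
          set m := Nat.log 2 (x + 1)
          have h3 : (2 * e : ℤ) ≤ 16 * (2 * m + 3) * C'.length := h1.trans hmu
          have h4 : 2 * e ≤ 16 * (2 * m + 3) * C'.length := by exact_mod_cast h3
          have h5 : 16 * (2 * m + 3) * C'.length ≤ 16 * (2 * m + 3) * I.k :=
            Nat.mul_le_mul_left _ hC'.le
          have h6 : 16 * (2 * m + 3) * I.k = 16 * (I.k * (2 * m + 3)) := by ring
          have h7 : 24 * I.k * (2 * m + 3) = 24 * (I.k * (2 * m + 3)) := by ring
          omega
        · rw [sset_congr (hf₃.arr 3 rfl)] at hXs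
          refine isAcyclic_induce_compl_ball (X := sset I.n s₂ 3) (fun v hv => ?_) hhit
          rw [← hXs, List.mem_toFinset] at hv
          exact hv
    · simp only [Expr.eval, hB.env.k_eq, hB.holds.count]
      omega

end InducedPacking

theorem theorem1p1 :
    ∃ f : ℕ → ℕ,
      (fun k : ℕ => (f k : ℝ)) =O[atTop] (fun k : ℕ => (k : ℝ) * Real.log (k : ℝ)) ∧
      RAM.SolvableInPolyTime InducedPacking.Instance.encode InducedPacking.Candidate.encode
        (InducedPacking.Candidate.Correct f) := by
  refine ⟨InducedPacking.hitBound, InducedPacking.hitBound_isBigO, InducedPacking.packingProg,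
    InducedPacking.packingProg.boundPoly.comp (2 * Polynomial.X + 1), fun I => ?_⟩
  have hn := InducedPacking.n_le_inputSize I
  obtain ⟨s, t, hexec, ht, b, hout, hb⟩ := InducedPacking.runs_packingProg I
    (L := 2 * RAM.inputSize I.encode + 1) (by omega)
  refine ⟨b, s, t, hexec, ?_, hout, hb⟩
  rw [Polynomial.eval_comp]
  simpa [RAM.Prog.boundPoly_eval] using ht
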